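/- Let $N\ge1$ and $k\ge2$ be integers, $\chi$ a Dirichlet character modulo $N$, $\Gamma=\mathrm{SL}_2(\mathbb Z)$, $S=\begin{pmatrix}0&-1\\1&0\end{pmatrix}$, $\rho=e^{2\pi i/3}$, and let $f,g\in M_k(\Gamma_0(N),\chi)$ be modular forms, not necessarily cusp forms. The Petersson product is normalized by $$\langle f,g\rangle_{\Gamma_0(N)}=\frac1{[\Gamma:\Gamma_0(N)]}\int_{\Gamma_0(N)\backslash\mathbb H}f(\tau)\overline{g(\tau)}\,y^k\,\frac{dx\,dy}{y^2}\qquad(\tau=x+iy).$$ Let $\gamma_1,\dots,\gamma_r$ be any system of representatives with $\Gamma=\bigsqcup_{j=1}^r\Gamma_0(N)\gamma_j$, and set $f_j=f|_k\gamma_j$, $g_j=g|_k\gamma_j$. For $\alpha\in\Gamma$ let $\alpha(j)$ be the index with $\gamma_j\alpha\in\Gamma_0(N)\gamma_{\alpha(j)}$. Let $E\subseteq\{1,\dots,r\}$ be the set of $j$ such that $f_j(\tau)\to0$ as $\tau\to i\infty$, and $S(E)=\{S(j):j\in E\}$. For $A,B,C,D\in\mathbb H\cup\mathbb Q\cup\{i\infty\}$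 put $$G_j(A,B;C,D)=\int_{A}^{B}\int_{C}^{D}f_j(\tau)\,\overline{g_j(\tau_2)}\,(\tau-\overline{\tau_2})^{k-2}\,d\tau\,d\overline{\tau_2},$$ where $\tau$ runs from $A$ to $B$ and $\tau_2$ from $C$ to $D$ (along straight segments between points of $\mathbb H$ and along vertical lines to or from $i\infty$), and $I_n(A,B,h)=\int_A^B\tau^n h(\tau)\,d\tau$. The integral defining $\langle f,g\rangle_{\Gamma_0(N)}$ converges absolutely if and only if at each cusp of $\Gamma_0(N)$ at least one of $f$ and $g$ vanishes. Assume that this is the case. Then $$r(2i)^{k-1}\langle f,g\rangle_{\Gamma_0(N)}=S_1+S_2+S_3,$$ with $$S_1=\sum_{j\in E}G_j(\rho+1,i\infty;i,i+1),\qquad S_2=\sum_{j\notin E,\ j\in S(E)}G_j(\rho+1,\rho;i,i\infty),\qquad S_3=\sum_{j\notin E,\ j\notin S(E)}G_j(\rho,i;i\infty,0).$$ Moreover, for each term $G_j(A,B;C,D)$ occurring in these three sums, the single integrals $I_n(A,B,f_j)$ and $I_n(C,D,g_j)$, $0\le n\le k-2$, all converge absolutely, and $$G_j(A,B;C,D)=\sum_{n=0}^{k-2}(-1)^n\binom{k-2}{n}\,I_{k-2-n}(A,B,f_j)\,\overline{I_n(C,D,g_j)}.$$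 -/

import Mathlib

open UpperHalfPlane MeasureTheory CongruenceSubgroup Matrix.SpecialLinearGroup
open scoped MatrixGroups ModularForm ComplexConjugate Pointwise

noncomputable section

/-! ### Modular forms with character -/

/-- The space `M_k(Γ₀(N), χ)`: the modular forms `f` of weight `k` on `Γ₁(N)` such that
`f ∣[k] γ = χ(d) f` for every `γ = (a, b; c, d) ∈ Γ₀(N)`. -/
def modularFormsWithCharacter (N : ℕ) (χ : DirichletCharacter ℂ N) (k : ℤ) :
    Submodule ℂ (ModularForm ((Gamma1 N).map (mapGL ℝ)) k) where
  carrier := {f | ∀ γ ∈ Gamma0 N, (⇑f) ∣[k] γ = χ ((γ 1 1 : ℤ) : ZMod N) • (⇑f)}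
  add_mem' := by
    intro f g hf hg γ hγ
    rw [FunLike.coe_add, SlashAction.add_slash, hf γ hγ, hg γ hγ, smul_add]
  zero_mem' := by
    intro γ _
    rw [FunLike.coe_zero, SlashAction.zero_slash, smul_zero]
  smul_mem' := by
    intro c f hf γ hγ
    rw [FunLike.coe_smul, ModularForm.SL_smul_slash, hf γ hγ, smul_comm]

/-! ### Coset representatives -/

/-- A system `γ_1, …, γ_r` of representatives of the cosets `Γ₀(N) \ SL₂(ℤ)`, so that `SL₂(ℤ)` is
the disjoint union of the `Γ₀(N) γ_j`. -/
structure CosetReps (N : ℕ) where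
  /-- The number of cosets. -/
  r : ℕ
  /-- The representatives. -/
  rep : Fin r → SL(2, ℤ)
  existsUnique : ∀ γ : SL(2, ℤ), ∃! j, γ * (rep j)⁻¹ ∈ Gamma0 N

/-- The index `α(j)` with `γ_j α ∈ Γ₀(N) γ_{α(j)}`. -/
def CosetReps.act {N : ℕ} (R : CosetReps N) (α : SL(2, ℤ)) (j : Fin R.r) : Fin R.r :=
  (R.existsUnique (R.rep j * α)).choose

/-- The functions `f_j = f ∣[k] γ_j`. -/
def CosetReps.translate {N : ℕ} (R : CosetReps N) (k : ℕ) (f : ℍ → ℂ) (j : Fin R.r) : ℍ → ℂ :=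
  f ∣[(k : ℤ)] R.rep j

open Classical in
/-- The set `E` of indices `j` such that `f_j` vanishes at `i∞`. -/
def CosetReps.vanishing {N : ℕ} (R : CosetReps N) (k : ℕ) (f : ℍ → ℂ) : Finset (Fin R.r) :=
  Finset.univ.filter fun j => IsZeroAtImInfty (R.translate k f j)

/-! ### The Petersson product -/

/-- `F` is a fundamental domain for the action of `Γ₀(N)` on `ℍ`, with respect to the hyperbolic
measure `dx dy / y²` (which is `volume` on `ℍ`). The group that acts is the image of `Γ₀(N)` in the
group of permutations of `ℍ`, because `-1 ∈ Γ₀(N)` acts trivially. -/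
def IsFundamentalDomainGamma0 (N : ℕ) (F : Set ℍ) : Prop :=
  IsFundamentalDomain ((Gamma0 N).map (MulAction.toPermHom SL(2, ℤ) ℍ)) F volume

/-- The integrand `f(τ) conj(g(τ)) y^k` of the Petersson product. -/
def peterssonIntegrand (k : ℕ) (f g : ℍ → ℂ) (τ : ℍ) : ℂ :=
  f τ * conj (g τ) * (τ.im : ℂ) ^ k

/-- Convergence of the Petersson product, over a fundamental domain `F`. -/
def PeterssonConverges (k : ℕ) (F : Set ℍ) (f g : ℍ → ℂ) : Prop :=
  IntegrableOn (peterssonIntegrand k f g) F volume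

/-- The Petersson product
`⟨f, g⟩ = [SL₂(ℤ) : Γ₀(N)]⁻¹ ∫_{Γ₀(N) \ ℍ} f(τ) conj(g(τ)) y^k dx dy / y²`, the integral being taken
over a fundamental domain `F` of `Γ₀(N)`. -/
def peterssonProduct (N k : ℕ) (F : Set ℍ) (f g : ℍ → ℂ) : ℂ :=
  ((Gamma0 N).index : ℂ)⁻¹ * ∫ τ in F, peterssonIntegrand k f g τ

/-- At each cusp of `Γ₀(N)`, at least one of `f` and `g` vanishes. -/
def VanishAtEachCusp (N k : ℕ) (f g : ℍ → ℂ) : Prop :=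
  ∀ c : OnePoint ℝ, IsCusp c ((Gamma0 N).map (mapGL ℝ)) →
    OnePoint.IsZeroAt c f k ∨ OnePoint.IsZeroAt c g k

/-! ### Line integrals in the completed upper half-plane -/

/-- The completed upper half-plane `ℍ ∪ ℚ ∪ {i∞}`. -/
inductive CompletedHalfPlane where
  | pt (z : ℍ)
  | rat (q : ℚ)
  | infty

namespace CompletedHalfPlane

/-- The path from `A` to `B` along which we integrate, with the open interval that parametrizes it:
* between two points of `ℍ`, or a point of `ℍ` and a rational number: the straight segment;
* between two rational numbers: the half-circle in `ℍ` that they span;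
* to `i∞`, or from `i∞`: the vertical half-line, upwards or downwards.
The interior of the path lies in `ℍ` (when `A ≠ B`). -/
def path : CompletedHalfPlane → CompletedHalfPlane → Set ℝ × (ℝ → ℂ)
  | pt a, pt b => (Set.Ioo 0 1, fun t => a + t * (b - a))
  | pt a, rat b => (Set.Ioo 0 1, fun t => a + t * (b - a))
  | rat a, pt b => (Set.Ioo 0 1, fun t => a + t * (b - a))
  | rat a, rat b => (Set.Ioo 0 1, fun t => (a + b) / 2 - (b - a) / 2 * Real.cos (Real.pi * t)
      + |((b - a) / 2 : ℝ)| * Real.sin (Real.pi * t) * Complex.I)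
  | pt a, infty => (Set.Ioi 0, fun t => a + t * Complex.I)
  | rat a, infty => (Set.Ioi 0, fun t => a + t * Complex.I)
  | infty, pt b => (Set.Iio 0, fun t => b - t * Complex.I)
  | infty, rat b => (Set.Iio 0, fun t => b - t * Complex.I)
  | infty, infty => (∅, fun _ => 0)

/-- The pull-back of the form `h(τ) dτ` to the path from `A` to `B`. -/
def pullback (A B : CompletedHalfPlane) (h : ℍ → ℂ) (t : ℝ) : ℂ :=
  h (ofComplex ((path A B).2 t)) * deriv (path A B).2 t

/-- The integral `∫_A^B h(τ) dτ`. -/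
def integral (A B : CompletedHalfPlane) (h : ℍ → ℂ) : ℂ :=
  ∫ t in (path A B).1, pullback A B h t

/-- The integral `∫_A^B h(τ) dτ` converges (absolutely). -/
def IntegralConverges (A B : CompletedHalfPlane) (h : ℍ → ℂ) : Prop :=
  IntegrableOn (pullback A B h) (path A B).1 volume

/-- The integral `∫_A^B h(τ) d conj(τ)`. -/
def conjIntegral (A B : CompletedHalfPlane) (h : ℍ → ℂ) : ℂ :=
  ∫ t in (path A B).1, h (ofComplex ((path A B).2 t)) * conj (deriv (path A B).2 t)

end CompletedHalfPlane

open CompletedHalfPlane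

/-- `G(A, B; C, D) = ∫_A^B ∫_C^D f(τ) conj(g(τ₂)) (τ - conj(τ₂))^{k-2} dτ d conj(τ₂)`,
where `τ` goes from `A` to `B` and `τ₂` goes from `C` to `D`. -/
def doubleIntegral (k : ℕ) (f g : ℍ → ℂ) (A B C D : CompletedHalfPlane) : ℂ :=
  integral A B fun τ => conjIntegral C D fun τ₂ =>
    f τ * conj (g τ₂) * ((τ : ℂ) - conj (τ₂ : ℂ)) ^ (k - 2)

/-- The form `τ^n f(τ)`. -/
def powMul (n : ℕ) (f : ℍ → ℂ) (τ : ℍ) : ℂ := (τ : ℂ) ^ n * f τ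

/-- The single integral `I_n(A, B, f) = ∫_A^B τ^n f(τ) dτ`. -/
def singleIntegral (n : ℕ) (A B : CompletedHalfPlane) (f : ℍ → ℂ) : ℂ :=
  integral A B (powMul n f)

/-- The binomial expansion of `G(A, B; C, D)` as a linear combination of products of two single
integrals holds, and all these single integrals converge. -/
def ReducesToSingleIntegrals (k : ℕ) (f g : ℍ → ℂ) (A B C D : CompletedHalfPlane) : Prop :=
  (∀ n ≤ k - 2, IntegralConverges A B (powMul n f)) ∧
  (∀ n ≤ k - 2, IntegralConverges C D (powMul n g)) ∧
  doubleIntegral k f g A B C D = ∑ n ∈ Finset.range (k - 1),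
    (-1 : ℂ) ^ n * ((k - 2).choose n : ℂ) *
      (singleIntegral (k - 2 - n) A B f * conj (singleIntegral n C D g))

/-- The cusp `i∞`. -/
def ptInfty : CompletedHalfPlane := infty

/-- The cusp `0`. -/
def ptZero : CompletedHalfPlane := rat 0

/-- The point `i`. -/
def ptI : CompletedHalfPlane := pt UpperHalfPlane.I

/-- The point `i + 1`. -/
def ptI1 : CompletedHalfPlane := pt ((1 : ℝ) +ᵥ UpperHalfPlane.I)

/-- The point `ρ = e^{2πi/3} = (-1 + i√3) / 2`. -/
def ptRho : CompletedHalfPlane := pt UpperHalfPlane.ρ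

/-- The point `ρ + 1`. -/
def ptRho1 : CompletedHalfPlane := pt ((1 : ℝ) +ᵥ UpperHalfPlane.ρ)

end

section

/-! ### Growth in a vertical strip -/

/-! Write k = m + 2. Unfolding over the cosets turns the left side into the sum over j of 2i ∫ f_j
conj(g_j) (z - conj z)^m dx dy over the standard fundamental domain of SL₂(ℤ), because (2iy)^m = (z
- conj z)^m. The integrand comes from an exact form. If G_n is a primitive of z^n g_j, the Eichler
integral E(w, z) = ∑ (-1)^n C(m,n) w^(m-n) G_n(z) is a primitive of g_j(z) (w - z)^m, and the
`potential` W_j(z) = f_j(z) conj(E(conj z, z)) has ∂W_j/∂(conj z) = f_j conj(g_j) (z - conj z)^m. By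
Stokes (`stokes_fundamentalDomain`) only integrals of W_j dz over the vertical sides and the arc
from ρ to ρ + 1 remain.

The constants of integration are chosen according to E. For j ∈ E the G_n vanish at i, and W_j
decays because f_j does. For j ∉ E the form g_j vanishes at i∞, and the G_n are normalized there, so
that again W_j decays. Hence the top of the domain contributes nothing.

The matrices T and S permute the f_j and the g_j up to common factors of absolute value 1. Matching
the right side for j with the left side for T(j) leaves f_j times the period polynomial of g_j from
i to i + 1 if j ∈ E, and 0 otherwise: this is S₁ (`sum_vertical`). On the arc, S exchanges the two
halves and combines W_j with W_{S(j)} into f_j times the period polynomial of g_j between the base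
point of j and the image under S of the base point of S(j). These periods run from i to i, from i∞
to i, or from i∞ to 0; they give 0, S₂ and S₃ (`sum_arc`).

For the convergence criterion, all f_j and g_j have limits at i∞. If both limits are nonzero, the
integrand is bounded below on a set of infinite measure; otherwise it decays exponentially
(`CosetReps.integrableOn_translate_iff`). -/

/-- The closed vertical strip `|Re z| ≤ 2`, `Im z ≥ 1/2`. -/
def cuspStrip : Set ℂ := {z | |z.re| ≤ 2 ∧ 1 / 2 ≤ z.im}

/-- In the vertical strip, `h` is `O(exp (c Im z))`. -/
def ExpBound (c : ℝ) (h : ℂ → ℂ) : Prop :=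
  ∃ C : ℝ, ∀ z ∈ cuspStrip, ‖h z‖ ≤ C * Real.exp (c * z.im)

/-- `h` has subexponential growth in the vertical strip. -/
def SubExp (h : ℂ → ℂ) : Prop := ∀ ε > 0, ExpBound ε h

/-- `h` decays exponentially in the vertical strip. -/
def ExpDecay (h : ℂ → ℂ) : Prop := ∃ c > 0, ExpBound (-c) h

theorem convex_cuspStrip : Convex ℝ cuspStrip := by
  have h : cuspStrip = (Complex.reLm ⁻¹' Set.Icc (-2) 2) ∩ (Complex.imLm ⁻¹' Set.Ici (1 / 2)) := by
    ext z; simp [cuspStrip, abs_le]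
  rw [h]
  exact ((convex_Icc _ _).linear_preimage _).inter ((convex_Ici _).linear_preimage _)

theorem im_pos_of_mem_cuspStrip {z : ℂ} (hz : z ∈ cuspStrip) : 0 < z.im := by
  linarith [hz.2]

theorem I_mem_cuspStrip : Complex.I ∈ cuspStrip := by
  constructor <;> norm_num

variable {a b c : ℝ} {h h₁ h₂ : ℂ → ℂ}

theorem ExpBound.mono (H : ExpBound a h) (hab : a ≤ b) : ExpBound b h := by
  obtain ⟨C, hC⟩ := H
  refine ⟨|C|, fun z hz => (hC z hz).trans ?_⟩
  have := im_pos_of_mem_cuspStrip hz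
  gcongr
  exact le_abs_self C

theorem ExpBound.congr (H : ExpBound a h₁) (e : ∀ z ∈ cuspStrip, h₁ z = h₂ z) :
    ExpBound a h₂ := by
  obtain ⟨C, hC⟩ := H
  exact ⟨C, fun z hz => e z hz ▸ hC z hz⟩

theorem ExpBound.mul (H₁ : ExpBound a h₁) (H₂ : ExpBound b h₂) :
    ExpBound (a + b) fun z => h₁ z * h₂ z := by
  obtain ⟨C, hC⟩ := H₁
  obtain ⟨D, hD⟩ := H₂
  refine ⟨C * D, fun z hz => ?_⟩
  rw [norm_mul, add_mul, Real.exp_add, mul_mul_mul_comm]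
  exact mul_le_mul (hC z hz) (hD z hz) (norm_nonneg _) ((norm_nonneg _).trans (hC z hz))

theorem ExpBound.add (H₁ : ExpBound a h₁) (H₂ : ExpBound a h₂) :
    ExpBound a fun z => h₁ z + h₂ z := by
  obtain ⟨C, hC⟩ := H₁
  obtain ⟨D, hD⟩ := H₂
  refine ⟨C + D, fun z hz => (norm_add_le _ _).trans ?_⟩
  rw [add_mul]
  exact add_le_add (hC z hz) (hD z hz)

theorem ExpBound.conj (H : ExpBound a h) : ExpBound a fun z => conj (h z) := by
  simpa only [ExpBound, RCLike.norm_conj] using H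

theorem expBound_const (w : ℂ) : ExpBound 0 fun _ => w := ⟨‖w‖, by simp⟩

theorem SubExp.conj (H : SubExp h) : SubExp fun z => conj (h z) := fun ε hε => (H ε hε).conj

theorem SubExp.mul (H₁ : SubExp h₁) (H₂ : SubExp h₂) : SubExp fun z => h₁ z * h₂ z := by
  intro ε hε
  have := (H₁ (ε / 2) (by positivity)).mul (H₂ (ε / 2) (by positivity))
  rwa [add_halves] at this

theorem SubExp.add (H₁ : SubExp h₁) (H₂ : SubExp h₂) : SubExp fun z => h₁ z + h₂ z :=
  fun ε hε => (H₁ ε hε).add (H₂ ε hε)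

theorem subExp_const (w : ℂ) : SubExp fun _ => w := fun _ hε => (expBound_const w).mono hε.le

theorem subExp_id : SubExp fun z => z := by
  intro ε hε
  -- The 2 bounds |Re z| in the strip; 1 / ε comes from εy ≤ exp(εy).
  refine ⟨2 + 1 / ε, fun z hz => ?_⟩
  have hy := im_pos_of_mem_cuspStrip hz
  have h1 : 1 ≤ Real.exp (ε * z.im) := Real.one_le_exp (by positivity)
  have h2 : z.im ≤ 1 / ε * Real.exp (ε * z.im) := by
    have := Real.add_one_le_exp (ε * z.im)
    rw [div_mul_eq_mul_div, one_mul, le_div_iff₀ hε]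
    linarith
  have h3 := Complex.norm_le_abs_re_add_abs_im z
  rw [abs_of_pos hy] at h3
  have h4 := hz.1
  nlinarith

theorem SubExp.pow (H : SubExp h) (n : ℕ) : SubExp fun z => h z ^ n := by
  induction n with
  | zero => simpa using subExp_const 1
  | succ n ih => simpa only [pow_succ] using ih.mul H

theorem SubExp.sum {ι : Type*} {s : Finset ι} {H : ι → ℂ → ℂ} (hH : ∀ i ∈ s, SubExp (H i)) :
    SubExp fun z => ∑ i ∈ s, H i z := by
  classical
  induction s using Finset.induction_on with
  | empty => simpa using subExp_const 0
  | insert i s hi ih =>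
    simp only [Finset.sum_insert hi]
    exact (hH i (by simp)).add (ih fun j hj => hH j (by simp [hj]))

theorem ExpDecay.mul_subExp (H₁ : ExpDecay h₁) (H₂ : SubExp h₂) :
    ExpDecay fun z => h₁ z * h₂ z := by
  obtain ⟨c, hc, H⟩ := H₁
  refine ⟨c / 2, by positivity, ?_⟩
  have := H.mul (H₂ (c / 2) (by positivity))
  rwa [show -c + c / 2 = -(c / 2) by ring] at this

theorem SubExp.mul_expDecay (H₁ : SubExp h₁) (H₂ : ExpDecay h₂) :
    ExpDecay fun z => h₁ z * h₂ z := by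
  simpa only [mul_comm] using H₂.mul_subExp H₁

theorem ExpDecay.conj (H : ExpDecay h) : ExpDecay fun z => conj (h z) := by
  obtain ⟨c, hc, H⟩ := H
  exact ⟨c, hc, H.conj⟩

theorem ExpDecay.add (H₁ : ExpDecay h₁) (H₂ : ExpDecay h₂) : ExpDecay fun z => h₁ z + h₂ z := by
  obtain ⟨c, hc, H₁⟩ := H₁
  obtain ⟨d, hd, H₂⟩ := H₂
  exact ⟨min c d, lt_min hc hd, (H₁.mono (neg_le_neg (min_le_left _ _))).add
    (H₂.mono (neg_le_neg (min_le_right _ _)))⟩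

theorem ExpDecay.sum {ι : Type*} {s : Finset ι} {H : ι → ℂ → ℂ} (hH : ∀ i ∈ s, ExpDecay (H i)) :
    ExpDecay fun z => ∑ i ∈ s, H i z := by
  classical
  induction s using Finset.induction_on with
  | empty => exact ⟨1, one_pos, 0, by simp⟩
  | insert i s hi ih =>
    simp only [Finset.sum_insert hi]
    exact (hH i (by simp)).add (ih fun j hj => hH j (by simp [hj]))

theorem ExpDecay.tendsto_zero {ι : Type*} {l : Filter ι} (H : ExpDecay h) {u : ι → ℂ}
    (hu : ∀ᶠ t in l, u t ∈ cuspStrip) (hu' : Filter.Tendsto (fun t => (u t).im) l Filter.atTop) :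
    Filter.Tendsto (fun t => h (u t)) l (nhds 0) := by
  obtain ⟨c, hc, C, hC⟩ := H
  refine squeeze_zero_norm' (hu.mono fun t ht => hC _ ht) ?_
  have : Filter.Tendsto (fun t => -c * (u t).im) l Filter.atBot :=
    hu'.const_mul_atTop_of_neg (by linarith)
  simpa using (Real.tendsto_exp_atBot.comp this).const_mul C

/-! ### Primitives in the upper half-plane -/

/-- `G` is a primitive of `h` in the upper half-plane. -/
def IsPrimitive (h G : ℂ → ℂ) : Prop := ∀ z : ℂ, 0 < z.im → HasDerivAt G (h z) z

theorem convex_im_pos : Convex ℝ {z : ℂ | 0 < z.im} := convex_halfSpace_im_gt 0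

theorem isOpen_im_pos : IsOpen {z : ℂ | 0 < z.im} := isOpen_lt continuous_const Complex.continuous_im

theorem exists_isPrimitive (hh : DifferentiableOn ℂ h {z | 0 < z.im}) :
    ∃ G, IsPrimitive h G ∧ G Complex.I = 0 := by
  obtain ⟨G, hG⟩ := convex_im_pos.exists_forall_hasDerivWithinAt hh
  refine ⟨fun z => G z - G Complex.I, fun z hz => ?_, sub_self _⟩
  exact ((hG z hz).hasDerivAt (isOpen_im_pos.mem_nhds hz)).sub_const _

theorem IsPrimitive.sub_const {G : ℂ → ℂ} (hG : IsPrimitive h G) (w : ℂ) :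
    IsPrimitive h fun z => G z - w := fun z hz => (hG z hz).sub_const w

/-- The difference of two primitives has derivative 0 on a convex set. In this form the constant can
be evaluated at any convenient point, or in the limit at a cusp. -/
theorem IsPrimitive.sub_eq_sub {G G' : ℂ → ℂ} (hG : IsPrimitive h G) (hG' : IsPrimitive h G')
    {z w : ℂ} (hz : 0 < z.im) (hw : 0 < w.im) : G z - G' z = G w - G' w := by
  have hd : ∀ x ∈ {z : ℂ | 0 < z.im}, HasDerivWithinAt (fun z => G z - G' z) 0 {z | 0 < z.im} x := by
    intro x hx
    simpa using! ((hG x hx).sub (hG' x hx)).hasDerivWithinAt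
  have := convex_im_pos.norm_image_sub_le_of_norm_hasDerivWithin_le (C := 0) hd (by simp) hw hz
  rw [zero_mul, norm_le_zero_iff, sub_eq_zero] at this
  exact this

theorem IsPrimitive.norm_sub_le {G : ℂ → ℂ} (hG : IsPrimitive h G) {s : Set ℂ} (hs : Convex ℝ s)
    (hs' : ∀ z ∈ s, 0 < z.im) {C : ℝ} (hC : ∀ z ∈ s, ‖h z‖ ≤ C) {z w : ℂ} (hz : z ∈ s) (hw : w ∈ s) :
    ‖G w - G z‖ ≤ C * ‖w - z‖ :=
  hs.norm_image_sub_le_of_norm_hasDerivWithin_le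
    (fun x hx => (hG x (hs' x hx)).hasDerivWithinAt) hC hz hw

/-- Half of ε pays for the growth of h, the other half for the linear factor |z - i| in the mean
value inequality. -/
theorem IsPrimitive.subExp {G : ℂ → ℂ} (hG : IsPrimitive h G) (hh : SubExp h) : SubExp G := by
  intro ε hε
  obtain ⟨C, hC⟩ := hh (ε / 2) (by positivity)
  have key : ExpBound ε fun z => G z - G Complex.I := by
    obtain ⟨D, hD⟩ := (subExp_id.add (subExp_const (-Complex.I))) (ε / 2) (by positivity)
    refine ⟨|C| * Real.exp (ε / 2) * D, fun z hz => ?_⟩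
    -- The bound for h grows with the height, so the strip is cut at a height that still leaves both
    -- z and i inside.
    have hs : Convex ℝ (cuspStrip ∩ {w | w.im ≤ z.im + 1}) :=
      convex_cuspStrip.inter (convex_halfSpace_im_le _)
    have h0 := im_pos_of_mem_cuspStrip hz
    have := hG.norm_sub_le hs (fun w hw => im_pos_of_mem_cuspStrip hw.1)
      (C := |C| * Real.exp (ε / 2 * (z.im + 1))) (fun w hw => (hC w hw.1).trans ?_)
      (z := Complex.I) (w := z) ⟨I_mem_cuspStrip, by simp [h0.le]⟩ ⟨hz, by simp⟩
    · refine this.trans ?_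
      have h1 := hD z hz
      simp only [← sub_eq_add_neg] at h1
      calc _ ≤ |C| * Real.exp (ε / 2 * (z.im + 1)) * (D * Real.exp (ε / 2 * z.im)) := by gcongr
        _ = _ := by
          rw [show ε * z.im = ε / 2 * z.im + ε / 2 * z.im by ring,
            show ε / 2 * (z.im + 1) = ε / 2 + ε / 2 * z.im by ring, Real.exp_add, Real.exp_add]
          ring
    · have := hw.2
      simp only [Set.mem_ofPred_eq] at this
      gcongr
      exact le_abs_self C
  have := key.add ((subExp_const (G Complex.I)) ε hε)
  simpa using this

/-- The decay of h makes its integral up the imaginary axis converge, which defines L. The mean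
value inequality on the part of the strip above height Im z extends the estimate horizontally. -/
theorem IsPrimitive.exists_expDecay_sub {G : ℂ → ℂ} (hG : IsPrimitive h G) (hh : ExpDecay h)
    (hc : ContinuousOn h {z | 0 < z.im}) : ∃ L, ExpDecay fun z => G z - L := by
  obtain ⟨c, hcpos, C, hC⟩ := hh
  have hmem : ∀ t : ℝ, 1 / 2 ≤ t → (t : ℂ) * Complex.I ∈ cuspStrip := fun t ht => by
    constructor <;> simp; simpa using ht
  have hd : ∀ t : ℝ, 1 / 2 ≤ t →
      HasDerivAt (fun t : ℝ => G (t * Complex.I)) (h (t * Complex.I) * Complex.I) t := by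
    intro t ht
    have h1 : HasDerivAt (fun t : ℝ => (t : ℂ) * Complex.I) Complex.I t := by
      simpa using (Complex.ofRealCLM.hasDerivAt (x := t)).mul_const Complex.I
    exact (hG _ (im_pos_of_mem_cuspStrip (hmem t ht))).comp t h1
  have hexp : IntegrableOn (fun t : ℝ => C * Real.exp (-c * t)) (Set.Ioi (1 / 2)) :=
    (integrableOn_exp_mul_Ioi (by linarith) _).const_mul C
  have hcont : ContinuousOn (fun t : ℝ => h (t * Complex.I) * Complex.I) (Set.Ici (1 / 2)) := by
    refine (hc.comp (by fun_prop) fun t ht => ?_).mul continuousOn_const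
    exact im_pos_of_mem_cuspStrip (hmem t ht)
  have hb : ∀ t : ℝ, 1 / 2 ≤ t → ‖h (t * Complex.I) * Complex.I‖ ≤ C * Real.exp (-c * t) := by
    intro t ht
    simpa using hC _ (hmem t ht)
  have hint : IntegrableOn (fun t : ℝ => h (t * Complex.I) * Complex.I) (Set.Ioi (1 / 2)) := by
    refine hexp.mono' ((hcont.mono Set.Ioi_subset_Ici_self).aestronglyMeasurable measurableSet_Ioi) ?_
    exact (ae_restrict_iff' measurableSet_Ioi).2 (.of_forall fun t ht => hb t (le_of_lt ht))
  have hlim := tendsto_limUnder_of_hasDerivAt_of_integrableOn_Ioi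
    (fun t ht => hd t (le_of_lt ht)) hint
  set L := Filter.atTop.limUnder fun t : ℝ => G (t * Complex.I)
  have hvert : ∀ t : ℝ, 1 / 2 ≤ t → ‖G (t * Complex.I) - L‖ ≤ C / c * Real.exp (-c * t) := by
    intro t ht
    have hsub : Set.Ioi t ⊆ Set.Ioi (1 / 2) := Set.Ioi_subset_Ioi ht
    have h1 := integral_Ioi_of_hasDerivAt_of_tendsto (hd t ht).continuousAt.continuousWithinAt
      (fun s hs => hd s (ht.trans (le_of_lt hs))) (hint.mono_set hsub) hlim
    rw [norm_sub_rev, ← h1]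
    refine (norm_integral_le_of_norm_le (hexp.mono_set hsub)
      ((ae_restrict_iff' measurableSet_Ioi).2 (.of_forall fun s hs => hb s
        (ht.trans (le_of_lt hs))))).trans (le_of_eq ?_)
    rw [integral_const_mul, integral_exp_mul_Ioi (by linarith)]
    field_simp
  -- C / c is the tail integral on the axis; 2|C| accounts for a horizontal displacement of at most
  -- 2.
  refine ⟨L, c, hcpos, C / c + 2 * |C|, fun z hz => ?_⟩
  have hs : Convex ℝ (cuspStrip ∩ {w | z.im ≤ w.im}) :=
    convex_cuspStrip.inter (convex_halfSpace_im_ge _)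
  have h2 := hG.norm_sub_le hs (fun w hw => im_pos_of_mem_cuspStrip hw.1)
      (C := |C| * Real.exp (-c * z.im)) (fun w hw => (hC w hw.1).trans ?_)
      (z := z.im * Complex.I) (w := z) ⟨hmem _ hz.2, by simp⟩ ⟨hz, by simp⟩
  · have h3 : ‖z - z.im * Complex.I‖ ≤ 2 := by
      have : z - z.im * Complex.I = (z.re : ℂ) := by
        apply Complex.ext <;> simp
      rw [this]
      simpa using hz.1
    calc ‖G z - L‖ = ‖(G z - G (z.im * Complex.I)) + (G (z.im * Complex.I) - L)‖ := by
          congr 1; ring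
      _ ≤ |C| * Real.exp (-c * z.im) * ‖z - z.im * Complex.I‖ + C / c * Real.exp (-c * z.im) :=
          (norm_add_le _ _).trans (add_le_add h2 (hvert _ hz.2))
      _ ≤ |C| * Real.exp (-c * z.im) * 2 + C / c * Real.exp (-c * z.im) := by gcongr
      _ = _ := by ring
  · have := hw.2
    simp only [Set.mem_ofPred_eq] at this
    have h5 : Real.exp (-c * w.im) ≤ Real.exp (-c * z.im) := Real.exp_le_exp.2 (by nlinarith)
    calc C * Real.exp (-c * w.im) ≤ |C| * Real.exp (-c * w.im) := by gcongr; exact le_abs_self C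
      _ ≤ _ := by gcongr

/-! ### Functions on the upper half-plane -/

/-- The estimate at i∞ covers the strip above some height A; what lies below A is compact. -/
theorem expBound_comp_ofComplex {f : ℍ → ℂ} (hf : Continuous f)
    (hO : f =O[atImInfty] fun τ => Real.exp (c * τ.im)) : ExpBound c (f ∘ ofComplex) := by
  obtain ⟨C, hC⟩ := hO.bound
  obtain ⟨A, hA⟩ := (atImInfty_mem _).1 hC
  have hK : IsCompact (Set.Icc (-2) 2 ×ℂ Set.Icc (1 / 2) A) := isCompact_Icc.reProdIm isCompact_Icc
  have hcont : ContinuousOn (fun z => ‖(f ∘ ofComplex) z‖ / Real.exp (c * z.im))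
      (Set.Icc (-2) 2 ×ℂ Set.Icc (1 / 2) A) := by
    intro z hz
    rw [Complex.mem_reProdIm] at hz
    have hz' : 0 < z.im := by linarith [hz.2.1]
    have h1 : ContinuousAt (f ∘ ofComplex) z := by
      refine hf.continuousAt.comp ?_
      exact (contMDiffAt_ofComplex (n := 0) hz').continuousAt
    refine ContinuousAt.continuousWithinAt (h1.norm.div ?_ (Real.exp_ne_zero _))
    fun_prop
  obtain ⟨M, hM⟩ := hK.bddAbove_image hcont
  refine ⟨max C M, fun z hz => ?_⟩
  have hz0 := im_pos_of_mem_cuspStrip hz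
  rcases le_total A z.im with h | h
  · have := hA (ofComplex z) (by rw [ofComplex_apply_of_im_pos hz0]; exact h)
    simp only [Set.mem_ofPred_eq, Real.norm_eq_abs, Real.abs_exp] at this
    rw [show (ofComplex z).im = z.im by rw [ofComplex_apply_of_im_pos hz0]; rfl] at this
    refine this.trans ?_
    gcongr
    exact le_max_left _ _
  · have := hM (Set.mem_image_of_mem _ (Complex.mem_reProdIm.2 ⟨abs_le.1 hz.1, hz.2, h⟩))
    rw [div_le_iff₀ (Real.exp_pos _)] at this
    refine this.trans ?_
    gcongr
    exact le_max_right _ _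

end

/-! ### Eichler integrals -/

/-- `G n` is a primitive of `z ^ n g(z)` in the upper half-plane, for all `n`. -/
def IsPrimitiveFamily (g : ℂ → ℂ) (G : ℕ → ℂ → ℂ) : Prop :=
  ∀ n, IsPrimitive (fun z => z ^ n * g z) (G n)

/-- The Eichler integral `∫ g(z) (w - z) ^ m dz`, expanded in terms of primitives of `z ^ n g(z)`. -/
noncomputable def eichlerIntegral (m : ℕ) (G : ℕ → ℂ → ℂ) (w z : ℂ) : ℂ :=
  ∑ n ∈ Finset.range (m + 1), (-1) ^ n * (m.choose n : ℂ) * w ^ (m - n) * G n z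

theorem sub_pow_eq_sum (m : ℕ) (w z : ℂ) :
    (w - z) ^ m = ∑ n ∈ Finset.range (m + 1), (-1) ^ n * (m.choose n : ℂ) * w ^ (m - n) * z ^ n := by
  rw [sub_eq_neg_add, add_pow]
  refine Finset.sum_congr rfl fun n _ => ?_
  rw [neg_pow]
  ring

theorem exists_isPrimitiveFamily {g : ℂ → ℂ} (hg : DifferentiableOn ℂ g {z | 0 < z.im}) :
    ∃ G, IsPrimitiveFamily g G ∧ ∀ n, G n Complex.I = 0 := by
  have := fun n : ℕ => exists_isPrimitive (h := fun z => z ^ n * g z) (by fun_prop)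
  choose G hG using this
  exact ⟨G, fun n => (hG n).1, fun n => (hG n).2⟩

section

variable {f g : ℂ → ℂ} {G : ℕ → ℂ → ℂ} {m : ℕ}

theorem IsPrimitiveFamily.isPrimitive_eichlerIntegral (hG : IsPrimitiveFamily g G) (m : ℕ) (w : ℂ) :
    IsPrimitive (fun z => g z * (w - z) ^ m) (eichlerIntegral m G w) := by
  intro z hz
  have : HasDerivAt (eichlerIntegral m G w) (∑ n ∈ Finset.range (m + 1),
      (-1) ^ n * (m.choose n : ℂ) * w ^ (m - n) * (z ^ n * g z)) z :=
    HasDerivAt.fun_sum fun n _ => (hG n z hz).const_mul _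
  refine this.congr_deriv ?_
  simp only [sub_pow_eq_sum, Finset.mul_sum]
  exact Finset.sum_congr rfl fun n _ => by ring

/-- A non-holomorphic potential of the form `f conj(g) (z - conj z) ^ m dz d conj(z)`. -/
noncomputable def potential (m : ℕ) (f : ℂ → ℂ) (G : ℕ → ℂ → ℂ) (z : ℂ) : ℂ :=
  f z * conj (eichlerIntegral m G (conj z) z)

/-- The factors (conj z)^(m-n) become holomorphic under the outer conjugation, so only the conj(G_n)
contribute to d(conj z). The coefficient a of dz stays unspecified because it cancels in Stokes'
theorem. -/
theorem IsPrimitiveFamily.hasFDerivAt_potential (hf : DifferentiableOn ℂ f {z | 0 < z.im})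
    (hG : IsPrimitiveFamily g G) (m : ℕ) {z : ℂ} (hz : 0 < z.im) :
    ∃ a : ℂ, HasFDerivAt (potential m f G) (a • (1 : ℂ →L[ℝ] ℂ) +
      (f z * conj (g z) * (z - conj z) ^ m) • (Complex.conjCLE : ℂ →L[ℝ] ℂ)) z := by
  have hfz := (hf.differentiableAt (isOpen_im_pos.mem_nhds hz)).hasDerivAt
  have h1 : ∀ n, HasDerivAt (fun z => f z * ((-1) ^ n * (m.choose n : ℂ) * z ^ (m - n)))
      (deriv f z * ((-1) ^ n * (m.choose n : ℂ) * z ^ (m - n)) +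
        f z * ((-1) ^ n * (m.choose n : ℂ) * (((m - n : ℕ) : ℂ) * z ^ (m - n - 1)))) z := fun n =>
    hfz.mul ((hasDerivAt_pow (m - n) z).const_mul _)
  set A' : ℕ → ℂ := fun n => deriv f z * ((-1) ^ n * (m.choose n : ℂ) * z ^ (m - n)) +
        f z * ((-1) ^ n * (m.choose n : ℂ) * (((m - n : ℕ) : ℂ) * z ^ (m - n - 1)))
  have h2 : ∀ n, HasFDerivAt (fun z => conj (G n z))
      ((Complex.conjCLE : ℂ →L[ℝ] ℂ).comp
        (((1 : ℂ →L[ℂ] ℂ).smulRight (z ^ n * g z)).restrictScalars ℝ)) z := fun n =>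
    Complex.conjCLE.hasFDerivAt.comp z ((hG n z hz).hasFDerivAt.restrictScalars ℝ)
  have h3 : ∀ n, HasFDerivAt (fun z => f z * ((-1) ^ n * (m.choose n : ℂ) * z ^ (m - n)) *
      conj (G n z)) _ z := fun n => ((h1 n).hasFDerivAt.restrictScalars ℝ).mul (h2 n)
  have h4 := HasFDerivAt.fun_sum (u := Finset.range (m + 1)) fun n _ => h3 n
  refine ⟨∑ n ∈ Finset.range (m + 1), A' n * conj (G n z), ?_⟩
  have e : potential m f G = fun z => ∑ n ∈ Finset.range (m + 1),
      f z * ((-1) ^ n * (m.choose n : ℂ) * z ^ (m - n)) * conj (G n z) := by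
    funext z
    simp only [potential, eichlerIntegral, map_sum, Finset.mul_sum]
    refine Finset.sum_congr rfl fun n _ => ?_
    simp
    ring
  rw [e]
  refine h4.congr_fderiv ?_
  ext v
  simp [sub_pow_eq_sum, Finset.mul_sum, Finset.sum_mul, Finset.sum_add_distrib, A']
  rw [add_comm]
  congr 1 <;> exact Finset.sum_congr rfl fun n _ => by ring

theorem IsPrimitiveFamily.continuousOn_potential (hf : DifferentiableOn ℂ f {z | 0 < z.im})
    (hG : IsPrimitiveFamily g G) (m : ℕ) : ContinuousOn (potential m f G) {z | 0 < z.im} := by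
  intro z hz
  obtain ⟨a, ha⟩ := hG.hasFDerivAt_potential hf m hz
  exact ha.continuousAt.continuousWithinAt

end

/-! ### Stokes' theorem in the standard fundamental domain -/

/-- The coordinates `(φ, u)` on the fundamental domain: `u` is the height above the point
`sin φ + i cos φ` of the unit circle. -/
noncomputable def arcCoord (p : ℝ × ℝ) : ℂ :=
  (Real.sin p.1 : ℂ) + ((Real.cos p.1 + p.2 : ℝ) : ℂ) * Complex.I

/-- The tangent vector of the unit circle at `sin φ + i cos φ`. -/
noncomputable def arcTangent (φ : ℝ) : ℂ := (Real.cos φ : ℂ) - (Real.sin φ : ℂ) * Complex.I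

@[simp] theorem arcCoord_re (p : ℝ × ℝ) : (arcCoord p).re = Real.sin p.1 := by
  simp [arcCoord, -Complex.ofReal_sin, -Complex.ofReal_cos]

@[simp] theorem arcCoord_im (p : ℝ × ℝ) : (arcCoord p).im = Real.cos p.1 + p.2 := by
  simp [arcCoord, -Complex.ofReal_sin, -Complex.ofReal_cos]

theorem continuous_arcCoord : Continuous arcCoord := by unfold arcCoord; fun_prop

theorem continuous_arcTangent : Continuous arcTangent := by unfold arcTangent; fun_prop

theorem hasFDerivAt_arcCoord (p : ℝ × ℝ) :
    ∃ L : ℝ × ℝ →L[ℝ] ℂ, HasFDerivAt arcCoord L p ∧ L (1, 0) = arcTangent p.1 ∧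
      L (0, 1) = Complex.I := by
  have h1 : HasFDerivAt (fun p : ℝ × ℝ => Real.sin p.1) _ p :=
    (hasFDerivAt_fst (p := p)).sin
  have h2 : HasFDerivAt (fun p : ℝ × ℝ => Real.cos p.1 + p.2) _ p :=
    (hasFDerivAt_fst (p := p)).cos.add hasFDerivAt_snd
  have h3 := (Complex.ofRealCLM.hasFDerivAt.comp p h1).add
    ((Complex.ofRealCLM.hasFDerivAt.comp p h2).mul_const Complex.I)
  refine ⟨_, h3, ?_, ?_⟩
  · simp [arcTangent]
    ring
  · simp

theorem hasFDerivAt_arcTangent (p : ℝ × ℝ) :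
    ∃ L : ℝ × ℝ →L[ℝ] ℂ, HasFDerivAt (fun p : ℝ × ℝ => arcTangent p.1) L p ∧ L (0, 1) = 0 := by
  have h1 : HasFDerivAt (fun p : ℝ × ℝ => Real.sin p.1) _ p :=
    (hasFDerivAt_fst (p := p)).sin
  have h2 : HasFDerivAt (fun p : ℝ × ℝ => Real.cos p.1) _ p :=
    (hasFDerivAt_fst (p := p)).cos
  have h3 := (Complex.ofRealCLM.hasFDerivAt.comp p h2).sub
    ((Complex.ofRealCLM.hasFDerivAt.comp p h1).mul_const Complex.I)
  exact ⟨_, h3, by simp⟩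

theorem one_half_le_cos {φ : ℝ} (hφ : φ ∈ Set.Icc (-(Real.pi / 6)) (Real.pi / 6)) :
    1 / 2 ≤ Real.cos φ := by
  have h := Real.pi_pos
  rw [← Real.cos_pi_div_three, ← Real.cos_abs φ]
  have : |φ| ≤ Real.pi / 6 := abs_le.2 hφ
  exact Real.cos_le_cos_of_nonneg_of_le_pi (abs_nonneg _) (by linarith) (by linarith)

theorem arcCoord_mem_cuspStrip {p : ℝ × ℝ}
    (hp : p ∈ Set.Icc (-(Real.pi / 6)) (Real.pi / 6) ×ˢ Set.Ici (0 : ℝ)) :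
    arcCoord p ∈ cuspStrip := by
  have h1 := one_half_le_cos hp.1
  have h2 : 0 ≤ p.2 := hp.2
  refine ⟨?_, ?_⟩
  · rw [arcCoord_re]
    exact (Real.abs_sin_le_one _).trans (by norm_num)
  · rw [arcCoord_im]
    linarith

/-! ### Stokes on truncated domains and passage to the cusp. -/

section

variable {f g : ℂ → ℂ} {G : ℕ → ℂ → ℂ} {m : ℕ}

/-- This is the divergence theorem for the field (iW, -Wt), where t = ∂z/∂φ is `arcTangent` and
∂z/∂u = i. If dW = a dz + b d(conj z), the divergence is i(at + b conj t) - t(ia - ib) = 2ib Re t =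
2ib cos φ. -/
theorem IsPrimitiveFamily.stokes_rectangle (hf : DifferentiableOn ℂ f {z | 0 < z.im})
    (hg : ContinuousOn g {z | 0 < z.im}) (hG : IsPrimitiveFamily g G) (m : ℕ) {U : ℝ} (hU : 0 ≤ U) :
    (∫ φ in -(Real.pi / 6)..(Real.pi / 6), ∫ u in (0 : ℝ)..U,
      2 * Complex.I * (f (arcCoord (φ, u)) * conj (g (arcCoord (φ, u))) *
        (arcCoord (φ, u) - conj (arcCoord (φ, u))) ^ m * Real.cos φ)) =
    (((∫ φ in -(Real.pi / 6)..(Real.pi / 6), -(potential m f G (arcCoord (φ, U)) * arcTangent φ)) -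
      ∫ φ in -(Real.pi / 6)..(Real.pi / 6), -(potential m f G (arcCoord (φ, 0)) * arcTangent φ)) +
      ∫ u in (0 : ℝ)..U, Complex.I * potential m f G (arcCoord (Real.pi / 6, u))) -
      ∫ u in (0 : ℝ)..U, Complex.I * potential m f G (arcCoord (-(Real.pi / 6), u)) := by
  have hpi : -(Real.pi / 6) ≤ Real.pi / 6 := by linarith [Real.pi_pos]
  set R : Set (ℝ × ℝ) := Set.Icc (-(Real.pi / 6)) (Real.pi / 6) ×ˢ Set.Icc 0 U with hR
  have hmaps : Set.MapsTo arcCoord R {z | 0 < z.im} := fun p hp =>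
    im_pos_of_mem_cuspStrip (arcCoord_mem_cuspStrip ⟨hp.1, hp.2.1⟩)
  have hWc : ContinuousOn (fun p => potential m f G (arcCoord p)) R :=
    (hG.continuousOn_potential hf m).comp continuous_arcCoord.continuousOn hmaps
  have hder : ∀ p : ℝ × ℝ, ∃ F' G' : ℝ × ℝ →L[ℝ] ℂ, p ∈ R →
      HasFDerivAt (fun p => Complex.I * potential m f G (arcCoord p)) F' p ∧
      HasFDerivAt (fun p => -(potential m f G (arcCoord p) * arcTangent p.1)) G' p ∧
      F' (1, 0) + G' (0, 1) = 2 * Complex.I * (f (arcCoord p) * conj (g (arcCoord p)) *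
        (arcCoord p - conj (arcCoord p)) ^ m * Real.cos p.1) := by
    intro p
    by_cases hp : p ∈ R
    · obtain ⟨a, ha⟩ := hG.hasFDerivAt_potential hf m (hmaps hp)
      obtain ⟨L, hL, hL1, hL2⟩ := hasFDerivAt_arcCoord p
      obtain ⟨M, hM, hM2⟩ := hasFDerivAt_arcTangent p
      have h1 := ha.comp p hL
      refine ⟨_, _, fun _ => ⟨h1.const_mul Complex.I, (h1.mul hM).neg, ?_⟩⟩
      simp [hL1, hL2, hM2, -Complex.ofReal_cos, -Complex.ofReal_sin]
      simp only [arcTangent, map_sub, map_mul, Complex.conj_ofReal, Complex.conj_I]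
      ring
    · exact ⟨0, 0, fun h => absurd h hp⟩
  choose F' G' hFG using hder
  have h := integral2_divergence_prod_of_hasFDerivAt
    (fun p => Complex.I * potential m f G (arcCoord p))
    (fun p => -(potential m f G (arcCoord p) * arcTangent p.1)) F' G'
    (-(Real.pi / 6)) 0 (Real.pi / 6) U
  rw [Set.uIcc_of_le hpi, Set.uIcc_of_le hU, min_eq_left hpi, max_eq_right hpi, min_eq_left hU,
    max_eq_right hU] at h
  have hsub : Set.Ioo (-(Real.pi / 6)) (Real.pi / 6) ×ˢ Set.Ioo 0 U ⊆ R :=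
    Set.prod_mono Set.Ioo_subset_Icc_self Set.Ioo_subset_Icc_self
  have hcont : ContinuousOn (fun p : ℝ × ℝ => 2 * Complex.I * (f (arcCoord p) * conj (g (arcCoord p)) *
        (arcCoord p - conj (arcCoord p)) ^ m * (Real.cos p.1 : ℂ))) R := by
    have h1 := hf.continuousOn.comp continuous_arcCoord.continuousOn hmaps
    have h2 := Complex.continuous_conj.comp_continuousOn
      (hg.comp continuous_arcCoord.continuousOn hmaps)
    have h3 : ContinuousOn (fun p : ℝ × ℝ => (arcCoord p - conj (arcCoord p)) ^ m * (Real.cos p.1 : ℂ)) R := by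
      have := continuous_arcCoord
      exact Continuous.continuousOn (by fun_prop)
    exact continuousOn_const.mul (((h1.mul h2).mul h3).congr fun p _ => by simp [mul_assoc])
  have h' := h (continuousOn_const.mul hWc)
    (hWc.mul (continuous_arcTangent.comp continuous_fst).continuousOn).neg
    (fun p hp => (hFG p (hsub hp)).1) (fun p hp => (hFG p (hsub hp)).2.1)
    ((hcont.integrableOn_compact (isCompact_Icc.prod isCompact_Icc)).congr_fun
      (fun p hp => ((hFG p hp).2.2).symm) (measurableSet_Icc.prod measurableSet_Icc))
  rw [← h']
  refine intervalIntegral.integral_congr fun φ hφ => intervalIntegral.integral_congr fun u hu => ?_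
  rw [Set.uIcc_of_le hpi] at hφ
  rw [Set.uIcc_of_le hU] at hu
  exact ((hFG (φ, u) ⟨hφ, hu⟩).2.2).symm

/-- The fundamental domain in the coordinates `(φ, u)`. -/
def arcRegion : Set (ℝ × ℝ) := Set.Ioc (-(Real.pi / 6)) (Real.pi / 6) ×ˢ Set.Ioi (0 : ℝ)

theorem ExpDecay.norm_comp_arcCoord_le {h : ℂ → ℂ} (H : ExpDecay h) :
    ∃ c > 0, ∃ C, ∀ φ ∈ Set.Icc (-(Real.pi / 6)) (Real.pi / 6), ∀ u : ℝ, 0 ≤ u →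
      ‖h (arcCoord (φ, u))‖ ≤ C * Real.exp (-c * u) := by
  obtain ⟨c, hc, C, hC⟩ := H
  refine ⟨c, hc, |C|, fun φ hφ u hu => ?_⟩
  have h1 := hC _ (arcCoord_mem_cuspStrip (p := (φ, u)) ⟨hφ, hu⟩)
  have h2 := one_half_le_cos hφ
  refine h1.trans ?_
  rw [arcCoord_im]
  have : -c * (Real.cos φ + u) ≤ -c * u := by nlinarith
  calc C * _ ≤ |C| * _ := mul_le_mul_of_nonneg_right (le_abs_self C) (Real.exp_pos _).le
    _ ≤ _ := by gcongr

theorem ExpDecay.integrableOn_vertical {h : ℂ → ℂ} (H : ExpDecay h)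
    (hh : ContinuousOn h {z | 0 < z.im}) {φ : ℝ}
    (hφ : φ ∈ Set.Icc (-(Real.pi / 6)) (Real.pi / 6)) :
    IntegrableOn (fun u : ℝ => h (arcCoord (φ, u))) (Set.Ioi 0) := by
  obtain ⟨c, hc, C, hC⟩ := H.norm_comp_arcCoord_le
  refine ((integrableOn_exp_mul_Ioi (show -c < 0 by linarith) 0).const_mul C).mono' ?_ ?_
  · refine ContinuousOn.aestronglyMeasurable ?_ measurableSet_Ioi
    refine hh.comp (continuous_arcCoord.comp (Continuous.prodMk_right φ)).continuousOn fun u hu => ?_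
    exact im_pos_of_mem_cuspStrip (arcCoord_mem_cuspStrip ⟨hφ, Set.Ioi_subset_Ici_self hu⟩)
  · exact (ae_restrict_iff' measurableSet_Ioi).2 (.of_forall fun u hu => hC φ hφ u (le_of_lt hu))

theorem ExpDecay.integrableOn_arcRegion {h : ℂ → ℂ} (H : ExpDecay h)
    (hh : ContinuousOn h {z | 0 < z.im}) :
    IntegrableOn (fun p => h (arcCoord p) * (Real.cos p.1 : ℂ)) arcRegion := by
  obtain ⟨c, hc, C, hC⟩ := H.norm_comp_arcCoord_le
  have hint : IntegrableOn (fun p : ℝ × ℝ => C * Real.exp (-c * p.2)) arcRegion := by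
    refine Integrable.const_mul ?_ C
    rw [arcRegion, Measure.volume_eq_prod, ← Measure.prod_restrict]
    have := Integrable.mul_prod (f := fun _ : ℝ => (1 : ℝ)) (g := fun u : ℝ => Real.exp (-c * u))
      (μ := volume.restrict (Set.Ioc (-(Real.pi / 6)) (Real.pi / 6)))
      (ν := volume.restrict (Set.Ioi (0 : ℝ))) (integrable_const 1)
      (integrableOn_exp_mul_Ioi (by linarith) 0)
    simpa using this
  have hsub : arcRegion ⊆ Set.Icc (-(Real.pi / 6)) (Real.pi / 6) ×ˢ Set.Ici (0 : ℝ) :=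
    Set.prod_mono Set.Ioc_subset_Icc_self Set.Ioi_subset_Ici_self
  have hmeas : MeasurableSet arcRegion := measurableSet_Ioc.prod measurableSet_Ioi
  refine hint.mono' ?_ ?_
  · refine ContinuousOn.aestronglyMeasurable ?_ hmeas
    refine (hh.comp continuous_arcCoord.continuousOn fun p hp => ?_).mul
      (Continuous.continuousOn (by fun_prop))
    exact im_pos_of_mem_cuspStrip (arcCoord_mem_cuspStrip (hsub hp))
  · refine (ae_restrict_iff' hmeas).2 (.of_forall fun p hp => ?_)
    have h1 := hC p.1 (hsub hp).1 p.2 (hsub hp).2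
    rw [norm_mul, Complex.norm_real, Real.norm_eq_abs]
    calc _ ≤ ‖h (arcCoord p)‖ * 1 := by
          gcongr
          exact Real.abs_cos_le_one _
      _ ≤ _ := by simpa using h1

/-- Rectangles of height n exhaust the region, and the integral over the top side tends to 0 with
the decay of the potential. -/
theorem IsPrimitiveFamily.stokes_fundamentalDomain (hf : DifferentiableOn ℂ f {z | 0 < z.im})
    (hg : ContinuousOn g {z | 0 < z.im}) (hG : IsPrimitiveFamily g G) (m : ℕ)
    (hW : ExpDecay (potential m f G))
    (hint : IntegrableOn (fun p : ℝ × ℝ => f (arcCoord p) * conj (g (arcCoord p)) *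
        (arcCoord p - conj (arcCoord p)) ^ m * Real.cos p.1) arcRegion) :
    2 * Complex.I * ∫ p in arcRegion, f (arcCoord p) * conj (g (arcCoord p)) *
        (arcCoord p - conj (arcCoord p)) ^ m * Real.cos p.1 =
    (∫ φ in -(Real.pi / 6)..(Real.pi / 6), potential m f G (arcCoord (φ, 0)) * arcTangent φ) +
    Complex.I * ∫ u in Set.Ioi (0 : ℝ), (potential m f G (arcCoord (Real.pi / 6, u)) -
      potential m f G (arcCoord (-(Real.pi / 6), u))) := by
  have hpi : -(Real.pi / 6) ≤ Real.pi / 6 := by linarith [Real.pi_pos]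
  set B : ℝ × ℝ → ℂ := fun p => f (arcCoord p) * conj (g (arcCoord p)) *
        (arcCoord p - conj (arcCoord p)) ^ m * Real.cos p.1 with hB
  have hWc := hG.continuousOn_potential hf m
  have hr := hW.integrableOn_vertical hWc (φ := Real.pi / 6) ⟨hpi, le_rfl⟩
  have hl := hW.integrableOn_vertical hWc (φ := -(Real.pi / 6)) ⟨le_rfl, hpi⟩
  set s : ℕ → Set (ℝ × ℝ) := fun n =>
    Set.Ioc (-(Real.pi / 6)) (Real.pi / 6) ×ˢ Set.Ioc (0 : ℝ) n with hs
  have hsU : ⋃ n, s n = arcRegion := by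
    ext p
    simp only [hs, Set.mem_iUnion, Set.mem_prod, arcRegion]
    constructor
    · rintro ⟨n, h1, h2⟩
      exact ⟨h1, h2.1⟩
    · rintro ⟨h1, h2⟩
      obtain ⟨n, hn⟩ := exists_nat_ge p.2
      exact ⟨n, h1, h2, hn⟩
  have hmono : Monotone s := fun a b hab => Set.prod_mono le_rfl
    (Set.Ioc_subset_Ioc_right (by exact_mod_cast hab))
  have hlim1 := tendsto_setIntegral_of_monotone (μ := volume) (f := B) (s := s)
    (fun n => measurableSet_Ioc.prod measurableSet_Ioc) hmono (by rw [hsU]; exact hint)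
  rw [hsU] at hlim1
  have hL : ∀ n : ℕ, 2 * Complex.I * ∫ p in s n, B p =
    (((∫ φ in -(Real.pi / 6)..(Real.pi / 6), -(potential m f G (arcCoord (φ, n)) * arcTangent φ)) -
      ∫ φ in -(Real.pi / 6)..(Real.pi / 6), -(potential m f G (arcCoord (φ, 0)) * arcTangent φ)) +
      ∫ u in (0 : ℝ)..n, Complex.I * potential m f G (arcCoord (Real.pi / 6, u))) -
      ∫ u in (0 : ℝ)..n, Complex.I * potential m f G (arcCoord (-(Real.pi / 6), u)) := by
    intro n
    rw [← hG.stokes_rectangle hf hg m n.cast_nonneg, ← integral_const_mul, hs,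
      Measure.volume_eq_prod, setIntegral_prod]
    · rw [intervalIntegral.integral_of_le hpi]
      refine setIntegral_congr_fun measurableSet_Ioc fun φ _ => ?_
      rw [intervalIntegral.integral_of_le n.cast_nonneg]
    · refine Integrable.const_mul (hint.mono_set ?_) _
      rw [← hsU]
      exact Set.subset_iUnion s n
  have htop : Filter.Tendsto (fun n : ℕ => ∫ φ in -(Real.pi / 6)..(Real.pi / 6),
      -(potential m f G (arcCoord (φ, n)) * arcTangent φ)) Filter.atTop (nhds 0) := by
    obtain ⟨c, hc, C, hC⟩ := hW.norm_comp_arcCoord_le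
    have hb : ∀ n : ℕ, ‖∫ φ in -(Real.pi / 6)..(Real.pi / 6),
        -(potential m f G (arcCoord (φ, n)) * arcTangent φ)‖ ≤
        (C * Real.exp (-c * n) * 2) * |Real.pi / 6 - -(Real.pi / 6)| := by
      intro n
      refine intervalIntegral.norm_integral_le_of_norm_le_const fun φ hφ => ?_
      rw [Set.uIoc_of_le hpi] at hφ
      rw [norm_neg, norm_mul]
      have h1 := hC φ (Set.Ioc_subset_Icc_self hφ) n n.cast_nonneg
      have h2 : ‖arcTangent φ‖ ≤ 2 := by
        refine (norm_sub_le _ _).trans ?_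
        rw [norm_mul, Complex.norm_I, mul_one, Complex.norm_real, Complex.norm_real]
        exact (add_le_add (Real.abs_cos_le_one φ) (Real.abs_sin_le_one φ)).trans (by norm_num)
      exact mul_le_mul h1 h2 (norm_nonneg _) ((norm_nonneg _).trans h1)
    refine squeeze_zero_norm hb ?_
    have h3 : Filter.Tendsto (fun n : ℕ => -c * (n : ℝ)) Filter.atTop Filter.atBot :=
      tendsto_natCast_atTop_atTop.const_mul_atTop_of_neg (by linarith)
    simpa using (((Real.tendsto_exp_atBot.comp h3).const_mul C).mul_const 2).mul_const
      |Real.pi / 6 - -(Real.pi / 6)|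
  have hR := intervalIntegral_tendsto_integral_Ioi (0 : ℝ) (hr.const_mul Complex.I)
    (tendsto_natCast_atTop_atTop (R := ℝ))
  have hLe := intervalIntegral_tendsto_integral_Ioi (0 : ℝ) (hl.const_mul Complex.I)
    (tendsto_natCast_atTop_atTop (R := ℝ))
  have hfin := tendsto_nhds_unique (hlim1.const_mul (2 * Complex.I))
    ((((htop.sub_const _).add hR).sub hLe).congr fun n => (hL n).symm)
  rw [hfin, integral_sub hr hl, intervalIntegral.integral_neg, integral_const_mul,
    integral_const_mul]
  ring

end

/-! ### Line integrals -/

section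

open CompletedHalfPlane

/-- After binomial expansion the inner integral is a finite sum of constants times τ^(m-n) f(τ), so
linearity suffices and no exchange of integrals is needed. -/
theorem doubleIntegral_eq_sum (m : ℕ) {f g : ℍ → ℂ} {A B C D : CompletedHalfPlane}
    (hf : ∀ n ≤ m, IntegralConverges A B (powMul n f))
    (hg : ∀ n ≤ m, IntegralConverges C D (powMul n g)) :
    doubleIntegral (m + 2) f g A B C D = ∑ n ∈ Finset.range (m + 1),
      (-1 : ℂ) ^ n * (m.choose n : ℂ) *
        (singleIntegral (m - n) A B f * conj (singleIntegral n C D g)) := by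
  have inner : ∀ τ : ℍ, (conjIntegral C D fun τ₂ =>
      f τ * conj (g τ₂) * ((τ : ℂ) - conj (τ₂ : ℂ)) ^ (m + 2 - 2)) =
      ∑ n ∈ Finset.range (m + 1), (-1 : ℂ) ^ n * (m.choose n : ℂ) *
        conj (singleIntegral n C D g) * powMul (m - n) f τ := by
    intro τ
    have e : ∀ t : ℝ, f τ * conj (g (ofComplex ((path C D).2 t))) *
        ((τ : ℂ) - conj ((ofComplex ((path C D).2 t) : ℍ) : ℂ)) ^ (m + 2 - 2) *
          conj (deriv (path C D).2 t) =
        ∑ n ∈ Finset.range (m + 1), (-1 : ℂ) ^ n * (m.choose n : ℂ) * powMul (m - n) f τ *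
          conj (pullback C D (powMul n g) t) := by
      intro t
      rw [show m + 2 - 2 = m from rfl, sub_pow_eq_sum, Finset.mul_sum, Finset.sum_mul]
      refine Finset.sum_congr rfl fun n _ => ?_
      simp only [pullback, powMul, map_mul, map_pow]
      ring
    simp only [conjIntegral, e]
    rw [integral_finsetSum]
    · refine Finset.sum_congr rfl fun n _ => ?_
      rw [integral_const_mul, integral_conj, singleIntegral, CompletedHalfPlane.integral]
      ring
    · intro n hn
      have := hg n (by simpa [Nat.lt_succ_iff] using hn)
      exact Integrable.const_mul (Complex.conjCLE.toContinuousLinearMap.integrable_comp this) _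
  have outer : ∀ t : ℝ, pullback A B (fun τ => ∑ n ∈ Finset.range (m + 1),
      (-1 : ℂ) ^ n * (m.choose n : ℂ) * conj (singleIntegral n C D g) * powMul (m - n) f τ) t =
      ∑ n ∈ Finset.range (m + 1), (-1 : ℂ) ^ n * (m.choose n : ℂ) *
        conj (singleIntegral n C D g) * pullback A B (powMul (m - n) f) t := by
    intro t
    rw [pullback, Finset.sum_mul]
    exact Finset.sum_congr rfl fun n _ => by rw [pullback]; ring
  rw [doubleIntegral]
  simp only [inner, CompletedHalfPlane.integral, outer]
  rw [integral_finsetSum]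
  · refine Finset.sum_congr rfl fun n _ => ?_
    rw [integral_const_mul]
    simp only [singleIntegral, CompletedHalfPlane.integral]
    ring
  · intro n _
    exact Integrable.const_mul (hf (m - n) (Nat.sub_le _ _)) _

theorem ReducesToSingleIntegrals.of_converges (m : ℕ) {f g : ℍ → ℂ} {A B C D : CompletedHalfPlane}
    (hf : ∀ n ≤ m, IntegralConverges A B (powMul n f))
    (hg : ∀ n ≤ m, IntegralConverges C D (powMul n g)) :
    ReducesToSingleIntegrals (m + 2) f g A B C D :=
  ⟨hf, hg, doubleIntegral_eq_sum m hf hg⟩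

theorem powMul_ofComplex (n : ℕ) (f : ℍ → ℂ) {z : ℂ} (hz : 0 < z.im) :
    powMul n f (ofComplex z) = z ^ n * (f ∘ ofComplex) z := by
  simp [powMul, ofComplex_apply_of_im_pos hz]

variable {f : ℍ → ℂ} {G : ℕ → ℂ → ℂ}

theorem deriv_segment (a b : ℂ) (t : ℝ) : deriv (fun t : ℝ => a + t * (b - a)) t = b - a := by
  have : HasDerivAt (fun t : ℝ => a + t * (b - a)) (b - a) t := by
    simpa using ((Complex.ofRealCLM.hasDerivAt (x := t)).mul_const (b - a)).const_add a
  exact this.deriv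

theorem hasDerivAt_segment (a b : ℂ) (t : ℝ) :
    HasDerivAt (fun t : ℝ => a + t * (b - a)) (b - a) t := by
  simpa using ((Complex.ofRealCLM.hasDerivAt (x := t)).mul_const (b - a)).const_add a

theorem segment_im_pos {a b : ℍ} {t : ℝ} (ht : t ∈ Set.Icc (0 : ℝ) 1) :
    0 < ((a : ℂ) + t * ((b : ℂ) - a)).im := by
  have := convex_im_pos.add_smul_sub_mem a.im_pos b.im_pos ht
  simpa using this

theorem hasDerivAt_comp_segment (hG : IsPrimitiveFamily (f ∘ ofComplex) G) (n : ℕ) {a b : ℍ} {t : ℝ}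
    (ht : t ∈ Set.Icc (0 : ℝ) 1) :
    HasDerivAt (fun t : ℝ => G n (a + t * ((b : ℂ) - a))) (pullback (pt a) (pt b) (powMul n f) t) t := by
  have h := (hG n _ (segment_im_pos ht)).comp t (hasDerivAt_segment a b t)
  refine h.congr_deriv ?_
  simp only [pullback, path]
  rw [deriv_segment, powMul_ofComplex n f (segment_im_pos ht)]

theorem continuousOn_pullback_segment (hf : ContinuousOn (f ∘ ofComplex) {z | 0 < z.im}) (n : ℕ)
    (a b : ℍ) : ContinuousOn (pullback (pt a) (pt b) (powMul n f)) (Set.Icc 0 1) := by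
  have h : ContinuousOn (fun t : ℝ => ((a : ℂ) + t * ((b : ℂ) - a)) ^ n *
      (f ∘ ofComplex) ((a : ℂ) + t * ((b : ℂ) - a)) * ((b : ℂ) - a)) (Set.Icc 0 1) := by
    refine (ContinuousOn.mul (by fun_prop) ?_).mul continuousOn_const
    exact hf.comp (by fun_prop) fun t ht => segment_im_pos ht
  refine h.congr fun t ht => ?_
  simp only [pullback, path]
  rw [deriv_segment, powMul_ofComplex n f (segment_im_pos ht)]

theorem integralConverges_segment (hf : ContinuousOn (f ∘ ofComplex) {z | 0 < z.im}) (n : ℕ)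
    (a b : ℍ) : IntegralConverges (pt a) (pt b) (powMul n f) :=
  ((continuousOn_pullback_segment hf n a b).integrableOn_compact isCompact_Icc).mono_set
    Set.Ioo_subset_Icc_self

theorem singleIntegral_segment (hf : ContinuousOn (f ∘ ofComplex) {z | 0 < z.im})
    (hG : IsPrimitiveFamily (f ∘ ofComplex) G) (n : ℕ) (a b : ℍ) :
    singleIntegral n (pt a) (pt b) f = G n b - G n a := by
  have h := intervalIntegral.integral_eq_sub_of_hasDerivAt (a := 0) (b := 1)
    (f := fun t : ℝ => G n (a + t * ((b : ℂ) - a))) (f' := pullback (pt a) (pt b) (powMul n f))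
    (fun t ht => hasDerivAt_comp_segment hG n (by rwa [Set.uIcc_of_le zero_le_one] at ht))
    (by
      refine ContinuousOn.intervalIntegrable ?_
      rw [Set.uIcc_of_le zero_le_one]
      exact continuousOn_pullback_segment hf n a b)
  rw [intervalIntegral.integral_of_le zero_le_one, integral_Ioc_eq_integral_Ioo] at h
  simpa [singleIntegral, CompletedHalfPlane.integral, path] using h

theorem hasDerivAt_vertical (a : ℂ) (t : ℝ) :
    HasDerivAt (fun t : ℝ => a + t * Complex.I) Complex.I t := by
  simpa using ((Complex.ofRealCLM.hasDerivAt (x := t)).mul_const Complex.I).const_add a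

theorem vertical_mem_cuspStrip {a : ℂ} (ha : a ∈ cuspStrip) {t : ℝ} (ht : 0 ≤ t) :
    a + t * Complex.I ∈ cuspStrip := by
  obtain ⟨h1, h2⟩ := ha
  constructor <;> simp
  · exact h1
  · linarith

theorem pullback_vertical (n : ℕ) {a : ℍ} (ha : (a : ℂ) ∈ cuspStrip) {t : ℝ} (ht : 0 ≤ t) :
    pullback (pt a) infty (powMul n f) t =
      ((a : ℂ) + t * Complex.I) ^ n * (f ∘ ofComplex) (a + t * Complex.I) * Complex.I := by
  simp only [pullback, path]
  rw [(hasDerivAt_vertical a t).deriv,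
    powMul_ofComplex n f (im_pos_of_mem_cuspStrip (vertical_mem_cuspStrip ha ht))]

theorem integralConverges_vertical (hf : ContinuousOn (f ∘ ofComplex) {z | 0 < z.im})
    (hd : ExpDecay (f ∘ ofComplex)) (n : ℕ) {a : ℍ} (ha : (a : ℂ) ∈ cuspStrip) :
    IntegralConverges (pt a) infty (powMul n f) := by
  obtain ⟨c, hc, C, hC⟩ := (subExp_id.pow n).mul_expDecay hd
  refine ((integrableOn_exp_mul_Ioi (show -c < 0 by linarith) 0).const_mul |C|).mono' ?_ ?_
  · have h : ContinuousOn (fun t : ℝ => ((a : ℂ) + t * Complex.I) ^ n *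
        (f ∘ ofComplex) ((a : ℂ) + t * Complex.I) * Complex.I) (Set.Ioi 0) := by
      refine (ContinuousOn.mul (by fun_prop) ?_).mul continuousOn_const
      exact hf.comp (by fun_prop) fun t ht =>
        im_pos_of_mem_cuspStrip (vertical_mem_cuspStrip ha (le_of_lt ht))
    exact (h.congr fun t ht => pullback_vertical n ha (le_of_lt ht)).aestronglyMeasurable
      measurableSet_Ioi
  · refine (ae_restrict_iff' measurableSet_Ioi).2 (.of_forall fun t ht => ?_)
    have ht : 0 < t := ht
    rw [pullback_vertical n ha ht.le, norm_mul, Complex.norm_I, mul_one]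
    refine (hC _ (vertical_mem_cuspStrip ha ht.le)).trans ?_
    have := a.im_pos
    have h1 : -c * ((a : ℂ) + t * Complex.I).im ≤ -c * t := by simp; nlinarith
    calc C * _ ≤ |C| * _ := mul_le_mul_of_nonneg_right (le_abs_self C) (Real.exp_pos _).le
      _ ≤ _ := by gcongr

theorem singleIntegral_vertical (hf : ContinuousOn (f ∘ ofComplex) {z | 0 < z.im})
    (hd : ExpDecay (f ∘ ofComplex)) (hG : IsPrimitiveFamily (f ∘ ofComplex) G) (n : ℕ) {L : ℂ}
    (hL : ExpDecay fun z => G n z - L) {a : ℍ} (ha : (a : ℂ) ∈ cuspStrip) :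
    singleIntegral n (pt a) infty f = L - G n a := by
  have hder : ∀ t ∈ Set.Ici (0 : ℝ), HasDerivAt (fun t : ℝ => G n (a + t * Complex.I))
      (pullback (pt a) infty (powMul n f) t) t := by
    intro t ht
    rw [pullback_vertical n ha ht]
    exact (hG n _ (im_pos_of_mem_cuspStrip (vertical_mem_cuspStrip ha ht))).comp t
      (hasDerivAt_vertical a t)
  have hlim : Filter.Tendsto (fun t : ℝ => G n (a + t * Complex.I)) Filter.atTop (nhds L) := by
    have h := hL.tendsto_zero (l := Filter.atTop) (u := fun t : ℝ => (a : ℂ) + t * Complex.I)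
      ((Filter.eventually_ge_atTop 0).mono fun t ht => vertical_mem_cuspStrip ha ht)
      (by simpa using Filter.tendsto_atTop_add_const_left _ _ Filter.tendsto_id)
    simpa using h.add_const L
  have h := integral_Ioi_of_hasDerivAt_of_tendsto' hder (integralConverges_vertical hf hd n ha) hlim
  simpa [singleIntegral, CompletedHalfPlane.integral, path] using h

/-! ### The path from i∞ to 0. -/

theorem hasDerivAt_zeroPath (t : ℝ) :
    HasDerivAt (fun t : ℝ => (((0 : ℚ) : ℂ)) - t * Complex.I) (-Complex.I) t := by
  simpa using ((Complex.ofRealCLM.hasDerivAt (x := t)).mul_const Complex.I).const_sub ((0 : ℚ) : ℂ)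

theorem pullback_zeroPath (n : ℕ) {t : ℝ} (ht : t < 0) :
    pullback infty (rat 0) (powMul n f) t =
      (-t * Complex.I) ^ n * (f ∘ ofComplex) (-t * Complex.I) * -Complex.I := by
  simp only [pullback, path]
  rw [(hasDerivAt_zeroPath t).deriv, powMul_ofComplex n f (by simpa using ht)]
  simp

/-- The decay of f handles the end at i∞. Near 0, inversion sends is to i/s, and the decay of f'
absorbs the factor s^(-k). -/
theorem integralConverges_zeroPath {k : ℕ} {f' : ℂ → ℂ}
    (hf : ContinuousOn (f ∘ ofComplex) {z | 0 < z.im})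
    (hd : ExpDecay (f ∘ ofComplex)) (hd' : ExpDecay f')
    (hS : ∀ z : ℂ, 0 < z.im → (f ∘ ofComplex) (-1 / z) = z ^ k * f' z) (n : ℕ) :
    IntegralConverges infty (rat 0) (powMul n f) := by
  have hcont : ContinuousOn (pullback infty (rat 0) (powMul n f)) (Set.Iio 0) := by
    have h : ContinuousOn (fun t : ℝ => (-t * Complex.I) ^ n *
        (f ∘ ofComplex) (-t * Complex.I) * -Complex.I) (Set.Iio 0) := by
      refine (ContinuousOn.mul (by fun_prop) ?_).mul continuousOn_const
      exact hf.comp (by fun_prop) fun t ht => by simpa using ht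
    exact h.congr fun t ht => pullback_zeroPath n ht
  have hsplit : (path infty (rat 0)).1 = Set.Iic (-1) ∪ Set.Ioo (-1) 0 := by
    simp only [path]
    ext t
    simp only [Set.mem_Iio, Set.mem_union, Set.mem_Iic, Set.mem_Ioo]
    constructor
    · intro h
      rcases le_or_gt t (-1) with h' | h'
      · exact .inl h'
      · exact .inr ⟨h', h⟩
    · rintro (h | h)
      · linarith
      · exact h.2
  rw [IntegralConverges, hsplit]
  refine IntegrableOn.union ?_ ?_
  · obtain ⟨c, hc, C, hC⟩ := (subExp_id.pow n).mul_expDecay hd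
    refine ((integrableOn_exp_mul_Iic hc (-1)).const_mul C).mono' ?_ ?_
    · exact (hcont.mono fun t ht => lt_of_le_of_lt ht (by norm_num)).aestronglyMeasurable
        measurableSet_Iic
    · refine (ae_restrict_iff' measurableSet_Iic).2 (.of_forall fun t ht => ?_)
      have ht : t ≤ -1 := ht
      rw [pullback_zeroPath n (by linarith), norm_mul, norm_neg, Complex.norm_I, mul_one]
      have hmem : (-t * Complex.I : ℂ) ∈ cuspStrip := by
        constructor
        · simp
        · simp; linarith
      simpa using hC _ hmem
  · obtain ⟨c, hc, C, hC⟩ := hd'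
    -- The bound x^k exp(-cx) ≤ k!/c^k follows from (cx)^k/k! ≤ exp(cx), used with x = 1/s.
    refine Integrable.mono' (g := fun _ => |C| * ((k.factorial : ℝ) / c ^ k))
      (integrableOn_const (by simp)) ?_ ?_
    · exact (hcont.mono fun t ht => ht.2).aestronglyMeasurable measurableSet_Ioo
    · refine (ae_restrict_iff' measurableSet_Ioo).2 (.of_forall fun t ht => ?_)
      obtain ⟨s, rfl⟩ : ∃ s, t = -s := ⟨-t, by ring⟩
      have hs0 : 0 < s := by linarith [ht.2]
      have hs1 : s < 1 := by linarith [ht.1]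
      rw [pullback_zeroPath n (by linarith), norm_mul, norm_neg, Complex.norm_I, mul_one]
      have hmem : ((s⁻¹ : ℝ) * Complex.I : ℂ) ∈ cuspStrip := by
        constructor
        · simp
        · have : 1 ≤ s⁻¹ := (one_le_inv₀ hs0).2 hs1.le
          simp at this ⊢
          linarith
      have hz : (-((-s : ℝ) : ℂ) * Complex.I) = -1 / ((s⁻¹ : ℝ) * Complex.I) := by
        push_cast
        field_simp
        simp
      have h1 := hC _ hmem
      rw [norm_mul, norm_pow]
      have h2 : ‖-((-s : ℝ) : ℂ) * Complex.I‖ ^ n ≤ 1 := by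
        refine pow_le_one₀ (norm_nonneg _) ?_
        simp [abs_of_pos hs0, hs1.le]
      have h3 : ‖(f ∘ ofComplex) (-((-s : ℝ) : ℂ) * Complex.I)‖ ≤
          |C| * ((k.factorial : ℝ) / c ^ k) := by
        rw [hz, hS _ (im_pos_of_mem_cuspStrip hmem), norm_mul, norm_pow]
        have e1 : ‖((s⁻¹ : ℝ) * Complex.I : ℂ)‖ = s⁻¹ := by
          simp [abs_of_pos hs0]
        have e2 : ((s⁻¹ : ℝ) * Complex.I : ℂ).im = s⁻¹ := by simp
        rw [e1]
        rw [e2] at h1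
        have h4 := Real.pow_div_factorial_le_exp (c * s⁻¹) (by positivity) k
        have h5 : s⁻¹ ^ k * Real.exp (-c * s⁻¹) ≤ (k.factorial : ℝ) / c ^ k := by
          rw [neg_mul, Real.exp_neg, ← div_eq_mul_inv, div_le_div_iff₀ (Real.exp_pos _) (by positivity)]
          rw [div_le_iff₀ (by positivity), mul_pow] at h4
          linarith
        calc s⁻¹ ^ k * ‖f' ((s⁻¹ : ℝ) * Complex.I)‖ ≤ s⁻¹ ^ k * (|C| * Real.exp (-c * s⁻¹)) := by
              gcongr
              exact h1.trans (mul_le_mul_of_nonneg_right (le_abs_self C) (Real.exp_pos _).le)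
          _ = |C| * (s⁻¹ ^ k * Real.exp (-c * s⁻¹)) := by ring
          _ ≤ _ := by gcongr
      calc _ ≤ 1 * ‖(f ∘ ofComplex) (-((-s : ℝ) : ℂ) * Complex.I)‖ := by gcongr
        _ ≤ _ := by simpa using h3

/-- G vanishes at i∞ and G' vanishes at 0. Since G - G' is constant, that constant is the limit of G
at 0, hence the whole integral. -/
theorem singleIntegral_zeroPath {G' : ℕ → ℂ → ℂ}
    (hG : IsPrimitiveFamily (f ∘ ofComplex) G) (hG' : IsPrimitiveFamily (f ∘ ofComplex) G') (n : ℕ)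
    (hconv : IntegralConverges infty (rat 0) (powMul n f))
    (hd : ExpDecay (G n)) (hd' : Filter.Tendsto (fun s : ℝ => G' n (s * Complex.I))
      (nhdsWithin 0 (Set.Ioi 0)) (nhds 0)) :
    singleIntegral n infty (rat 0) f = G n Complex.I - G' n Complex.I := by
  set L := G n Complex.I - G' n Complex.I
  -- At t = 0 the path leaves the half-plane and the value of G n is meaningless. Replacing it by
  -- the limit L gives the continuity at the endpoint that the fundamental theorem on (-∞, 0]
  -- requires.
  have hder : ∀ t ∈ Set.Iio (0 : ℝ), HasDerivAt
      (Function.update (fun t : ℝ => G n (-t * Complex.I)) 0 L)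
      (pullback infty (rat 0) (powMul n f) t) t := by
    intro t ht
    rw [pullback_zeroPath n ht]
    have h1 : HasDerivAt (fun t : ℝ => (-t * Complex.I : ℂ)) (-Complex.I) t := by
      simpa using (hasDerivAt_zeroPath t)
    have h2 := (hG n (-t * Complex.I) (by simpa using ht)).comp t h1
    refine h2.congr_of_eventuallyEq ?_
    filter_upwards [isOpen_Iio.mem_nhds ht] with s hs
    rw [Function.update_of_ne (ne_of_lt (Set.mem_Iio.1 hs))]
    rfl
  have hcont : ContinuousWithinAt (Function.update (fun t : ℝ => G n (-t * Complex.I)) 0 L)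
      (Set.Iic 0) 0 := by
    rw [continuousWithinAt_update_same, Set.Iic_sdiff_right]
    have hneg : Filter.Tendsto (fun t : ℝ => -t) (nhdsWithin 0 (Set.Iio 0))
        (nhdsWithin 0 (Set.Ioi 0)) := by
      simpa using tendsto_neg_nhdsLT (a := (0 : ℝ))
    have h1 := (hd'.comp hneg).add_const L
    rw [zero_add] at h1
    refine h1.congr' ?_
    filter_upwards [self_mem_nhdsWithin] with t ht
    have := (hG n).sub_eq_sub (hG' n) (z := -t * Complex.I) (w := Complex.I)
      (by simpa using ht) (by simp)
    simp only [Function.comp_apply, L, ← this]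
    push_cast
    ring
  have hlim : Filter.Tendsto (Function.update (fun t : ℝ => G n (-t * Complex.I)) 0 L)
      Filter.atBot (nhds 0) := by
    have h := hd.tendsto_zero (l := Filter.atBot) (u := fun t : ℝ => (-t * Complex.I : ℂ))
      ((Filter.eventually_le_atBot (-1)).mono fun t ht => by
        constructor
        · simp
        · simp; linarith)
      (by simpa using Filter.tendsto_neg_atBot_atTop)
    refine h.congr' ?_
    filter_upwards [Filter.eventually_lt_atBot 0] with t ht
    simp [Function.update_of_ne (ne_of_lt ht)]
  have h := integral_Iic_of_hasDerivAt_of_tendsto hcont hder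
    ((integrableOn_Iic_iff_integrableOn_Iio (by finiteness)).2 hconv) hlim
  rw [integral_Iic_eq_integral_Iio] at h
  simpa [singleIntegral, CompletedHalfPlane.integral, path] using h

end

/-! ### The hyperbolic measure on the standard fundamental domain -/

theorem measure_eq_zero_of_volume_image_coe {s : Set ℍ} (hs : volume (((↑) : ℍ → ℂ) '' s) = 0) :
    volume s = 0 := by
  rw [UpperHalfPlane.volume_eq_lintegral, Measure.restrict_eq_zero.2 hs, lintegral_zero_measure]

theorem volume_re_eq (c : ℝ) : volume {z : ℂ | z.re = c} = 0 := by
  have h : {z : ℂ | z.re = c} = Complex.measurableEquivRealProd ⁻¹' ({c} ×ˢ Set.univ) := by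
    ext z; simp
  rw [h, Complex.volume_preserving_equiv_real_prod.measure_preimage_equiv, Measure.volume_eq_prod,
    Measure.prod_prod]
  simp

/-- The boundary lies on the unit circle and two vertical lines, all of area 0. -/
theorem volume_fd_diff_fdo : volume (ModularGroup.fd \ ModularGroup.fdo) = 0 := by
  apply measure_eq_zero_of_volume_image_coe
  refine measure_mono_null (t := Metric.sphere (0 : ℂ) 1 ∪ ({z | z.re = 1 / 2} ∪ {z | z.re = -(1 / 2)}))
    ?_ (measure_union_null (Measure.addHaar_sphere _ _ _)
      (measure_union_null (volume_re_eq _) (volume_re_eq _)))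
  rintro _ ⟨τ, ⟨⟨h1, h2⟩, h3⟩, rfl⟩
  by_cases h : 1 < Complex.normSq τ
  · right
    have h4 : |τ.re| = 1 / 2 := le_antisymm h2 (not_lt.1 fun h4 => h3 ⟨h, h4⟩)
    exact eq_or_eq_neg_of_abs_eq h4
  · left
    have : Complex.normSq τ = 1 := le_antisymm (not_lt.1 h) h1
    rw [Complex.normSq_eq_norm_sq] at this
    have h5 : ‖(τ : ℂ)‖ = 1 := by
      have h0 := norm_nonneg (τ : ℂ)
      nlinarith
    simpa using h5

theorem fd_ae_eq_fdo : ModularGroup.fd =ᵐ[volume] ModularGroup.fdo := by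
  refine Filter.EventuallyLE.antisymm ?_ ?_
  · exact ae_le_set.2 volume_fd_diff_fdo
  · exact Filter.Eventually.of_forall fun z hz => ModularGroup.fdo_subset_fd hz

theorem measurePreserving_coe : MeasurePreserving UpperHalfPlane.coe
    (volume.comap UpperHalfPlane.coe) (volume.restrict (Set.range UpperHalfPlane.coe)) :=
  ⟨UpperHalfPlane.measurable_coe, by rw [UpperHalfPlane.measurableEmbedding_coe.map_comap]⟩

theorem measurable_invImSq :
    Measurable fun z : ℍ => ((1 / NNReal.mk z.im z.im_pos.le : NNReal) ^ 2) := by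
  have : Measurable fun z : ℍ => NNReal.mk z.im z.im_pos.le :=
    (UpperHalfPlane.continuous_im.subtype_mk _).measurable
  exact (this.const_div 1).pow_const 2

section

variable {E : Type*} [NormedAddCommGroup E] [NormedSpace ℝ E]

theorem smul_invImSq (z : ℍ) (x : E) :
    ((1 / NNReal.mk z.im z.im_pos.le : NNReal) ^ 2) • x = (((z : ℂ).im ^ 2)⁻¹ : ℝ) • x := by
  rw [NNReal.smul_def]
  simp

theorem integrableOn_iff_integrableOn_coe (Φ : ℂ → E) {s : Set ℍ} (hs : MeasurableSet s) :
    IntegrableOn (fun τ : ℍ => Φ τ) s ↔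
      IntegrableOn (fun z => ((z.im ^ 2)⁻¹ : ℝ) • Φ z) (((↑) : ℍ → ℂ) '' s) := by
  have hsub : ((↑) : ℍ → ℂ) '' s ⊆ Set.range ((↑) : ℍ → ℂ) := Set.image_subset_range _ _
  have h1 := measurePreserving_coe.integrableOn_image UpperHalfPlane.measurableEmbedding_coe
    (f := fun z => ((z.im ^ 2)⁻¹ : ℝ) • Φ z) (s := s)
  have e : (volume.restrict (Set.range UpperHalfPlane.coe)).restrict (UpperHalfPlane.coe '' s) =
      volume.restrict (UpperHalfPlane.coe '' s) :=
    Measure.restrict_restrict_of_subset hsub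
  rw [IntegrableOn, e] at h1
  rw [IntegrableOn, UpperHalfPlane.volume_def, restrict_withDensity hs,
    integrable_withDensity_iff_integrable_smul measurable_invImSq, IntegrableOn, h1]
  simp only [smul_invImSq]
  rfl

theorem setIntegral_eq_setIntegral_coe (Φ : ℂ → E) {s : Set ℍ} (hs : MeasurableSet s) :
    ∫ τ : ℍ in s, Φ τ = ∫ z in ((↑) : ℍ → ℂ) '' s, ((z.im ^ 2)⁻¹ : ℝ) • Φ z := by
  have hsub : ((↑) : ℍ → ℂ) '' s ⊆ Set.range ((↑) : ℍ → ℂ) := Set.image_subset_range _ _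
  have h1 := measurePreserving_coe.setIntegral_image_emb UpperHalfPlane.measurableEmbedding_coe
    (fun z => ((z.im ^ 2)⁻¹ : ℝ) • Φ z) s
  rw [Measure.restrict_restrict_of_subset hsub] at h1
  rw [h1, UpperHalfPlane.volume_def,
    setIntegral_withDensity_eq_setIntegral_smul measurable_invImSq _ hs]
  simp only [smul_invImSq]

/-- The fundamental domain in the coordinates `(φ, u)`, without its vertical sides. -/
def openArcRegion : Set (ℝ × ℝ) := Set.Ioo (-(Real.pi / 6)) (Real.pi / 6) ×ˢ Set.Ioi (0 : ℝ)

theorem measurableSet_openArcRegion : MeasurableSet openArcRegion :=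
  measurableSet_Ioo.prod measurableSet_Ioi

theorem openArcRegion_ae_eq : openArcRegion =ᵐ[volume] arcRegion := by
  rw [openArcRegion, arcRegion, Measure.volume_eq_prod]
  exact Measure.set_prod_ae_eq Ioo_ae_eq_Ioc (Filter.EventuallyEq.refl _ _)

/-- The coordinates `(φ, u)`, as a map of the plane. -/
noncomputable def arcMap (p : ℝ × ℝ) : ℝ × ℝ := (Real.sin p.1, Real.cos p.1 + p.2)

/-- The derivative of `arcMap`. -/
noncomputable def fderivArcMap (p : ℝ × ℝ) : ℝ × ℝ →L[ℝ] ℝ × ℝ :=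
  (Matrix.toLin (.finTwoProd ℝ) (.finTwoProd ℝ)
    !![Real.cos p.1, 0; -Real.sin p.1, 1]).toContinuousLinearMap

theorem hasFDerivAt_arcMap (p : ℝ × ℝ) : HasFDerivAt arcMap (fderivArcMap p) p := by
  unfold fderivArcMap
  rw [Matrix.toLin_finTwoProd_toContinuousLinearMap]
  convert! HasFDerivAt.prodMk (𝕜 := ℝ) (hasFDerivAt_fst (p := p)).sin
    ((hasFDerivAt_fst (p := p)).cos.add hasFDerivAt_snd) using 2 <;> simp

theorem det_fderivArcMap (p : ℝ × ℝ) : (fderivArcMap p).det = Real.cos p.1 := by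
  unfold fderivArcMap
  simp only [LinearMap.det_toContinuousLinearMap, LinearMap.det_toLin, Matrix.det_fin_two_of]
  ring

theorem strictMonoOn_sin_arc : StrictMonoOn Real.sin (Set.Icc (-(Real.pi / 6)) (Real.pi / 6)) :=
  Real.strictMonoOn_sin.mono (Set.Icc_subset_Icc (by linarith [Real.pi_pos]) (by linarith [Real.pi_pos]))

theorem injOn_arcMap : Set.InjOn arcMap openArcRegion := by
  rintro ⟨φ, u⟩ hp ⟨φ', u'⟩ hq h
  simp only [arcMap, Prod.mk.injEq] at h
  have h1 : φ = φ' := strictMonoOn_sin_arc.injOn (Set.Ioo_subset_Icc_self hp.1)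
    (Set.Ioo_subset_Icc_self hq.1) h.1
  subst h1
  simpa using h.2

/-- For |φ| < π/6 the abscissa sin φ fills (-1/2, 1/2), and u > 0 says that the point lies above the
unit circle. -/
theorem arcMap_image : arcMap '' openArcRegion =
    Complex.measurableEquivRealProd '' (((↑) : ℍ → ℂ) '' ModularGroup.fdo) := by
  have hpi := Real.pi_pos
  have h6 : Real.sin (Real.pi / 6) = 1 / 2 := Real.sin_pi_div_six
  rw [ModularGroup.coe_fdo]
  ext ⟨x, y⟩
  constructor
  · rintro ⟨⟨φ, u⟩, ⟨hφ, hu⟩, h⟩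
    simp only [arcMap, Prod.mk.injEq] at h
    obtain ⟨rfl, rfl⟩ := h
    have hu : 0 < u := hu
    have hc := one_half_le_cos (Set.Ioo_subset_Icc_self hφ)
    refine ⟨⟨Real.sin φ, Real.cos φ + u⟩, ⟨?_, ?_, ?_⟩, ?_⟩
    · simp only
      linarith
    · rw [← one_lt_sq_iff₀ (norm_nonneg _), ← Complex.normSq_eq_norm_sq, Complex.normSq_mk]
      nlinarith [Real.sin_sq_add_cos_sq φ]
    · simp only
      have h1 := strictMonoOn_sin_arc (Set.Ioo_subset_Icc_self hφ)
        (Set.right_mem_Icc.2 (by linarith)) hφ.2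
      have h2 := strictMonoOn_sin_arc (Set.left_mem_Icc.2 (by linarith))
        (Set.Ioo_subset_Icc_self hφ) hφ.1
      rw [Real.sin_neg] at h2
      rw [abs_lt]
      constructor <;> linarith
    · simp
  · rintro ⟨z, ⟨h1, h2, h3⟩, h4⟩
    simp only [Complex.measurableEquivRealProd_apply, Prod.mk.injEq] at h4
    obtain ⟨rfl, rfl⟩ := h4
    rw [abs_lt] at h3
    have hs : Real.sin (Real.arcsin z.re) = z.re :=
      Real.sin_arcsin (by linarith) (by linarith)
    have hc : Real.cos (Real.arcsin z.re) = √(1 - z.re ^ 2) := Real.cos_arcsin _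
    refine ⟨(Real.arcsin z.re, z.im - Real.cos (Real.arcsin z.re)), ⟨⟨?_, ?_⟩, ?_⟩, ?_⟩
    · simp only
      rw [Real.lt_arcsin_iff_sin_lt' ⟨by linarith, by linarith⟩, Real.sin_neg, h6]
      exact h3.1
    · simp only
      rw [Real.arcsin_lt_iff_lt_sin' ⟨by linarith, by linarith⟩, h6]
      exact h3.2
    · have h5 : √(1 - z.re ^ 2) < z.im := by
        rw [Real.sqrt_lt' h1]
        rw [← one_lt_sq_iff₀ (norm_nonneg _), ← Complex.normSq_eq_norm_sq, Complex.normSq_apply] at h2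
        linarith
      simp only [Set.mem_Ioi, hc]
      linarith
    · simp [arcMap, hs]

theorem symm_arcMap (p : ℝ × ℝ) : Complex.measurableEquivRealProd.symm (arcMap p) = arcCoord p := by
  apply Complex.ext <;> simp [arcMap]

/-- Change of variables with Jacobian cos φ, carried out between the open regions, where the
coordinates are injective, and transferred to the closed domain across null sets. -/
theorem integrableOn_fd_iff (Φ : ℂ → E) :
    IntegrableOn (fun τ : ℍ => Φ τ) ModularGroup.fd ↔
      IntegrableOn (fun p => Real.cos p.1 • ((((arcCoord p).im ^ 2)⁻¹ : ℝ) • Φ (arcCoord p)))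
        arcRegion := by
  rw [integrableOn_congr_set_ae fd_ae_eq_fdo,
    integrableOn_iff_integrableOn_coe _ ModularGroup.isOpen_fdo.measurableSet,
    ← integrableOn_congr_set_ae openArcRegion_ae_eq]
  set Ψ : ℂ → E := fun z => ((z.im ^ 2)⁻¹ : ℝ) • Φ z
  have h1 := Complex.volume_preserving_equiv_real_prod.integrableOn_image
    Complex.measurableEquivRealProd.measurableEmbedding
    (f := Ψ ∘ Complex.measurableEquivRealProd.symm) (s := ((↑) : ℍ → ℂ) '' ModularGroup.fdo)
  have h2 := integrableOn_image_iff_integrableOn_abs_det_fderiv_smul volume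
    measurableSet_openArcRegion (fun p _ => (hasFDerivAt_arcMap p).hasFDerivWithinAt) injOn_arcMap
    (Ψ ∘ Complex.measurableEquivRealProd.symm)
  rw [arcMap_image, h1] at h2
  have e : (Ψ ∘ Complex.measurableEquivRealProd.symm) ∘ Complex.measurableEquivRealProd = Ψ := by
    funext z; simp only [Function.comp_apply, MeasurableEquiv.symm_apply_apply]
  rw [e] at h2
  rw [h2]
  refine integrableOn_congr_fun (fun p hp => ?_) measurableSet_openArcRegion
  have hc := one_half_le_cos (Set.Ioo_subset_Icc_self hp.1)
  simp only [det_fderivArcMap, Function.comp_apply, symm_arcMap, Ψ]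
  rw [abs_of_pos (by linarith)]

theorem setIntegral_fd (Φ : ℂ → E) :
    ∫ τ : ℍ in ModularGroup.fd, Φ τ =
      ∫ p in arcRegion, Real.cos p.1 • ((((arcCoord p).im ^ 2)⁻¹ : ℝ) • Φ (arcCoord p)) := by
  rw [setIntegral_congr_set fd_ae_eq_fdo,
    setIntegral_eq_setIntegral_coe _ ModularGroup.isOpen_fdo.measurableSet,
    ← setIntegral_congr_set openArcRegion_ae_eq]
  set Ψ : ℂ → E := fun z => ((z.im ^ 2)⁻¹ : ℝ) • Φ z
  have h1 := Complex.volume_preserving_equiv_real_prod.setIntegral_image_emb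
    Complex.measurableEquivRealProd.measurableEmbedding
    (Ψ ∘ Complex.measurableEquivRealProd.symm) (((↑) : ℍ → ℂ) '' ModularGroup.fdo)
  have h2 := integral_image_eq_integral_abs_det_fderiv_smul volume
    measurableSet_openArcRegion (fun p _ => (hasFDerivAt_arcMap p).hasFDerivWithinAt) injOn_arcMap
    (Ψ ∘ Complex.measurableEquivRealProd.symm)
  rw [arcMap_image, h1] at h2
  simp only [Function.comp_apply, MeasurableEquiv.symm_apply_apply] at h2
  rw [h2]
  refine setIntegral_congr_fun measurableSet_openArcRegion fun p hp => ?_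
  have hc := one_half_le_cos (Set.Ioo_subset_Icc_self hp.1)
  simp only [det_fderivArcMap, symm_arcMap, Ψ]
  rw [abs_of_pos (by linarith)]

end

/-! ### Fundamental domains for `Γ₀(N)` -/

theorem measurePreserving_sl_smul (γ : SL(2, ℤ)) :
    MeasurePreserving (fun τ : ℍ => γ • τ) volume volume :=
  measurePreserving_smul (toGL ((map (Int.castRingHom ℝ)) γ)) (volume : Measure ℍ)

theorem measurableEmbedding_sl_smul (γ : SL(2, ℤ)) : MeasurableEmbedding fun τ : ℍ => γ • τ :=
  measurableEmbedding_const_smul (toGL ((map (Int.castRingHom ℝ)) γ))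

theorem measurableSet_sl_smul (γ : SL(2, ℤ)) {s : Set ℍ} (hs : MeasurableSet s) :
    MeasurableSet (γ • s) :=
  (measurableEmbedding_sl_smul γ).measurableSet_image' hs

theorem volume_sl_smul (γ : SL(2, ℤ)) (s : Set ℍ) :
    volume (γ • s) = volume s := by
  have h := (measurePreserving_sl_smul γ).measure_preimage_emb (measurableEmbedding_sl_smul γ) (γ • s)
  rw [← h]
  congr 1
  ext τ
  exact (Set.smul_mem_smul_set_iff (a := γ) (x := τ) (s := s))

/-- Two points of the open domain can be equivalent only under ±1, so any overlap involves a
boundary point of one of the translates. -/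
theorem aedisjoint_smul_fd {γ γ' : SL(2, ℤ)} (h : γ ≠ γ') (h' : γ ≠ -γ') :
    AEDisjoint volume (γ • ModularGroup.fd) (γ' • ModularGroup.fd) := by
  refine measure_mono_null (t := γ • (ModularGroup.fd \ ModularGroup.fdo) ∪
      γ' • (ModularGroup.fd \ ModularGroup.fdo)) ?_ (measure_union_null ?_ ?_)
  · rintro _ ⟨⟨a, ha, rfl⟩, ⟨b, hb, hab⟩⟩
    by_cases ha' : a ∈ ModularGroup.fdo
    · by_cases hb' : b ∈ ModularGroup.fdo
      · exfalso
        have hab' : (γ'⁻¹ * γ) • a = b := by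
          rw [mul_smul, inv_smul_eq_iff]
          exact hab.symm
        rcases ModularGroup.eq_one_or_neg_one_of_mem_fdo_mem_fdo ha' (g := γ'⁻¹ * γ)
          (hab' ▸ hb') with h1 | h1
        · exact h (inv_mul_eq_one.1 h1).symm
        · rw [inv_mul_eq_iff_eq_mul, mul_neg, mul_one] at h1
          exact h' h1
      · right
        rw [← hab]
        exact Set.smul_mem_smul_set ⟨hb, hb'⟩
    · left
      exact Set.smul_mem_smul_set ⟨ha, ha'⟩
  · rw [volume_sl_smul, volume_fd_diff_fdo]
  · rw [volume_sl_smul, volume_fd_diff_fdo]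

theorem neg_one_mem_Gamma0 (N : ℕ) : (-1 : SL(2, ℤ)) ∈ Gamma0 N := by
  simp [Gamma0_mem]

section

variable {N : ℕ} (R : CosetReps N)

theorem CosetReps.eq_of_mul_inv_mem {i j : Fin R.r} (h : R.rep i * (R.rep j)⁻¹ ∈ Gamma0 N) :
    i = j :=
  (R.existsUnique (R.rep i)).unique (by simp [one_mem]) h

theorem CosetReps.aedisjoint_smul_fd {γ γ' : SL(2, ℤ)} (hγ : γ ∈ Gamma0 N) (hγ' : γ' ∈ Gamma0 N)
    {i j : Fin R.r} (h : i = j → γ ≠ γ' ∧ γ ≠ -γ') :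
    AEDisjoint volume ((γ * R.rep i) • ModularGroup.fd) ((γ' * R.rep j) • ModularGroup.fd) := by
  have hij : ∀ δ ∈ Gamma0 N, γ * R.rep i = δ * R.rep j → i = j := by
    intro δ hδ e
    apply R.eq_of_mul_inv_mem
    have : R.rep i * (R.rep j)⁻¹ = γ⁻¹ * δ := by
      rw [mul_inv_eq_iff_eq_mul, mul_assoc, ← e, inv_mul_cancel_left]
    rw [this]
    exact mul_mem (inv_mem hγ) hδ
  refine _root_.aedisjoint_smul_fd (fun e => ?_) fun e => ?_
  · have := hij _ hγ' e
    subst this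
    exact (h rfl).1 (mul_right_cancel e)
  · have e' : γ * R.rep i = -γ' * R.rep j := by rw [e, neg_mul]
    have hn : -γ' ∈ Gamma0 N := by
      simpa using mul_mem (neg_one_mem_Gamma0 N) hγ'
    have := hij _ hn e'
    subst this
    exact (h rfl).2 (mul_right_cancel e')

theorem isFundamentalDomainGamma0_iUnion :
    IsFundamentalDomainGamma0 N (⋃ j, R.rep j • ModularGroup.fd) := by
  refine ⟨?_, ?_, ?_⟩
  · exact (MeasurableSet.iUnion fun j =>
      measurableSet_sl_smul _ ModularGroup.isClosed_fd.measurableSet).nullMeasurableSet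
  · refine .of_forall fun τ => ?_
    obtain ⟨γ, hγ⟩ := ModularGroup.exists_smul_mem_fd τ
    obtain ⟨j, hj, -⟩ := R.existsUnique γ⁻¹
    have hj' : R.rep j * γ ∈ Gamma0 N := by simpa using inv_mem hj
    refine ⟨⟨_, Subgroup.mem_map_of_mem _ hj'⟩, Set.mem_iUnion.2 ⟨j, γ • τ, hγ, ?_⟩⟩
    exact (mul_smul (R.rep j) γ τ).symm
  · rintro ⟨_, γ, hγ, rfl⟩ ⟨_, γ', hγ', rfl⟩ hne
    have key : ∀ δ : SL(2, ℤ), (MulAction.toPermHom SL(2, ℤ) ℍ δ) •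
        (⋃ j, R.rep j • ModularGroup.fd) = ⋃ j, (δ * R.rep j) • ModularGroup.fd := by
      intro δ
      have : ∀ s : Set ℍ, (MulAction.toPermHom SL(2, ℤ) ℍ δ) • s = δ • s := fun s => rfl
      rw [this, Set.smul_set_iUnion]
      simp only [mul_smul]
    change AEDisjoint volume ((MulAction.toPermHom SL(2, ℤ) ℍ γ) • _)
      ((MulAction.toPermHom SL(2, ℤ) ℍ γ') • _)
    rw [key, key, AEDisjoint.iUnion_left_iff]
    intro i
    rw [AEDisjoint.iUnion_right_iff]
    intro j
    refine R.aedisjoint_smul_fd hγ hγ' fun _ => ⟨fun e => ?_, fun e => ?_⟩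
    · exact hne (by simp [e])
    -- The elements γ' and -γ' are different matrices but the same permutation of ℍ.
    · refine hne (Subtype.ext (Equiv.ext fun τ => ?_))
      change γ • τ = γ' • τ
      rw [e]
      exact ModularGroup.SL_neg_smul _ _

/-! ### Unfolding invariant integrals. -/

variable {E : Type*} [NormedAddCommGroup E] {F : Set ℍ}

instance instCountableSL : Countable SL(2, ℤ) := by
  unfold Matrix.SpecialLinearGroup Matrix
  infer_instance

theorem measurableConstSMul_Gamma0 (N : ℕ) :
    MeasurableConstSMul ((Gamma0 N).map (MulAction.toPermHom SL(2, ℤ) ℍ)) ℍ :=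
  ⟨by
    rintro ⟨_, γ, -, rfl⟩
    exact (measurePreserving_sl_smul γ).measurable⟩

theorem smulInvariantMeasure_Gamma0 (N : ℕ) :
    SMulInvariantMeasure ((Gamma0 N).map (MulAction.toPermHom SL(2, ℤ) ℍ)) ℍ volume :=
  ⟨by
    rintro ⟨_, γ, -, rfl⟩ s hs
    exact (measurePreserving_sl_smul γ).measure_preimage hs.nullMeasurableSet⟩

theorem countable_Gamma0_map (N : ℕ) :
    Countable ((Gamma0 N).map (MulAction.toPermHom SL(2, ℤ) ℍ)) :=
  Function.Surjective.countable
    ((MulAction.toPermHom SL(2, ℤ) ℍ).subgroupMap_surjective (Gamma0 N))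

theorem integrableOn_smul_fd_iff (γ : SL(2, ℤ)) (Φ : ℍ → E) :
    IntegrableOn Φ (γ • ModularGroup.fd) ↔ IntegrableOn (fun τ => Φ (γ • τ)) ModularGroup.fd :=
  (measurePreserving_sl_smul γ).integrableOn_image (measurableEmbedding_sl_smul γ)

theorem IsFundamentalDomainGamma0.integrableOn_iff (hF : IsFundamentalDomainGamma0 N F) {Φ : ℍ → E}
    (hΦ : ∀ γ ∈ Gamma0 N, ∀ τ, Φ (γ • τ) = Φ τ) :
    IntegrableOn Φ F ↔ ∀ j, IntegrableOn (fun τ => Φ (R.rep j • τ)) ModularGroup.fd := by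
  have := measurableConstSMul_Gamma0 N
  have := smulInvariantMeasure_Gamma0 N
  have := countable_Gamma0_map N
  rw [IsFundamentalDomain.integrableOn_iff hF (isFundamentalDomainGamma0_iUnion R)
    (by rintro ⟨_, γ, hγ, rfl⟩ τ; exact hΦ γ hγ τ), integrableOn_finite_iUnion]
  simp only [integrableOn_smul_fd_iff]

theorem IsFundamentalDomainGamma0.setIntegral_eq [NormedSpace ℝ E] (hF : IsFundamentalDomainGamma0 N F) {Φ : ℍ → E}
    (hΦ : ∀ γ ∈ Gamma0 N, ∀ τ, Φ (γ • τ) = Φ τ) (hint : IntegrableOn Φ F) :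
    ∫ τ in F, Φ τ = ∑ j, ∫ τ in ModularGroup.fd, Φ (R.rep j • τ) := by
  have := measurableConstSMul_Gamma0 N
  have := smulInvariantMeasure_Gamma0 N
  have := countable_Gamma0_map N
  have hinv : ∀ (σ : (Gamma0 N).map (MulAction.toPermHom SL(2, ℤ) ℍ)) (τ : ℍ), Φ (σ • τ) = Φ τ := by
    rintro ⟨_, γ, hγ, rfl⟩ τ
    exact hΦ γ hγ τ
  rw [IsFundamentalDomain.setIntegral_eq hF (isFundamentalDomainGamma0_iUnion R) hinv]
  rw [IsFundamentalDomain.integrableOn_iff hF (isFundamentalDomainGamma0_iUnion R) hinv] at hint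
  rw [integral_iUnion_ae (fun j => (measurableSet_sl_smul _
    ModularGroup.isClosed_fd.measurableSet).nullMeasurableSet) (fun i j hij => ?_) hint,
    tsum_fintype]
  · exact Finset.sum_congr rfl fun j _ =>
      (measurePreserving_sl_smul _).setIntegral_image_emb (measurableEmbedding_sl_smul _) Φ _
  · have := R.aedisjoint_smul_fd (one_mem _) (one_mem _) (fun h => absurd h hij)
    simpa using this

/-- The representatives describe cosets Γ₀(N)γ; inversion turns them into the cosets γΓ₀(N) that the
index counts. -/
theorem CosetReps.r_eq_index : R.r = (Gamma0 N).index := by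
  have hb : Function.Bijective fun j : Fin R.r => (QuotientGroup.mk (R.rep j)⁻¹ : SL(2, ℤ) ⧸ Gamma0 N) := by
    constructor
    · intro i j h
      refine R.eq_of_mul_inv_mem ?_
      have := QuotientGroup.eq.1 h
      simpa using this
    · intro q
      obtain ⟨γ, rfl⟩ := QuotientGroup.mk_surjective q
      obtain ⟨j, hj, -⟩ := R.existsUnique γ⁻¹
      refine ⟨j, QuotientGroup.eq.2 ?_⟩
      simpa using inv_mem hj
  rw [Subgroup.index, ← Nat.card_eq_of_bijective _ hb, Nat.card_fin]

end

/-! ### Translates of modular forms with character -/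

theorem slash_T_ofComplex (k : ℕ) (f : ℍ → ℂ) {z : ℂ} (hz : 0 < z.im) :
    ((f ∣[(k : ℤ)] ModularGroup.T) ∘ ofComplex) z = (f ∘ ofComplex) (z + 1) := by
  have h1 : 0 < (z + 1).im := by simpa using hz
  rw [Function.comp_apply, Function.comp_apply, ModularForm.SL_slash_apply,
    UpperHalfPlane.modular_T_smul, ofComplex_apply_of_im_pos hz, ofComplex_apply_of_im_pos h1]
  have e : ((1 : ℝ) +ᵥ (⟨z, hz⟩ : ℍ)) = ⟨z + 1, h1⟩ := by
    apply UpperHalfPlane.ext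
    simp [add_comm]
  have hd : denom (toGL ((map (Int.castRingHom ℝ)) ModularGroup.T)) z = 1 :=
    (ModularGroup.denom_apply ModularGroup.T ⟨z, hz⟩).trans (by simp [ModularGroup.coe_T])
  rw [e]
  simp [hd]

theorem im_neg_one_div_pos {z : ℂ} (hz : 0 < z.im) : 0 < (-1 / z).im := by
  have : z ≠ 0 := fun h => by simp [h] at hz
  rw [neg_div, Complex.neg_im, one_div, Complex.inv_im]
  have := Complex.normSq_pos.2 this
  simp only [neg_div, neg_neg]
  positivity

theorem slash_S_ofComplex (k : ℕ) (f : ℍ → ℂ) {z : ℂ} (hz : 0 < z.im) :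
    (f ∘ ofComplex) (-1 / z) = z ^ k * ((f ∣[(k : ℤ)] ModularGroup.S) ∘ ofComplex) z := by
  have hz0 : z ≠ 0 := fun h => by simp [h] at hz
  have h1 := im_neg_one_div_pos hz
  rw [Function.comp_apply, Function.comp_apply, ModularForm.SL_slash_apply,
    UpperHalfPlane.modular_S_smul, ofComplex_apply_of_im_pos hz, ofComplex_apply_of_im_pos h1]
  have e : UpperHalfPlane.mk (-(((⟨z, hz⟩ : ℍ) : ℂ)))⁻¹ ((⟨z, hz⟩ : ℍ).im_inv_neg_coe_pos) =
      ⟨-1 / z, h1⟩ := by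
    apply UpperHalfPlane.ext
    simp [neg_div]
  have hd : denom (toGL ((map (Int.castRingHom ℝ)) ModularGroup.S)) z = z :=
    (ModularGroup.denom_apply ModularGroup.S ⟨z, hz⟩).trans (by simp [ModularGroup.coe_S])
  rw [e]
  simp [hd]
  field_simp

theorem peterssonIntegrand_eq_petersson (k : ℕ) (f g : ℍ → ℂ) (τ : ℍ) :
    peterssonIntegrand k f g τ = petersson k g f τ := by
  simp [peterssonIntegrand, petersson, mul_comm]

theorem peterssonIntegrand_smul (k : ℕ) (f g : ℍ → ℂ) (γ : SL(2, ℤ)) (τ : ℍ) :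
    peterssonIntegrand k f g (γ • τ) =
      peterssonIntegrand k (f ∣[(k : ℤ)] γ) (g ∣[(k : ℤ)] γ) τ := by
  rw [peterssonIntegrand_eq_petersson, peterssonIntegrand_eq_petersson, petersson_slash_SL]

section

variable {N k : ℕ} {χ : DirichletCharacter ℂ N}

/-- Since N divides c, the determinant gives ad ≡ 1 mod N; thus d is a unit, where χ has absolute
value 1. -/
theorem norm_character_Gamma0 (χ : DirichletCharacter ℂ N) {γ : SL(2, ℤ)}
    (hγ : γ ∈ Gamma0 N) : ‖χ ((γ 1 1 : ℤ) : ZMod N)‖ = 1 := by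
  have hdet : ((γ 0 0 : ℤ) : ZMod N) * ((γ 1 1 : ℤ) : ZMod N) = 1 := by
    have h := γ.det_coe
    rw [Matrix.det_fin_two] at h
    have h' := congrArg (Int.cast : ℤ → ZMod N) h
    have h0 : ((γ 1 0 : ℤ) : ZMod N) = 0 := Gamma0_mem.1 hγ
    push_cast at h'
    rwa [h0, mul_zero, sub_zero] at h'
  obtain ⟨u, hu⟩ := IsUnit.of_mul_eq_one_right _ hdet
  rw [← hu]
  exact χ.unit_norm_eq_one u

theorem character_mul_conj (χ : DirichletCharacter ℂ N) {γ : SL(2, ℤ)} (hγ : γ ∈ Gamma0 N) :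
    χ ((γ 1 1 : ℤ) : ZMod N) * conj (χ ((γ 1 1 : ℤ) : ZMod N)) = 1 := by
  rw [Complex.mul_conj, Complex.normSq_eq_norm_sq, norm_character_Gamma0 χ hγ]
  simp

variable {f g : ModularForm ((Gamma1 N).map (mapGL ℝ)) (k : ℤ)}

theorem peterssonIntegrand_Gamma0 (hf : f ∈ modularFormsWithCharacter N χ k)
    (hg : g ∈ modularFormsWithCharacter N χ k) {γ : SL(2, ℤ)} (hγ : γ ∈ Gamma0 N) (τ : ℍ) :
    peterssonIntegrand k f g (γ • τ) = peterssonIntegrand k f g τ := by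
  rw [peterssonIntegrand_smul, hf γ hγ, hg γ hγ]
  have := character_mul_conj χ hγ
  simp only [peterssonIntegrand, Pi.smul_apply, smul_eq_mul, map_mul]
  linear_combination f τ * conj (g τ) * (τ.im : ℂ) ^ k * this

/-! ### The permutation action and the behaviour of the translates at i∞. -/

variable (R : CosetReps N)

theorem CosetReps.act_spec (α : SL(2, ℤ)) (j : Fin R.r) :
    R.rep j * α * (R.rep (R.act α j))⁻¹ ∈ Gamma0 N :=
  (R.existsUnique (R.rep j * α)).choose_spec.1

theorem CosetReps.act_eq_of_mem {α : SL(2, ℤ)} {i j : Fin R.r}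
    (h : R.rep i * α * (R.rep j)⁻¹ ∈ Gamma0 N) : R.act α i = j :=
  (R.existsUnique (R.rep i * α)).unique (R.act_spec α i) h

/-- S² = -1 lies in Γ₀(N). -/
theorem CosetReps.act_S_act_S (j : Fin R.r) :
    R.act ModularGroup.S (R.act ModularGroup.S j) = j := by
  apply R.act_eq_of_mem
  have h := mul_mem (neg_one_mem_Gamma0 N) (inv_mem (R.act_spec ModularGroup.S j))
  have e : R.rep (R.act ModularGroup.S j) * ModularGroup.S * (R.rep j)⁻¹ =
      -1 * (R.rep j * ModularGroup.S * (R.rep (R.act ModularGroup.S j))⁻¹)⁻¹ := by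
    rw [mul_inv_rev, mul_inv_rev, inv_inv, ModularGroup.S_inv]
    simp [mul_assoc]
  rw [e]
  exact h

theorem CosetReps.act_injective (α : SL(2, ℤ)) : Function.Injective (R.act α) := by
  intro i j h
  apply R.eq_of_mul_inv_mem
  have h1 := mul_mem (R.act_spec α i) (inv_mem (R.act_spec α j))
  rw [h] at h1
  simpa [mul_assoc] using h1

/-- The permutation of the indices induced by `α`. -/
noncomputable def CosetReps.actPerm (α : SL(2, ℤ)) : Equiv.Perm (Fin R.r) :=
  Equiv.ofBijective _ (Finite.injective_iff_bijective.1 (R.act_injective α))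

/-- The factor `c` for which `f_j ∣ α = c f_{α(j)}`. -/
noncomputable def CosetReps.factor (χ : DirichletCharacter ℂ N) (α : SL(2, ℤ)) (j : Fin R.r) : ℂ :=
  χ (((R.rep j * α * (R.rep (R.act α j))⁻¹) 1 1 : ℤ) : ZMod N)

theorem CosetReps.factor_mul_conj (χ : DirichletCharacter ℂ N) (α : SL(2, ℤ)) (j : Fin R.r) :
    R.factor χ α j * conj (R.factor χ α j) = 1 :=
  character_mul_conj χ (R.act_spec α j)

theorem CosetReps.slash_eq (hf : f ∈ modularFormsWithCharacter N χ k) (γ : SL(2, ℤ)) {j : Fin R.r}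
    (hj : γ * (R.rep j)⁻¹ ∈ Gamma0 N) : ⇑f ∣[(k : ℤ)] γ =
      χ (((γ * (R.rep j)⁻¹) 1 1 : ℤ) : ZMod N) • R.translate k f j := by
  have e : γ = γ * (R.rep j)⁻¹ * R.rep j := by simp
  conv_lhs => rw [e, SlashAction.slash_mul, hf _ hj]
  rw [ModularForm.SL_smul_slash]
  rfl

theorem CosetReps.translate_slash (hf : f ∈ modularFormsWithCharacter N χ k) (α : SL(2, ℤ))
    (j : Fin R.r) : R.translate k f j ∣[(k : ℤ)] α =
      R.factor χ α j • R.translate k f (R.act α j) := by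
  rw [CosetReps.translate, ← SlashAction.slash_mul]
  exact R.slash_eq hf _ (R.act_spec α j)

theorem CosetReps.mdifferentiable_translate (f : ModularForm ((Gamma1 N).map (mapGL ℝ)) (k : ℤ))
    (j : Fin R.r) : MDifferentiable (modelWithCornersSelf ℂ ℂ) (modelWithCornersSelf ℂ ℂ)
      (R.translate k f j) :=
  (ModularFormClass.holo f).slash k _

theorem CosetReps.differentiableOn_translate (f : ModularForm ((Gamma1 N).map (mapGL ℝ)) (k : ℤ))
    (j : Fin R.r) : DifferentiableOn ℂ (R.translate k f j ∘ ofComplex) {z | 0 < z.im} :=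
  UpperHalfPlane.mdifferentiable_iff.1 (R.mdifferentiable_translate f j)

theorem CosetReps.continuous_translate (f : ModularForm ((Gamma1 N).map (mapGL ℝ)) (k : ℤ))
    (j : Fin R.r) : Continuous (R.translate k f j) :=
  (R.mdifferentiable_translate f j).continuous

/-- T^N lies in Γ(N), which is normal, so its conjugate by γ_j has lower right entry d ≡ 1 mod N and
χ contributes no factor. -/
theorem CosetReps.periodic_translate (hf : f ∈ modularFormsWithCharacter N χ k) (j : Fin R.r) :
    Function.Periodic (R.translate k f j ∘ ofComplex) (N : ℝ) := by
  have hN : R.translate k f j ∣[(k : ℤ)] (ModularGroup.T ^ (N : ℤ)) = R.translate k f j := by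
    have hmem : R.rep j * ModularGroup.T ^ (N : ℤ) * (R.rep j)⁻¹ ∈ Gamma N :=
      (Gamma_normal N).conj_mem _ (ModularGroup_T_pow_mem_Gamma N N dvd_rfl) _
    obtain ⟨-, -, h10, h11⟩ := Gamma_mem.1 hmem
    rw [CosetReps.translate, ← SlashAction.slash_mul, R.slash_eq hf _ (Gamma0_mem.2 h10), h11]
    simp [CosetReps.translate]
  intro z
  by_cases hz : 0 < z.im
  · have hz' : 0 < (z + (N : ℝ)).im := by simpa using hz
    rw [Function.comp_apply, Function.comp_apply, ofComplex_apply_of_im_pos hz,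
      ofComplex_apply_of_im_pos hz']
    have h2 := congrFun hN ⟨z, hz⟩
    have hd : denom (toGL ((map (Int.castRingHom ℝ)) (ModularGroup.T ^ (N : ℤ)))) z = 1 :=
      (ModularGroup.denom_apply (ModularGroup.T ^ (N : ℤ)) ⟨z, hz⟩).trans
        (by rw [ModularGroup.coe_T_zpow]; simp)
    rw [ModularForm.SL_slash_apply, hd, one_zpow, mul_one] at h2
    rw [← h2]
    have e : (ModularGroup.T ^ (N : ℤ)) • (⟨z, hz⟩ : ℍ) = ⟨z + (N : ℝ), hz'⟩ := by
      apply UpperHalfPlane.ext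
      rw [ModularGroup.coe_T_zpow_smul_eq]
      simp
    rw [e]
  -- Off the half-plane `ofComplex` is constant, so periodicity is automatic there.
  · have hz' : (z + (N : ℝ)).im ≤ 0 := by simpa using hz
    rw [Function.comp_apply, Function.comp_apply, ofComplex_apply_of_im_nonpos (not_lt.1 hz),
      ofComplex_apply_of_im_nonpos hz']

/-- T fixes the cusp i∞. This makes E stable under T, which the matching of the vertical sides
needs. -/
theorem CosetReps.isZeroAtImInfty_act_T (hf : f ∈ modularFormsWithCharacter N χ k) (j : Fin R.r) :
    IsZeroAtImInfty (R.translate k f (R.act ModularGroup.T j)) ↔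
      IsZeroAtImInfty (R.translate k f j) := by
  have hc := R.factor_mul_conj χ ModularGroup.T j
  have e := R.translate_slash hf ModularGroup.T j
  constructor
  · intro h
    have e2 : R.translate k f j = (R.factor χ ModularGroup.T j •
        R.translate k f (R.act ModularGroup.T j)) ∣[(k : ℤ)] ModularGroup.T⁻¹ := by
      rw [← e, ← SlashAction.slash_mul, mul_inv_cancel, SlashAction.slash_one]
    rw [e2]
    refine IsZeroAtImInfty.slash _ ?_ (h.smul _)
    change (((ModularGroup.T⁻¹ : SL(2, ℤ)) 1 0 : ℤ) : ℝ) = 0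
    simp
  · intro h
    have e2 : R.translate k f (R.act ModularGroup.T j) = conj (R.factor χ ModularGroup.T j) •
        (R.translate k f j ∣[(k : ℤ)] ModularGroup.T) := by
      rw [e, smul_smul, mul_comm, hc, one_smul]
    rw [e2]
    refine Filter.ZeroAtFilter.smul _ (IsZeroAtImInfty.slash _ ?_ h)
    simp

variable [NeZero N]

theorem CosetReps.isBoundedAtImInfty_translate
    (f : ModularForm ((Gamma1 N).map (mapGL ℝ)) (k : ℤ)) (j : Fin R.r) :
    IsBoundedAtImInfty (R.translate k f j) :=
  ModularFormClass.bdd_at_infty_slash f (R.rep j)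

theorem CosetReps.subExp_translate (f : ModularForm ((Gamma1 N).map (mapGL ℝ)) (k : ℤ))
    (j : Fin R.r) : SubExp (R.translate k f j ∘ ofComplex) := by
  have h : ExpBound 0 (R.translate k f j ∘ ofComplex) := by
    refine expBound_comp_ofComplex (R.continuous_translate f j) ?_
    have := R.isBoundedAtImInfty_translate f j
    simpa [IsBoundedAtImInfty, Filter.BoundedAtFilter, Pi.one_def] using this
  exact fun ε hε => h.mono hε.le

/-- The expansion in exp(2πiz/N) has no constant term, whence the rate 2π/N. -/
theorem CosetReps.expDecay_translate (hf : f ∈ modularFormsWithCharacter N χ k) {j : Fin R.r}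
    (h0 : IsZeroAtImInfty (R.translate k f j)) : ExpDecay (R.translate k f j ∘ ofComplex) := by
  have hN : (0 : ℝ) < N := by exact_mod_cast NeZero.pos N
  have h := h0.exp_decay_atImInfty hN (R.periodic_translate hf j) (R.mdifferentiable_translate f j)
    (R.isBoundedAtImInfty_translate f j)
  refine ⟨2 * Real.pi / N, by positivity, expBound_comp_ofComplex (R.continuous_translate f j) ?_⟩
  refine h.congr_right fun τ => ?_
  congr 1
  ring

theorem CosetReps.exists_tendsto_translate (hf : f ∈ modularFormsWithCharacter N χ k) (j : Fin R.r) :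
    ∃ v, Filter.Tendsto (R.translate k f j) atImInfty (nhds v) := by
  have hN : (0 : ℝ) < N := by exact_mod_cast NeZero.pos N
  have h := exp_decay_sub_atImInfty hN (R.periodic_translate hf j)
    (R.mdifferentiable_translate f j) (R.isBoundedAtImInfty_translate f j)
  refine ⟨valueAtInfty (R.translate k f j), tendsto_sub_nhds_zero_iff.1 (h.trans_tendsto ?_)⟩
  have him : Filter.Tendsto UpperHalfPlane.im atImInfty Filter.atTop := Filter.tendsto_comap
  refine Real.tendsto_exp_atBot.comp ?_
  have := him.const_mul_atTop_of_neg (r := -2 * Real.pi / N)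
    (div_neg_of_neg_of_pos (by linarith [Real.pi_pos]) hN)
  refine this.congr fun τ => ?_
  ring

/-- Every cusp is γ∞ with γ ∈ SL₂(ℤ), and slashing by γ gives a multiple of the translate attached
to the coset of γ. -/
theorem CosetReps.vanishAtEachCusp_iff (hf : f ∈ modularFormsWithCharacter N χ k)
    (hg : g ∈ modularFormsWithCharacter N χ k) : VanishAtEachCusp N k f g ↔
      ∀ j, IsZeroAtImInfty (R.translate k f j) ∨ IsZeroAtImInfty (R.translate k g j) := by
  have key : ∀ γ : SL(2, ℤ), ∀ {h : ModularForm ((Gamma1 N).map (mapGL ℝ)) (k : ℤ)},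
      (OnePoint.IsZeroAt (mapGL ℝ γ • OnePoint.infty) h k ↔ IsZeroAtImInfty (⇑h ∣[(k : ℤ)] γ)) :=
    fun γ h => OnePoint.isZeroAt_iff rfl
  constructor
  · intro H j
    have hc : IsCusp (mapGL ℝ (R.rep j) • OnePoint.infty) ((Gamma0 N).map (mapGL ℝ)) :=
      (Subgroup.IsArithmetic.isCusp_iff_isCusp_SL2Z _).2 (isCusp_SL2Z_iff'.2 ⟨_, rfl⟩)
    exact (H _ hc).imp (key _).1 (key _).1
  · intro H c hc
    obtain ⟨γ, rfl⟩ := isCusp_SL2Z_iff'.1 ((Subgroup.IsArithmetic.isCusp_iff_isCusp_SL2Z _).1 hc)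
    obtain ⟨j, hj, -⟩ := R.existsUnique γ
    rw [key, key, R.slash_eq hf γ hj, R.slash_eq hg γ hj]
    exact (H j).imp (fun h => h.smul _) fun h => h.smul _

end

/-! ### Convergence of the Petersson product -/

section

variable {f g : ℍ → ℂ}

/-- The integrand of the Petersson product of weight `m + 2` in the coordinates `(φ, u)`, up to
the factor `(2 i) ^ m`. -/
noncomputable def arcIntegrand (m : ℕ) (f g : ℂ → ℂ) (p : ℝ × ℝ) : ℂ :=
  f (arcCoord p) * conj (g (arcCoord p)) * (arcCoord p - conj (arcCoord p)) ^ m * Real.cos p.1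

theorem arcRegion_subset :
    arcRegion ⊆ Set.Icc (-(Real.pi / 6)) (Real.pi / 6) ×ˢ Set.Ici (0 : ℝ) :=
  Set.prod_mono Set.Ioc_subset_Icc_self Set.Ioi_subset_Ici_self

theorem measurableSet_arcRegion : MeasurableSet arcRegion :=
  measurableSet_Ioc.prod measurableSet_Ioi

theorem two_I_pow_mul_peterssonIntegrand (m : ℕ) (f g : ℍ → ℂ) {p : ℝ × ℝ} (hp : p ∈ arcRegion) :
    Real.cos p.1 • ((((arcCoord p).im ^ 2)⁻¹ : ℝ) •
      ((2 * Complex.I) ^ m * peterssonIntegrand (m + 2) f g (ofComplex (arcCoord p)))) =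
      arcIntegrand m (f ∘ ofComplex) (g ∘ ofComplex) p := by
  have h := im_pos_of_mem_cuspStrip (arcCoord_mem_cuspStrip (arcRegion_subset hp))
  have him : (ofComplex (arcCoord p)).im = (arcCoord p).im := by
    rw [ofComplex_apply_of_im_pos h]; rfl
  have h' : ((arcCoord p).im : ℂ) ≠ 0 := by exact_mod_cast h.ne'
  simp only [arcIntegrand, peterssonIntegrand, him, Complex.sub_conj, Complex.real_smul,
    Function.comp_apply]
  push_cast
  rw [pow_add, mul_pow, mul_pow, mul_pow]
  field_simp

theorem integrableOn_peterssonIntegrand_fd_iff (m : ℕ) (f g : ℍ → ℂ) :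
    IntegrableOn (peterssonIntegrand (m + 2) f g) ModularGroup.fd ↔
      IntegrableOn (arcIntegrand m (f ∘ ofComplex) (g ∘ ofComplex)) arcRegion := by
  have h2 : IsUnit ((2 * Complex.I) ^ m) := (Ne.isUnit (by simp)).pow m
  have h := integrableOn_fd_iff fun z =>
    (2 * Complex.I) ^ m * peterssonIntegrand (m + 2) f g (ofComplex z)
  simp only [ofComplex_apply] at h
  rw [← integrableOn_congr_fun (fun p hp => two_I_pow_mul_peterssonIntegrand m f g hp)
    measurableSet_arcRegion, ← h]
  exact (integrable_const_mul_iff h2 _).symm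

theorem setIntegral_peterssonIntegrand_fd (m : ℕ) (f g : ℍ → ℂ) :
    (2 * Complex.I) ^ m * ∫ τ in ModularGroup.fd, peterssonIntegrand (m + 2) f g τ =
      ∫ p in arcRegion, arcIntegrand m (f ∘ ofComplex) (g ∘ ofComplex) p := by
  have h := setIntegral_fd fun z =>
    (2 * Complex.I) ^ m * peterssonIntegrand (m + 2) f g (ofComplex z)
  simp only [ofComplex_apply] at h
  rw [← integral_const_mul, h]
  exact setIntegral_congr_fun measurableSet_arcRegion
    fun p hp => two_I_pow_mul_peterssonIntegrand m f g hp

theorem integrableOn_arcIntegrand (m : ℕ) {f g : ℂ → ℂ} (hf : ContinuousOn f {z | 0 < z.im})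
    (hg : ContinuousOn g {z | 0 < z.im}) (H : ExpDecay fun z => f z * conj (g z)) :
    IntegrableOn (arcIntegrand m f g) arcRegion := by
  have hs : SubExp fun z : ℂ => (z - conj z) ^ m := by
    have := ((subExp_id.add ((subExp_const (-1)).mul subExp_id.conj))).pow m
    refine fun ε hε => (this ε hε).congr fun z _ => ?_
    ring
  refine (H.mul_subExp hs).integrableOn_arcRegion ?_
  exact (hf.mul (Complex.continuous_conj.comp_continuousOn hg)).mul
    (Continuous.continuousOn (by fun_prop))

theorem volume_Ioc_prod_Ioi (A : ℝ) :
    volume (Set.Ioc (-(Real.pi / 6)) (Real.pi / 6) ×ˢ Set.Ioi A) = ⊤ := by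
  rw [Measure.volume_eq_prod, Measure.prod_prod, Real.volume_Ioi, Real.volume_Ioc]
  refine ENNReal.mul_top ?_
  rw [ne_eq, ENNReal.ofReal_eq_zero, not_le]
  linarith [Real.pi_pos]

/-- High up, |f g| ≥ |v||w|/2, |z - conj z|^m ≥ 1 and cos φ ≥ 1/2, so the integrand is at least
|v||w|/4 on a set of infinite measure. -/
theorem not_integrableOn_arcIntegrand (m : ℕ) {f g : ℍ → ℂ} {v w : ℂ}
    (hf : Filter.Tendsto f atImInfty (nhds v)) (hg : Filter.Tendsto g atImInfty (nhds w))
    (hv : v ≠ 0) (hw : w ≠ 0) :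
    ¬ IntegrableOn (arcIntegrand m (f ∘ ofComplex) (g ∘ ofComplex)) arcRegion := by
  intro hint
  have hδ : 0 < ‖v‖ * ‖w‖ / 2 := by positivity
  have hev := (hf.norm.mul hg.norm).eventually (eventually_ge_nhds (b := ‖v‖ * ‖w‖ / 2)
    (by linarith))
  obtain ⟨A, hA⟩ := (atImInfty_mem _).1 hev
  set s : Set (ℝ × ℝ) := Set.Ioc (-(Real.pi / 6)) (Real.pi / 6) ×ˢ Set.Ioi (max A 1)
  have hs : s ⊆ arcRegion := Set.prod_mono le_rfl
    (Set.Ioi_subset_Ioi (zero_le_one.trans (le_max_right _ _)))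
  have hb : ∀ p ∈ s, ‖v‖ * ‖w‖ / 4 ≤ ‖arcIntegrand m (f ∘ ofComplex) (g ∘ ofComplex) p‖ := by
    intro p hp
    have hc := one_half_le_cos (Set.Ioc_subset_Icc_self hp.1)
    have hpu : max A 1 < p.2 := hp.2
    have him := im_pos_of_mem_cuspStrip (arcCoord_mem_cuspStrip (arcRegion_subset (hs hp)))
    have hi : max A 1 ≤ (arcCoord p).im := by rw [arcCoord_im]; linarith
    have h1 := hA (ofComplex (arcCoord p)) (by
      rw [ofComplex_apply_of_im_pos him]; exact (le_max_left _ _).trans hi)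
    have h2 : 1 ≤ ‖arcCoord p - conj (arcCoord p)‖ := by
      rw [Complex.sub_conj, norm_mul, Complex.norm_I, mul_one, Complex.norm_real, Real.norm_eq_abs]
      refine le_trans ?_ (le_abs_self _)
      linarith [le_max_right A 1]
    simp only [arcIntegrand, norm_mul, norm_pow, RCLike.norm_conj, Complex.norm_real,
      Real.norm_eq_abs, Function.comp_apply]
    rw [abs_of_pos (by linarith)]
    simp only [Set.mem_ofPred_eq] at h1
    calc ‖v‖ * ‖w‖ / 4 = ‖v‖ * ‖w‖ / 2 * 1 * (1 / 2) := by ring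
      _ ≤ _ := by
        gcongr
        exact one_le_pow₀ h2
  have hconst : IntegrableOn (fun _ : ℝ × ℝ => ‖v‖ * ‖w‖ / 4) s := by
    refine (hint.mono_set hs).norm.mono' (by fun_prop) ?_
    refine (ae_restrict_iff' (measurableSet_Ioc.prod measurableSet_Ioi)).2
      (.of_forall fun p hp => ?_)
    rw [Real.norm_of_nonneg (by positivity)]
    exact hb p hp
  rw [integrableOn_const_iff, volume_Ioc_prod_Ioi] at hconst
  rcases hconst with h | h
  · have : 0 < ‖v‖ * ‖w‖ / 4 := by positivity
    exact this.ne' (enorm_eq_zero.1 h)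
  · exact lt_irrefl _ h

end

section

variable {N m : ℕ} [NeZero N] {χ : DirichletCharacter ℂ N}
  {f g : ModularForm ((Gamma1 N).map (mapGL ℝ)) ((m + 2 : ℕ) : ℤ)} {F : Set ℍ}

theorem CosetReps.integrableOn_translate_iff (R : CosetReps N)
    (hf : f ∈ modularFormsWithCharacter N χ (m + 2 : ℕ))
    (hg : g ∈ modularFormsWithCharacter N χ (m + 2 : ℕ)) (j : Fin R.r) :
    IntegrableOn (peterssonIntegrand (m + 2) (R.translate (m + 2) f j) (R.translate (m + 2) g j))
      ModularGroup.fd ↔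
    (IsZeroAtImInfty (R.translate (m + 2) f j) ∨ IsZeroAtImInfty (R.translate (m + 2) g j)) := by
  rw [integrableOn_peterssonIntegrand_fd_iff]
  constructor
  · intro h
    by_contra! hn
    obtain ⟨v, hv⟩ := R.exists_tendsto_translate hf j
    obtain ⟨w, hw⟩ := R.exists_tendsto_translate hg j
    refine not_integrableOn_arcIntegrand m hv hw ?_ ?_ h
    · rintro rfl
      exact hn.1 hv
    · rintro rfl
      exact hn.2 hw
  · intro h
    refine integrableOn_arcIntegrand m (R.differentiableOn_translate f j).continuousOn
      (R.differentiableOn_translate g j).continuousOn ?_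
    rcases h with h | h
    · exact (R.expDecay_translate hf h).mul_subExp (R.subExp_translate g j).conj
    · exact (R.subExp_translate f j).mul_expDecay (R.expDecay_translate hg h).conj

theorem CosetReps.peterssonConverges_iff (R : CosetReps N)
    (hf : f ∈ modularFormsWithCharacter N χ (m + 2 : ℕ))
    (hg : g ∈ modularFormsWithCharacter N χ (m + 2 : ℕ)) (hF : IsFundamentalDomainGamma0 N F) :
    PeterssonConverges (m + 2) F f g ↔ ∀ j, IsZeroAtImInfty (R.translate (m + 2) f j) ∨
      IsZeroAtImInfty (R.translate (m + 2) g j) := by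
  rw [PeterssonConverges, hF.integrableOn_iff R
    (fun γ hγ τ => peterssonIntegrand_Gamma0 hf hg hγ τ)]
  refine forall_congr' fun j => ?_
  rw [← R.integrableOn_translate_iff hf hg j]
  simp only [peterssonIntegrand_smul]
  rfl

/-- Of the factor (2i)^(m+1), m powers turn y^m into (z - conj z)^m; the last one is the 2i of
Stokes' theorem. The index cancels r. -/
theorem CosetReps.peterssonProduct_eq (R : CosetReps N)
    (hf : f ∈ modularFormsWithCharacter N χ (m + 2 : ℕ))
    (hg : g ∈ modularFormsWithCharacter N χ (m + 2 : ℕ)) (hF : IsFundamentalDomainGamma0 N F)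
    (hc : PeterssonConverges (m + 2) F f g) :
    (R.r : ℂ) * (2 * Complex.I) ^ (m + 1) * peterssonProduct N (m + 2) F f g =
      ∑ j, 2 * Complex.I * ∫ p in arcRegion, arcIntegrand m (R.translate (m + 2) f j ∘ ofComplex)
        (R.translate (m + 2) g j ∘ ofComplex) p := by
  have hr : (R.r : ℂ) ≠ 0 := by
    rw [R.r_eq_index]
    exact_mod_cast Subgroup.FiniteIndex.index_ne_zero
  rw [peterssonProduct, ← R.r_eq_index, hF.setIntegral_eq R
    (fun γ hγ τ => peterssonIntegrand_Gamma0 hf hg hγ τ) hc]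
  rw [mul_comm (R.r : ℂ), mul_assoc, mul_inv_cancel_left₀ hr, Finset.mul_sum]
  refine Finset.sum_congr rfl fun j _ => ?_
  rw [← setIntegral_peterssonIntegrand_fd]
  simp only [peterssonIntegrand_smul]
  rw [CosetReps.translate, CosetReps.translate]
  ring

end

/-! ### Double integrals and period polynomials -/

/-- The polynomial `∑ (-1) ^ n (m choose n) d_n w ^ (m - n)` with given periods `d_n`. -/
noncomputable def periodPolynomial (m : ℕ) (d : ℕ → ℂ) (w : ℂ) : ℂ :=
  ∑ n ∈ Finset.range (m + 1), (-1) ^ n * (m.choose n : ℂ) * w ^ (m - n) * d n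

theorem eichlerIntegral_eq_periodPolynomial (m : ℕ) (G : ℕ → ℂ → ℂ) (w z : ℂ) :
    eichlerIntegral m G w z = periodPolynomial m (fun n => G n z) w := rfl

theorem periodPolynomial_congr {m : ℕ} {d d' : ℕ → ℂ} (h : ∀ n ≤ m, d n = d' n) (w : ℂ) :
    periodPolynomial m d w = periodPolynomial m d' w :=
  Finset.sum_congr rfl fun n hn => by rw [h n (Nat.lt_succ_iff.1 (Finset.mem_range.1 hn))]

theorem periodPolynomial_sub (m : ℕ) (d d' : ℕ → ℂ) (w : ℂ) :
    periodPolynomial m (fun n => d n - d' n) w =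
      periodPolynomial m d w - periodPolynomial m d' w := by
  simp only [periodPolynomial, ← Finset.sum_sub_distrib]
  exact Finset.sum_congr rfl fun n _ => by ring

theorem periodPolynomial_const_mul (m : ℕ) (c : ℂ) (d : ℕ → ℂ) (w : ℂ) :
    c * periodPolynomial m d w = periodPolynomial m (fun n => c * d n) w := by
  simp only [periodPolynomial, Finset.mul_sum]
  exact Finset.sum_congr rfl fun n _ => by ring

theorem periodPolynomial_zero (m : ℕ) (w : ℂ) : periodPolynomial m (fun _ => 0) w = 0 := by
  simp [periodPolynomial]

theorem periodPolynomial_neg (m : ℕ) (d : ℕ → ℂ) (w : ℂ) :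
    periodPolynomial m (fun n => -d n) w = -periodPolynomial m d w := by
  simp only [periodPolynomial, ← Finset.sum_neg_distrib]
  exact Finset.sum_congr rfl fun n _ => by ring

theorem mul_conj_periodPolynomial (m : ℕ) (d : ℕ → ℂ) (v z : ℂ) :
    v * conj (periodPolynomial m d (conj z)) = ∑ n ∈ Finset.range (m + 1),
      (-1) ^ n * (m.choose n : ℂ) * (z ^ (m - n) * v) * conj (d n) := by
  simp only [periodPolynomial, map_sum, Finset.mul_sum]
  refine Finset.sum_congr rfl fun n _ => ?_
  simp
  ring

section

open CompletedHalfPlane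

variable {m : ℕ} {f g : ℍ → ℂ} {C D : CompletedHalfPlane}

/-- This is the shape in which the vertical sides leave Stokes' theorem; the factor i is dz/du. -/
theorem doubleIntegral_vertical (hf : ContinuousOn (f ∘ ofComplex) {z | 0 < z.im})
    (hd : ExpDecay (f ∘ ofComplex)) {a : ℍ} (ha : (a : ℂ) ∈ cuspStrip)
    (hg : ∀ n ≤ m, IntegralConverges C D (powMul n g)) :
    doubleIntegral (m + 2) f g (pt a) infty C D =
      Complex.I * ∫ u in Set.Ioi (0 : ℝ), (f ∘ ofComplex) (a + u * Complex.I) *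
        conj (periodPolynomial m (fun n => singleIntegral n C D g) (conj (a + u * Complex.I))) := by
  have hconv := fun n (_ : n ≤ m) => integralConverges_vertical hf hd n ha
  have e := doubleIntegral_eq_sum m hconv hg
  simp only [mul_conj_periodPolynomial]
  have hpull : ∀ n, IntegrableOn (fun u : ℝ => ((a : ℂ) + u * Complex.I) ^ n *
      (f ∘ ofComplex) (a + u * Complex.I)) (Set.Ioi 0) := by
    intro n
    have h := (integralConverges_vertical hf hd n ha).const_mul (-Complex.I)
    refine IntegrableOn.congr_fun h (fun u hu => ?_) measurableSet_Ioi
    rw [pullback_vertical n ha (le_of_lt hu)]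
    linear_combination (-((a : ℂ) + u * Complex.I) ^ n *
      (f ∘ ofComplex) (a + u * Complex.I)) * Complex.I_sq
  rw [e, integral_finsetSum _ fun n _ => ((hpull (m - n)).const_mul _).mul_const _, Finset.mul_sum]
  refine Finset.sum_congr rfl fun n _ => ?_
  rw [integral_mul_const, integral_const_mul]
  have h1 : singleIntegral (m - n) (pt a) infty f =
      Complex.I * ∫ u in Set.Ioi (0 : ℝ), ((a : ℂ) + u * Complex.I) ^ (m - n) *
        (f ∘ ofComplex) (a + u * Complex.I) := by
    rw [← integral_const_mul]
    refine setIntegral_congr_fun measurableSet_Ioi fun u hu => ?_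
    rw [pullback_vertical _ ha (le_of_lt hu)]
    ring
  rw [h1]
  ring

theorem hasDerivAt_arcCoord (φ : ℝ) :
    HasDerivAt (fun φ : ℝ => arcCoord (φ, 0)) (arcTangent φ) φ := by
  have h1 := (Real.hasDerivAt_sin φ).ofReal_comp
  have h2 := ((Real.hasDerivAt_cos φ).ofReal_comp).mul_const Complex.I
  refine ((h1.add h2).congr_deriv ?_).congr_of_eventuallyEq (.of_forall fun x => ?_)
  · simp only [arcTangent]
    push_cast
    ring
  · simp [arcCoord]

theorem arcCoord_im_pos {φ : ℝ} (hφ : φ ∈ Set.Icc (-(Real.pi / 6)) (Real.pi / 6)) :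
    0 < (arcCoord (φ, 0)).im :=
  im_pos_of_mem_cuspStrip (arcCoord_mem_cuspStrip ⟨hφ, Set.mem_Ici.2 le_rfl⟩)

/-- Since f is holomorphic, the straight segment may be replaced by the circular arc with the same
endpoints: both give the difference of a primitive. -/
theorem doubleIntegral_arc (hf : DifferentiableOn ℂ (f ∘ ofComplex) {z | 0 < z.im})
    {φ₁ φ₂ : ℝ} (h₁ : φ₁ ∈ Set.Icc (-(Real.pi / 6)) (Real.pi / 6))
    (h₂ : φ₂ ∈ Set.Icc (-(Real.pi / 6)) (Real.pi / 6)) {a b : ℍ}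
    (ha : (a : ℂ) = arcCoord (φ₁, 0)) (hb : (b : ℂ) = arcCoord (φ₂, 0))
    (hg : ∀ n ≤ m, IntegralConverges C D (powMul n g)) :
    doubleIntegral (m + 2) f g (pt a) (pt b) C D =
      ∫ φ in φ₁..φ₂, (f ∘ ofComplex) (arcCoord (φ, 0)) *
        conj (periodPolynomial m (fun n => singleIntegral n C D g) (conj (arcCoord (φ, 0)))) *
        arcTangent φ := by
  have hsub : ∀ φ ∈ Set.uIcc φ₁ φ₂, 0 < (arcCoord (φ, 0)).im := fun φ hφ =>
    arcCoord_im_pos (Set.uIcc_subset_Icc h₁ h₂ hφ)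
  rw [doubleIntegral_eq_sum m (fun n _ => integralConverges_segment hf.continuousOn n a b) hg]
  obtain ⟨A, hA, -⟩ := exists_isPrimitiveFamily hf
  have hcont : ∀ n, ContinuousOn (fun φ : ℝ => arcCoord (φ, 0) ^ n *
      (f ∘ ofComplex) (arcCoord (φ, 0)) * arcTangent φ) (Set.uIcc φ₁ φ₂) := by
    intro n
    have hc : Continuous fun φ : ℝ => arcCoord (φ, 0) :=
      continuous_arcCoord.comp (Continuous.prodMk_left 0)
    exact (((hc.pow n).continuousOn).mul (hf.continuousOn.comp hc.continuousOn hsub)).mul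
      continuous_arcTangent.continuousOn
  have h1 : ∀ n, singleIntegral n (pt a) (pt b) f = ∫ φ in φ₁..φ₂, arcCoord (φ, 0) ^ n *
      (f ∘ ofComplex) (arcCoord (φ, 0)) * arcTangent φ := by
    intro n
    rw [singleIntegral_segment hf.continuousOn hA n a b, ha, hb,
      intervalIntegral.integral_eq_sub_of_hasDerivAt (f := fun φ : ℝ => A n (arcCoord (φ, 0)))
        (fun φ hφ => (hA n _ (hsub φ hφ)).comp φ (hasDerivAt_arcCoord φ))
        (hcont n).intervalIntegrable]
  simp only [mul_conj_periodPolynomial, Finset.sum_mul, h1]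
  rw [intervalIntegral.integral_finsetSum]
  · refine Finset.sum_congr rfl fun n _ => ?_
    rw [← intervalIntegral.integral_mul_const, ← intervalIntegral.integral_const_mul]
    refine intervalIntegral.integral_congr fun φ _ => ?_
    ring
  · intro n _
    have := (((hcont (m - n)).intervalIntegrable (μ := volume)).const_mul
      ((-1) ^ n * (m.choose n : ℂ))).mul_const
        (conj (singleIntegral n C D g))
    refine this.congr fun φ _ => ?_
    ring

end

/-! ### Families of functions permuted by translation and inversion -/

/-- Two families `f_j`, `g_j` of functions on the upper half-plane which are permuted, up to factors
of absolute value one, by `τ ↦ τ + 1` and, in weight `m + 2`, by `τ ↦ -1 / τ`, such that `f_j` decays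
at `i∞` for `j ∈ E` and `g_j` decays at `i∞` for `j ∉ E`. -/
structure SlashSystem (ι : Type*) (m : ℕ) where
  /-- The functions `f_j`. -/
  f : ι → ℍ → ℂ
  /-- The functions `g_j`. -/
  g : ι → ℍ → ℂ
  /-- The indices with decay of `f_j`. -/
  E : Finset ι
  /-- The permutation of the indices given by `τ ↦ τ + 1`. -/
  T : Equiv.Perm ι
  /-- The permutation of the indices given by `τ ↦ -1 / τ`. -/
  S : Equiv.Perm ι
  /-- The factors for `τ ↦ τ + 1`. -/
  t : ι → ℂ
  /-- The factors for `τ ↦ -1 / τ`. -/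
  s : ι → ℂ
  t_mul_conj : ∀ j, t j * conj (t j) = 1
  s_mul_conj : ∀ j, s j * conj (s j) = 1
  S_S : ∀ j, S (S j) = j
  T_mem : ∀ j, T j ∈ E ↔ j ∈ E
  differentiableOn_f : ∀ j, DifferentiableOn ℂ (f j ∘ ofComplex) {z | 0 < z.im}
  differentiableOn_g : ∀ j, DifferentiableOn ℂ (g j ∘ ofComplex) {z | 0 < z.im}
  subExp_f : ∀ j, SubExp (f j ∘ ofComplex)
  subExp_g : ∀ j, SubExp (g j ∘ ofComplex)
  expDecay_f : ∀ j ∈ E, ExpDecay (f j ∘ ofComplex)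
  expDecay_g : ∀ j ∉ E, ExpDecay (g j ∘ ofComplex)
  f_add_one : ∀ j (z : ℂ), 0 < z.im → (f j ∘ ofComplex) (z + 1) = t j * (f (T j) ∘ ofComplex) z
  g_add_one : ∀ j (z : ℂ), 0 < z.im → (g j ∘ ofComplex) (z + 1) = t j * (g (T j) ∘ ofComplex) z
  f_neg_one_div : ∀ j (z : ℂ), 0 < z.im →
    (f j ∘ ofComplex) (-1 / z) = z ^ (m + 2) * (s j * (f (S j) ∘ ofComplex) z)
  g_neg_one_div : ∀ j (z : ℂ), 0 < z.im →
    (g j ∘ ofComplex) (-1 / z) = z ^ (m + 2) * (s j * (g (S j) ∘ ofComplex) z)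

namespace SlashSystem

variable {ι : Type*} {m : ℕ} (D : SlashSystem ι m)

/-- Primitives of `z ^ n g_j(z)`, normalized at `i` for `j ∈ E` and at `i∞` for `j ∉ E`. -/
structure NormalizedPrimitives (B : ι → ℕ → ℂ → ℂ) : Prop where
  isPrimitiveFamily : ∀ j, IsPrimitiveFamily (D.g j ∘ ofComplex) (B j)
  eq_zero : ∀ j ∈ D.E, ∀ n, B j n Complex.I = 0
  expDecay : ∀ j ∉ D.E, ∀ n, ExpDecay (B j n)

theorem exists_normalizedPrimitives : ∃ B, D.NormalizedPrimitives B := by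
  have h : ∀ j, ∃ B : ℕ → ℂ → ℂ, IsPrimitiveFamily (D.g j ∘ ofComplex) B ∧
      (j ∈ D.E → ∀ n, B n Complex.I = 0) ∧ (j ∉ D.E → ∀ n, ExpDecay (B n)) := by
    intro j
    obtain ⟨B, hB, hB0⟩ := exists_isPrimitiveFamily (D.differentiableOn_g j)
    by_cases hj : j ∈ D.E
    · exact ⟨B, hB, fun _ => hB0, fun h => absurd hj h⟩
    · have := fun n => (hB n).exists_expDecay_sub
        ((subExp_id.pow n).mul_expDecay (D.expDecay_g j hj))
        ((continuous_pow n).continuousOn.mul (D.differentiableOn_g j).continuousOn)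
      choose L hL using this
      exact ⟨fun n z => B n z - L n, fun n => (hB n).sub_const _, fun h => absurd h hj, fun _ => hL⟩
  choose B hB using h
  exact ⟨B, fun j => (hB j).1, fun j hj => (hB j).2.1 hj, fun j hj => (hB j).2.2 hj⟩

variable {D} {B : ι → ℕ → ℂ → ℂ}

namespace NormalizedPrimitives

theorem subExp (hB : D.NormalizedPrimitives B) (j : ι) (n : ℕ) : SubExp (B j n) :=
  (hB.isPrimitiveFamily j n).subExp ((subExp_id.pow n).mul (D.subExp_g j))

/-- One factor decays and the other is subexponential: f_j decays for j ∈ E, the primitives of g_j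
for j ∉ E. -/
theorem expDecay_potential (hB : D.NormalizedPrimitives B) (j : ι) :
    ExpDecay (potential m (D.f j ∘ ofComplex) (B j)) := by
  by_cases hj : j ∈ D.E
  · refine (D.expDecay_f j hj).mul_subExp (SubExp.conj (SubExp.sum fun n _ => ?_))
    exact ((subExp_const _).mul (subExp_id.conj.pow _)).mul (hB.subExp j n)
  · refine (D.subExp_f j).mul_expDecay (ExpDecay.conj (ExpDecay.sum fun n _ => ?_))
    exact ((subExp_const _).mul (subExp_id.conj.pow _)).mul_expDecay (hB.expDecay j hj n)

end NormalizedPrimitives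

end SlashSystem

theorem arcCoord_pi_div_six (u : ℝ) :
    arcCoord (Real.pi / 6, u) = (((1 : ℝ) +ᵥ UpperHalfPlane.ρ : ℍ) : ℂ) + u * Complex.I := by
  apply Complex.ext
  · simp [UpperHalfPlane.ρ]
    norm_num
  · simp [UpperHalfPlane.ρ]

theorem arcCoord_neg_pi_div_six (u : ℝ) :
    arcCoord (-(Real.pi / 6), u) = arcCoord (Real.pi / 6, u) - 1 := by
  apply Complex.ext
  · simp
    norm_num
  · simp

theorem rho_add_one_mem_cuspStrip : (((1 : ℝ) +ᵥ UpperHalfPlane.ρ : ℍ) : ℂ) ∈ cuspStrip := by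
  have hpi : -(Real.pi / 6) ≤ Real.pi / 6 := by linarith [Real.pi_pos]
  have := arcCoord_mem_cuspStrip (p := (Real.pi / 6, 0)) ⟨⟨hpi, le_rfl⟩, Set.mem_Ici.2 le_rfl⟩
  rw [arcCoord_pi_div_six] at this
  simpa using this

namespace SlashSystem

variable {ι : Type*} {m : ℕ} {D : SlashSystem ι m} {B : ι → ℕ → ℂ → ℂ}

namespace NormalizedPrimitives

theorem stokes (hB : D.NormalizedPrimitives B) (j : ι) :
    2 * Complex.I * ∫ p in arcRegion, arcIntegrand m (D.f j ∘ ofComplex) (D.g j ∘ ofComplex) p =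
    (∫ φ in -(Real.pi / 6)..(Real.pi / 6),
      potential m (D.f j ∘ ofComplex) (B j) (arcCoord (φ, 0)) * arcTangent φ) +
    Complex.I * ∫ u in Set.Ioi (0 : ℝ),
      (potential m (D.f j ∘ ofComplex) (B j) (arcCoord (Real.pi / 6, u)) -
        potential m (D.f j ∘ ofComplex) (B j) (arcCoord (-(Real.pi / 6), u))) := by
  refine (hB.isPrimitiveFamily j).stokes_fundamentalDomain (D.differentiableOn_f j)
    (D.differentiableOn_g j).continuousOn m (hB.expDecay_potential j) ?_
  refine integrableOn_arcIntegrand m (D.differentiableOn_f j).continuousOn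
    (D.differentiableOn_g j).continuousOn ?_
  by_cases hj : j ∈ D.E
  · exact (D.expDecay_f j hj).mul_subExp (D.subExp_g j).conj
  · exact (D.subExp_f j).mul_expDecay (D.expDecay_g j hj).conj

/-! ### The vertical sides -/

theorem isPrimitive_translate (hB : D.NormalizedPrimitives B) (j : ι) (w : ℂ) :
    IsPrimitive (fun z => (D.g j ∘ ofComplex) z * (w - z) ^ m)
      fun z => D.t j * eichlerIntegral m (B (D.T j)) (w - 1) (z - 1) := by
  intro z hz
  have hz' : 0 < (z - 1).im := by simpa using hz
  have h := (((hB.isPrimitiveFamily (D.T j)).isPrimitive_eichlerIntegral m (w - 1)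
    (z - 1) hz').comp_sub_const z 1).const_mul (D.t j)
  refine h.congr_deriv ?_
  have e := D.g_add_one j (z - 1) hz'
  rw [sub_add_cancel] at e
  beta_reduce
  rw [e, sub_sub_sub_cancel_right]
  ring

-- Both terms are primitives of the same function, so their difference is constant in z. For j ∈ E
-- it is read off at 1 + i, where the second term vanishes; for j ∉ E both terms tend to 0 at i∞.
-- The index T(j) falls in the same case as j.
open Classical in
theorem eichlerIntegral_sub_translate (hB : D.NormalizedPrimitives B) (j : ι) (w : ℂ) {z : ℂ}
    (hz : 0 < z.im) :
    eichlerIntegral m (B j) w z - D.t j * eichlerIntegral m (B (D.T j)) (w - 1) (z - 1) =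
      if j ∈ D.E then periodPolynomial m (fun n => singleIntegral n ptI ptI1 (D.g j)) w else 0 := by
  have hsub := fun x (hx : 0 < x.im) =>
    ((hB.isPrimitiveFamily j).isPrimitive_eichlerIntegral m w).sub_eq_sub
      (hB.isPrimitive_translate j w) hz (w := x) hx
  split_ifs with hj
  · rw [hsub (1 + Complex.I) (by simp)]
    have h0 : eichlerIntegral m (B (D.T j)) (w - 1) (1 + Complex.I - 1) = 0 := by
      rw [add_sub_cancel_left]
      exact Finset.sum_eq_zero fun n _ => by
        rw [hB.eq_zero _ ((D.T_mem j).2 hj), mul_zero]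
    rw [h0, mul_zero, sub_zero, eichlerIntegral_eq_periodPolynomial]
    refine periodPolynomial_congr (fun n _ => ?_) w
    rw [ptI, ptI1, singleIntegral_segment (D.differentiableOn_g j).continuousOn
      (hB.isPrimitiveFamily j)]
    simp [hB.eq_zero j hj]
  · have hdec : ∀ (l : ι) (_ : l ∉ D.E) (v : ℂ), ExpDecay (eichlerIntegral m (B l) v) :=
      fun l hl v => ExpDecay.sum fun n _ => (subExp_const _).mul_expDecay (hB.expDecay l hl n)
    have him : ∀ c : ℝ, Filter.Tendsto (fun t : ℝ => ((c : ℂ) + t * Complex.I).im)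
        Filter.atTop Filter.atTop := fun c =>
      Filter.tendsto_id.congr fun t => by simp
    have hmem : ∀ c : ℝ, |c| ≤ 2 → ∀ᶠ t : ℝ in Filter.atTop,
        (c : ℂ) + t * Complex.I ∈ cuspStrip := fun c hc =>
      (Filter.eventually_ge_atTop (1 / 2)).mono fun t ht => by
        constructor
        · simpa using hc
        · simpa using ht
    have h1 := (hdec j hj w).tendsto_zero (hmem 1 (by norm_num)) (him 1)
    have h2 := ((hdec _ (fun h => hj ((D.T_mem j).1 h)) (w - 1)).tendsto_zero
      (hmem 0 (by norm_num)) (him 0)).const_mul (D.t j)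
    have h3 := h1.sub h2
    rw [mul_zero, sub_zero] at h3
    refine tendsto_nhds_unique (tendsto_const_nhds.congr' ?_) h3
    filter_upwards [Filter.eventually_gt_atTop (0 : ℝ)] with t ht
    rw [hsub ((1 : ℝ) + t * Complex.I) (by simpa using ht)]
    congr 3
    push_cast
    ring

-- The factor t_j from f and its conjugate from g cancel, since |t_j| = 1.
open Classical in
theorem potential_sub_potential_translate (hB : D.NormalizedPrimitives B) (j : ι) {z : ℂ}
    (hz : 0 < z.im) :
    potential m (D.f j ∘ ofComplex) (B j) z -
      potential m (D.f (D.T j) ∘ ofComplex) (B (D.T j)) (z - 1) =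
    if j ∈ D.E then (D.f j ∘ ofComplex) z *
      conj (periodPolynomial m (fun n => singleIntegral n ptI ptI1 (D.g j)) (conj z)) else 0 := by
  have e := D.f_add_one j (z - 1) (by simpa using hz)
  rw [sub_add_cancel] at e
  have h := congrArg conj (hB.eichlerIntegral_sub_translate j (conj z) hz)
  have h2 : potential m (D.f (D.T j) ∘ ofComplex) (B (D.T j)) (z - 1) =
      (D.f j ∘ ofComplex) z *
        conj (D.t j * eichlerIntegral m (B (D.T j)) (conj z - 1) (z - 1)) := by
    rw [potential, e, map_sub, map_one, map_mul]
    linear_combination -(D.f (D.T j) ∘ ofComplex) (z - 1) *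
      conj (eichlerIntegral m (B (D.T j)) (conj z - 1) (z - 1)) * D.t_mul_conj j
  rw [h2, potential, ← mul_sub, ← map_sub, h]
  split_ifs <;> simp

variable [Fintype ι] [DecidableEq ι]

/-- Reindexing the left sides by T places the left side for T(j) opposite the right side for j. -/
theorem sum_vertical (hB : D.NormalizedPrimitives B) :
    ∑ j, Complex.I * ∫ u in Set.Ioi (0 : ℝ),
      (potential m (D.f j ∘ ofComplex) (B j) (arcCoord (Real.pi / 6, u)) -
        potential m (D.f j ∘ ofComplex) (B j) (arcCoord (-(Real.pi / 6), u))) =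
    ∑ j with j ∈ D.E, doubleIntegral (m + 2) (D.f j) (D.g j) ptRho1 ptInfty ptI ptI1 := by
  have hpi : -(Real.pi / 6) ≤ Real.pi / 6 := by linarith [Real.pi_pos]
  have hint := fun (j : ι) {φ : ℝ} (hφ : φ ∈ Set.Icc (-(Real.pi / 6)) (Real.pi / 6)) =>
    (hB.expDecay_potential j).integrableOn_vertical
      ((hB.isPrimitiveFamily j).continuousOn_potential (D.differentiableOn_f j) m) hφ
  have hr := fun j => hint j ⟨hpi, le_rfl⟩
  have hl := fun j => hint j ⟨le_rfl, hpi⟩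
  simp only [integral_sub (hr _) (hl _)]
  rw [← Finset.mul_sum, Finset.sum_sub_distrib,
    ← Equiv.sum_comp D.T fun j => ∫ u in Set.Ioi (0 : ℝ),
      potential m (D.f j ∘ ofComplex) (B j) (arcCoord (-(Real.pi / 6), u)),
    ← Finset.sum_sub_distrib, Finset.mul_sum, Finset.sum_filter]
  refine Finset.sum_congr rfl fun j _ => ?_
  rw [← integral_sub (hr j) (hl _), setIntegral_congr_fun measurableSet_Ioi fun u hu => by
    rw [arcCoord_neg_pi_div_six, hB.potential_sub_potential_translate j
      (im_pos_of_mem_cuspStrip (arcCoord_mem_cuspStrip ⟨⟨hpi, le_rfl⟩, Set.Ioi_subset_Ici_self hu⟩))]]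
  split_ifs with hj
  · rw [ptRho1, ptInfty, doubleIntegral_vertical (C := ptI) (D := ptI1)
      (D.differentiableOn_f j).continuousOn (D.expDecay_f j hj) rho_add_one_mem_cuspStrip
      (fun n _ => integralConverges_segment (D.differentiableOn_g j).continuousOn n _ _)]
    simp only [arcCoord_pi_div_six]
  · simp

end NormalizedPrimitives

end SlashSystem

/-! ### The circular arc -/

theorem arcCoord_zero_mul_arcTangent (φ : ℝ) :
    arcCoord (φ, 0) = Complex.I * arcTangent φ := by
  simp only [arcCoord, arcTangent, add_zero]
  linear_combination (Real.sin φ : ℂ) * Complex.I_sq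

theorem arcTangent_mul_arcTangent_neg (φ : ℝ) : arcTangent φ * arcTangent (-φ) = 1 := by
  have h : (Real.sin φ : ℂ) ^ 2 + (Real.cos φ : ℂ) ^ 2 = 1 := by
    exact_mod_cast Real.sin_sq_add_cos_sq φ
  simp only [arcTangent, Real.cos_neg, Real.sin_neg, Complex.ofReal_neg]
  linear_combination h - (Real.sin φ : ℂ) ^ 2 * Complex.I_sq

theorem arcTangent_neg (φ : ℝ) : arcTangent (-φ) = conj (arcTangent φ) := by
  simp only [arcTangent, Real.cos_neg, Real.sin_neg, Complex.ofReal_neg, map_sub, map_mul,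
    Complex.conj_ofReal, Complex.conj_I]
  ring

/-- On the arc, τ ↦ -1/τ is the reflection φ ↦ -φ. -/
theorem arcCoord_neg (φ : ℝ) : arcCoord (-φ, 0) = -1 / arcCoord (φ, 0) := by
  have h := arcTangent_mul_arcTangent_neg φ
  have h0 : arcTangent φ ≠ 0 := left_ne_zero_of_mul_eq_one h
  rw [arcCoord_zero_mul_arcTangent, arcCoord_zero_mul_arcTangent, eq_div_iff (by simp [h0])]
  linear_combination Complex.I ^ 2 * h + Complex.I_sq

theorem arcCoord_mul_conj (φ : ℝ) : arcCoord (φ, 0) * conj (arcCoord (φ, 0)) = 1 := by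
  have h := arcTangent_mul_arcTangent_neg φ
  rw [arcTangent_neg] at h
  rw [arcCoord_zero_mul_arcTangent, map_mul, Complex.conj_I]
  linear_combination h - arcTangent φ * conj (arcTangent φ) * Complex.I_sq

theorem hasDerivAt_neg_one_div {z : ℂ} (hz : z ≠ 0) :
    HasDerivAt (fun z : ℂ => -1 / z) (z ^ 2)⁻¹ z := by
  have h := (hasDerivAt_inv hz).neg
  rw [neg_neg] at h
  refine h.congr_of_eventuallyEq (.of_forall fun w => ?_)
  simp [neg_div]

/-- The substitution `τ ↦ -1 / τ` in the integral defining a period polynomial. -/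
theorem periodPolynomial_reflect (m : ℕ) (d : ℕ → ℂ) {w : ℂ} (hw : w ≠ 0) :
    w ^ m * periodPolynomial m d (-1 / w) =
      periodPolynomial m (fun n => (-1) ^ (m - n) * d (m - n)) w := by
  simp only [periodPolynomial, Finset.mul_sum]
  rw [← Finset.sum_range_reflect]
  refine Finset.sum_congr rfl fun n hn => ?_
  have hn : n ≤ m := Nat.lt_succ_iff.1 (Finset.mem_range.1 hn)
  rw [show m + 1 - 1 - n = m - n by lia, Nat.choose_symm hn, Nat.sub_sub_self hn]
  have hm : w ^ m = w ^ (m - n) * w ^ n := by rw [← pow_add, Nat.sub_add_cancel hn]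
  rw [hm, div_pow]
  field_simp

namespace SlashSystem

variable {ι : Type*} {m : ℕ} {D : SlashSystem ι m} {B : ι → ℕ → ℂ → ℂ}

/-- The primitives of `z ^ n g_j(z)`, `n ≤ m`, that come from those for the index `S(j)`. -/
noncomputable def reflected (D : SlashSystem ι m) (B : ι → ℕ → ℂ → ℂ) (j : ι) (n : ℕ) (z : ℂ) : ℂ :=
  if n ≤ m then conj (D.s (D.S j)) * ((-1) ^ (m - n) * B (D.S j) (m - n) (-1 / z)) else B j n z

/-- The period of `z ^ n g_j(z)` between the points at which the primitives for the indices `j` and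
`S(j)` are normalized. -/
noncomputable def period (D : SlashSystem ι m) (B : ι → ℕ → ℂ → ℂ) (j : ι) (n : ℕ) : ℂ :=
  B j n Complex.I - D.reflected B j n Complex.I

namespace NormalizedPrimitives

theorem continuousOn_potential_arc (hB : D.NormalizedPrimitives B) (j : ι) :
    ContinuousOn (fun φ : ℝ => potential m (D.f j ∘ ofComplex) (B j) (arcCoord (φ, 0)) *
      arcTangent φ) (Set.Icc (-(Real.pi / 6)) (Real.pi / 6)) :=
  (((hB.isPrimitiveFamily j).continuousOn_potential (D.differentiableOn_f j) m).comp
    (continuous_arcCoord.comp (Continuous.prodMk_left 0)).continuousOn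
    fun _ hφ => arcCoord_im_pos hφ).mul continuous_arcTangent.continuousOn

/-- Under z ↦ -1/z the powers are z^(m+2) from the weight, z^(-2) from the differential and
z^(-(m-n)) from the monomial, which together leave z^n. The signs cancel, and so do the factors s.
-/
theorem isPrimitiveFamily_reflected (hB : D.NormalizedPrimitives B) (j : ι) :
    IsPrimitiveFamily (D.g j ∘ ofComplex) (D.reflected B j) := by
  intro n
  by_cases hn : n ≤ m
  · intro z hz
    have hz0 : z ≠ 0 := fun h => by simp [h] at hz
    have h := (((hB.isPrimitiveFamily (D.S j) (m - n) (-1 / z) (im_neg_one_div_pos hz)).comp z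
      (hasDerivAt_neg_one_div hz0)).const_mul ((-1) ^ (m - n))).const_mul (conj (D.s (D.S j)))
    have e := D.g_neg_one_div (D.S j) z hz
    rw [D.S_S] at e
    have hs := D.s_mul_conj (D.S j)
    refine (h.congr_deriv ?_).congr_of_eventuallyEq (.of_forall fun w => by simp [reflected, hn])
    beta_reduce
    rw [e]
    have hm : z ^ (m + 2) = z ^ (m - n) * z ^ n * z ^ 2 := by
      rw [← pow_add, ← pow_add]; congr 1; lia
    have h1 : ((-1 : ℂ) ^ (m - n)) * (-1) ^ (m - n) = 1 := by
      rw [← mul_pow]; simp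
    rw [hm, div_pow]
    field_simp
    linear_combination ((D.g j ∘ ofComplex) z) *
      ((-1 : ℂ) ^ (m - n) * (-1) ^ (m - n) * hs + h1)
  -- For n > m the definition falls back on B itself, which keeps the family defined for all n.
  · intro z hz
    refine (hB.isPrimitiveFamily j n z hz).congr_of_eventuallyEq
      (.of_forall fun w => by simp [reflected, hn])

theorem period_eq (hB : D.NormalizedPrimitives B) (j : ι) (n : ℕ) {z : ℂ} (hz : 0 < z.im) :
    B j n z - D.reflected B j n z = D.period B j n :=
  (hB.isPrimitiveFamily j n).sub_eq_sub (hB.isPrimitiveFamily_reflected j n) hz (by simp)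

/-- The primitive for S(j) vanishes at i, which is fixed by z ↦ -1/z, so the reflected primitive
vanishes at i as well. -/
theorem period_eq_of_mem (hB : D.NormalizedPrimitives B) {j : ι} (hj : D.S j ∈ D.E) {n : ℕ}
    (hn : n ≤ m) : D.period B j n = B j n Complex.I := by
  have : (-1 / Complex.I) = Complex.I := by
    rw [div_eq_iff Complex.I_ne_zero, ← sq, Complex.I_sq]
  simp [period, reflected, hn, this, hB.eq_zero _ hj]

/-- The second summand is minus the same expression formed with the reflected primitives, so the sum
involves only the constants by which the two families differ. -/
theorem potential_add_potential_reflected (hB : D.NormalizedPrimitives B) (j : ι) {φ : ℝ}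
    (hφ : φ ∈ Set.Icc (-(Real.pi / 6)) (Real.pi / 6)) :
    potential m (D.f j ∘ ofComplex) (B j) (arcCoord (φ, 0)) * arcTangent φ +
      potential m (D.f (D.S j) ∘ ofComplex) (B (D.S j)) (arcCoord (-φ, 0)) * arcTangent (-φ) =
    (D.f j ∘ ofComplex) (arcCoord (φ, 0)) *
      conj (periodPolynomial m (D.period B j) (conj (arcCoord (φ, 0)))) * arcTangent φ := by
  have hz := arcCoord_im_pos hφ
  set z := arcCoord (φ, 0) with hzdef
  have hz1 : z * conj z = 1 := arcCoord_mul_conj φ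
  have hz0 : z ≠ 0 := left_ne_zero_of_mul_eq_one hz1
  have hw0 : conj z ≠ 0 := right_ne_zero_of_mul_eq_one hz1
  have e := D.f_neg_one_div (D.S j) z hz
  rw [D.S_S] at e
  have hs := D.s_mul_conj (D.S j)
  have h1 : periodPolynomial m (D.period B j) (conj z) =
      eichlerIntegral m (B j) (conj z) z - conj (D.s (D.S j)) *
        ((conj z) ^ m * eichlerIntegral m (B (D.S j)) (-1 / conj z) (-1 / z)) := by
    rw [eichlerIntegral_eq_periodPolynomial, eichlerIntegral_eq_periodPolynomial,
      periodPolynomial_reflect m _ hw0, periodPolynomial_const_mul, ← periodPolynomial_sub]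
    refine periodPolynomial_congr (fun n hn => ?_) _
    rw [← hB.period_eq j n hz, reflected, if_pos hn]
  -- The minus sign records that inversion reverses the direction of the arc.
  have h2 : z ^ 2 * arcTangent (-φ) = -arcTangent φ := by
    rw [hzdef, arcCoord_zero_mul_arcTangent]
    linear_combination Complex.I ^ 2 * arcTangent φ * arcTangent_mul_arcTangent_neg φ +
      arcTangent φ * Complex.I_sq
  rw [arcCoord_neg, ← hzdef, potential, potential, e, h1]
  have h3 : conj (-1 / z) = -1 / conj z := by simp
  rw [h3]
  set Q := eichlerIntegral m (B (D.S j)) (-1 / conj z) (-1 / z)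
  simp only [map_sub, map_mul, map_pow, Complex.conj_conj]
  linear_combination (D.s (D.S j) * (D.f j ∘ ofComplex) z * z ^ m * conj Q) * h2

theorem intervalIntegral_add_reflected (hB : D.NormalizedPrimitives B) (j : ι) {a b : ℝ}
    (ha : a ∈ Set.Icc (-(Real.pi / 6)) (Real.pi / 6))
    (hb : b ∈ Set.Icc (-(Real.pi / 6)) (Real.pi / 6)) :
    (∫ φ in a..b, potential m (D.f j ∘ ofComplex) (B j) (arcCoord (φ, 0)) * arcTangent φ) +
      (∫ φ in -b..-a, potential m (D.f (D.S j) ∘ ofComplex) (B (D.S j)) (arcCoord (φ, 0)) *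
        arcTangent φ) =
    ∫ φ in a..b, (D.f j ∘ ofComplex) (arcCoord (φ, 0)) *
      conj (periodPolynomial m (D.period B j) (conj (arcCoord (φ, 0)))) * arcTangent φ := by
  have hsub := Set.uIcc_subset_Icc ha hb
  have hcont := fun l => hB.continuousOn_potential_arc l
  rw [← intervalIntegral.integral_comp_neg (a := a) (b := b) fun φ =>
    potential m (D.f (D.S j) ∘ ofComplex) (B (D.S j)) (arcCoord (φ, 0)) * arcTangent φ,
    ← intervalIntegral.integral_add]
  · exact intervalIntegral.integral_congr fun φ hφ =>
      hB.potential_add_potential_reflected j (hsub hφ)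
  · exact ((hcont j).mono hsub).intervalIntegrable
  · refine ContinuousOn.intervalIntegrable ?_
    refine (hcont (D.S j)).comp continuous_neg.continuousOn fun φ hφ => ?_
    have := hsub hφ
    exact ⟨by linarith [this.2], by linarith [this.1]⟩

end NormalizedPrimitives

end SlashSystem

/-! ### Identification of the periods and summation over the indices. -/

namespace SlashSystem

open CompletedHalfPlane

variable {ι : Type*} {m : ℕ} {D : SlashSystem ι m} {B : ι → ℕ → ℂ → ℂ}

theorem integralConverges_I_infty {j : ι} (hj : j ∉ D.E) (n : ℕ) :
    IntegralConverges ptI ptInfty (powMul n (D.g j)) :=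
  integralConverges_vertical (D.differentiableOn_g j).continuousOn (D.expDecay_g j hj) n
    I_mem_cuspStrip

theorem integralConverges_infty_zero {j : ι} (hj : j ∉ D.E) (hSj : D.S j ∉ D.E) (n : ℕ) :
    IntegralConverges ptInfty ptZero (powMul n (D.g j)) :=
  integralConverges_zeroPath (D.differentiableOn_g j).continuousOn (D.expDecay_g j hj)
    ((subExp_const (D.s j)).mul_expDecay (D.expDecay_g _ hSj)) (D.g_neg_one_div j) n

theorem reducesToSingleIntegrals_of_mem {j : ι} (hj : j ∈ D.E) :
    ReducesToSingleIntegrals (m + 2) (D.f j) (D.g j) ptRho1 ptInfty ptI ptI1 :=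
  .of_converges m
    (fun n _ => integralConverges_vertical (D.differentiableOn_f j).continuousOn
      (D.expDecay_f j hj) n rho_add_one_mem_cuspStrip)
    fun n _ => integralConverges_segment (D.differentiableOn_g j).continuousOn n _ _

theorem reducesToSingleIntegrals_of_notMem {j : ι} (hj : j ∉ D.E) :
    ReducesToSingleIntegrals (m + 2) (D.f j) (D.g j) ptRho1 ptRho ptI ptInfty :=
  .of_converges m
    (fun n _ => integralConverges_segment (D.differentiableOn_f j).continuousOn n _ _)
    fun n _ => integralConverges_I_infty hj n

theorem reducesToSingleIntegrals_of_notMem_notMem {j : ι} (hj : j ∉ D.E) (hSj : D.S j ∉ D.E) :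
    ReducesToSingleIntegrals (m + 2) (D.f j) (D.g j) ptRho ptI ptInfty ptZero :=
  .of_converges m
    (fun n _ => integralConverges_segment (D.differentiableOn_f j).continuousOn n _ _)
    fun n _ => integralConverges_infty_zero hj hSj n

namespace NormalizedPrimitives

theorem singleIntegral_I_infty (hB : D.NormalizedPrimitives B) {j : ι} (hj : j ∉ D.E)
    (hSj : D.S j ∈ D.E) {n : ℕ} (hn : n ≤ m) :
    singleIntegral n ptI ptInfty (D.g j) = -D.period B j n := by
  rw [ptI, ptInfty, singleIntegral_vertical (D.differentiableOn_g j).continuousOn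
    (D.expDecay_g j hj) (hB.isPrimitiveFamily j) n (L := 0) (by simpa using hB.expDecay j hj n)
    I_mem_cuspStrip, hB.period_eq_of_mem hSj hn, zero_sub]
  rfl

/-- The primitive for S(j) vanishes at i∞, so the reflected one vanishes at 0, and the period is the
integral from i∞ to 0. -/
theorem singleIntegral_infty_zero (hB : D.NormalizedPrimitives B) {j : ι} (hj : j ∉ D.E)
    (hSj : D.S j ∉ D.E) {n : ℕ} (hn : n ≤ m) :
    singleIntegral n ptInfty ptZero (D.g j) = D.period B j n := by
  refine singleIntegral_zeroPath (hB.isPrimitiveFamily j) (hB.isPrimitiveFamily_reflected j) n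
    (integralConverges_infty_zero hj hSj n) (hB.expDecay j hj n) ?_
  simp only [reflected, if_pos hn]
  have h : Filter.Tendsto (fun s : ℝ => B (D.S j) (m - n) (-1 / (s * Complex.I)))
      (nhdsWithin 0 (Set.Ioi 0)) (nhds 0) := by
    have e : ∀ s : ℝ, (-1 / (s * Complex.I)) = ((s⁻¹ : ℝ) : ℂ) * Complex.I := by
      intro s
      rw [div_mul_eq_div_div_swap, Complex.div_I]
      push_cast
      ring
    simp only [e]
    refine (hB.expDecay _ hSj (m - n)).tendsto_zero ?_ ?_
    · filter_upwards [Ioo_mem_nhdsGT (zero_lt_one' ℝ)] with s hs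
      constructor
      · simp
      · have : 1 ≤ s⁻¹ := (one_le_inv₀ hs.1).2 hs.2.le
        simp only [Complex.im_ofReal_mul, Complex.I_im, mul_one]
        linarith
    · simpa using tendsto_inv_nhdsGT_zero (𝕜 := ℝ)
  simpa using (h.const_mul _).const_mul _

/-- Both paths are reversed, ρ + 1 to ρ against the direction of φ and i to i∞ against the period,
so two signs cancel. -/
theorem doubleIntegral_full_arc (hB : D.NormalizedPrimitives B) {j : ι} (hj : j ∉ D.E)
    (hSj : D.S j ∈ D.E) :
    doubleIntegral (m + 2) (D.f j) (D.g j) ptRho1 ptRho ptI ptInfty =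
      ∫ φ in -(Real.pi / 6)..(Real.pi / 6), (D.f j ∘ ofComplex) (arcCoord (φ, 0)) *
        conj (periodPolynomial m (D.period B j) (conj (arcCoord (φ, 0)))) * arcTangent φ := by
  have hpi : -(Real.pi / 6) ≤ Real.pi / 6 := by linarith [Real.pi_pos]
  rw [ptRho1, ptRho, doubleIntegral_arc (D.differentiableOn_f j) ⟨hpi, le_rfl⟩ ⟨le_rfl, hpi⟩
    (by simp [arcCoord_pi_div_six]) (by simp [arcCoord_neg_pi_div_six, arcCoord_pi_div_six])
    (fun n _ => integralConverges_I_infty hj n), intervalIntegral.integral_symm,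
    ← intervalIntegral.integral_neg]
  refine intervalIntegral.integral_congr fun φ _ => ?_
  rw [periodPolynomial_congr (fun n hn => hB.singleIntegral_I_infty hj hSj hn),
    periodPolynomial_neg]
  simp

theorem doubleIntegral_half_arc (hB : D.NormalizedPrimitives B) {j : ι} (hj : j ∉ D.E)
    (hSj : D.S j ∉ D.E) :
    doubleIntegral (m + 2) (D.f j) (D.g j) ptRho ptI ptInfty ptZero =
      ∫ φ in -(Real.pi / 6)..0, (D.f j ∘ ofComplex) (arcCoord (φ, 0)) *
        conj (periodPolynomial m (D.period B j) (conj (arcCoord (φ, 0)))) * arcTangent φ := by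
  have hpi : 0 < Real.pi := Real.pi_pos
  rw [ptRho, ptI, doubleIntegral_arc (D.differentiableOn_f j) ⟨le_rfl, by linarith⟩
    (φ₂ := 0) ⟨by linarith, by linarith⟩
    (by simp [arcCoord_neg_pi_div_six, arcCoord_pi_div_six]) (by simp [arcCoord])
    (fun n _ => integralConverges_infty_zero hj hSj n)]
  refine intervalIntegral.integral_congr fun φ _ => ?_
  rw [periodPolynomial_congr (fun n hn => hB.singleIntegral_infty_zero hj hSj hn)]

variable [Fintype ι] [DecidableEq ι]

/-- W denotes arc integrals of the potentials and K the integrals after pairing j with S(j). Summing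
the pairings over all j gives ∑ K_j over the left half arc, and K_j on the left half equals K_{S(j)}
on the right half. -/
theorem sum_arc (hB : D.NormalizedPrimitives B) :
    ∑ j, ∫ φ in -(Real.pi / 6)..(Real.pi / 6),
      potential m (D.f j ∘ ofComplex) (B j) (arcCoord (φ, 0)) * arcTangent φ =
    ∑ j with j ∉ D.E ∧ D.S j ∈ D.E,
      doubleIntegral (m + 2) (D.f j) (D.g j) ptRho1 ptRho ptI ptInfty +
    ∑ j with j ∉ D.E ∧ D.S j ∉ D.E,
      doubleIntegral (m + 2) (D.f j) (D.g j) ptRho ptI ptInfty ptZero := by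
  set c := Real.pi / 6 with hc
  have hc0 : 0 < c := by positivity
  have hm : -c ∈ Set.Icc (-c) c := ⟨le_rfl, by linarith⟩
  have hz : 0 ∈ Set.Icc (-c) c := ⟨by linarith, by linarith⟩
  have hp : c ∈ Set.Icc (-c) c := ⟨by linarith, le_rfl⟩
  set W : ι → ℝ → ℝ → ℂ := fun j a b => ∫ φ in a..b,
    potential m (D.f j ∘ ofComplex) (B j) (arcCoord (φ, 0)) * arcTangent φ with hW
  set K : ι → ℝ → ℝ → ℂ := fun j a b => ∫ φ in a..b, (D.f j ∘ ofComplex) (arcCoord (φ, 0)) *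
        conj (periodPolynomial m (D.period B j) (conj (arcCoord (φ, 0)))) * arcTangent φ with hK
  have hsplit : ∀ j, W j (-c) c = W j (-c) 0 + W j 0 c := fun j =>
    (intervalIntegral.integral_add_adjacent_intervals
      (((hB.continuousOn_potential_arc j).mono (Set.uIcc_subset_Icc hm hz)).intervalIntegrable)
      (((hB.continuousOn_potential_arc j).mono (Set.uIcc_subset_Icc hz hp)).intervalIntegrable)).symm
  have hleft : ∀ j, W j (-c) 0 + W (D.S j) 0 c = K j (-c) 0 := fun j => by
    have := hB.intervalIntegral_add_reflected j hm hz
    rwa [neg_zero, neg_neg] at this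
  have hright : ∀ j, W (D.S j) (-c) 0 + W j 0 c = K j 0 c := fun j => by
    have := hB.intervalIntegral_add_reflected j hz hp
    rwa [neg_zero, add_comm] at this
  have hfull : ∀ j, K j 0 c + K j (-c) 0 = K j (-c) c := fun j => by
    have := hB.intervalIntegral_add_reflected j hm hp
    rw [neg_neg] at this
    change W j (-c) c + W (D.S j) (-c) c = K j (-c) c at this
    rw [← this, ← hleft, ← hright, hsplit, hsplit]
    ring
  have h1 : ∑ j, W j (-c) c = ∑ j, K j (-c) 0 := by
    simp only [← hleft, hsplit, Finset.sum_add_distrib]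
    rw [Equiv.sum_comp D.S fun j => W j 0 c]
  -- Each left half with j ∈ E is credited to S(j) as a right half. An index j ∉ E with S(j) ∈ E
  -- thus collects the full arc.
  have h2 : ∑ j, K j (-c) 0 =
      ∑ j, ((if D.S j ∈ D.E then K j 0 c else 0) + if j ∉ D.E then K j (-c) 0 else 0) := by
    rw [Finset.sum_add_distrib]
    have e : ∀ j, (if D.S j ∈ D.E then K j 0 c else 0) =
        (fun l => if l ∈ D.E then K l (-c) 0 else 0) (D.S j) := fun j => by
      simp only [← hleft, ← hright, D.S_S]
    simp only [e]
    rw [Equiv.sum_comp D.S fun l => if l ∈ D.E then K l (-c) 0 else 0, ← Finset.sum_add_distrib]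
    refine Finset.sum_congr rfl fun j _ => ?_
    by_cases hj : j ∈ D.E <;> simp [hj]
  rw [h1, h2, Finset.sum_filter, Finset.sum_filter, ← Finset.sum_add_distrib]
  refine Finset.sum_congr rfl fun j _ => ?_
  by_cases hj : j ∈ D.E <;> by_cases hSj : D.S j ∈ D.E
  -- Both base points are i, so the period vanishes and the credited right half is 0.
  · have h0 : ∀ w, periodPolynomial m (D.period B j) w = 0 := fun w => by
      rw [periodPolynomial_congr (d' := fun _ => 0) fun n hn => by
        rw [hB.period_eq_of_mem hSj hn, hB.eq_zero j hj], periodPolynomial_zero]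
    simp [hj, hSj, hK, h0]
  · simp [hj, hSj]
  · simp only [hj, hSj, if_true, not_false_eq_true, not_true_eq_false, if_false, add_zero,
      and_self, and_false]
    rw [hfull, hB.doubleIntegral_full_arc hj hSj]
  · simp only [hj, hSj, if_true, not_false_eq_true, if_false, zero_add, and_self, and_false]
    rw [hB.doubleIntegral_half_arc hj hSj]

end NormalizedPrimitives

theorem sum_eq_sum_doubleIntegral (D : SlashSystem ι m) [Fintype ι] [DecidableEq ι] :
    ∑ j, 2 * Complex.I * ∫ p in arcRegion,
      arcIntegrand m (D.f j ∘ ofComplex) (D.g j ∘ ofComplex) p =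
    (∑ j with j ∈ D.E, doubleIntegral (m + 2) (D.f j) (D.g j) ptRho1 ptInfty ptI ptI1) +
    (∑ j with j ∉ D.E ∧ D.S j ∈ D.E,
      doubleIntegral (m + 2) (D.f j) (D.g j) ptRho1 ptRho ptI ptInfty) +
    (∑ j with j ∉ D.E ∧ D.S j ∉ D.E,
      doubleIntegral (m + 2) (D.f j) (D.g j) ptRho ptI ptInfty ptZero) := by
  obtain ⟨B, hB⟩ := D.exists_normalizedPrimitives
  simp only [hB.stokes, Finset.sum_add_distrib]
  rw [hB.sum_arc, hB.sum_vertical]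
  ring

end SlashSystem

/-! ### The Petersson product of modular forms -/

section

variable {N m : ℕ} {χ : DirichletCharacter ℂ N}
  {f g : ModularForm ((Gamma1 N).map (mapGL ℝ)) ((m + 2 : ℕ) : ℤ)}

theorem CosetReps.translate_add_one (R : CosetReps N)
    (hf : f ∈ modularFormsWithCharacter N χ (m + 2 : ℕ)) (j : Fin R.r) (z : ℂ) (hz : 0 < z.im) :
    (R.translate (m + 2) f j ∘ ofComplex) (z + 1) = R.factor χ ModularGroup.T j *
      (R.translate (m + 2) f (R.act ModularGroup.T j) ∘ ofComplex) z := by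
  rw [← slash_T_ofComplex (m + 2) _ hz, R.translate_slash hf]
  rfl

theorem CosetReps.translate_neg_one_div (R : CosetReps N)
    (hf : f ∈ modularFormsWithCharacter N χ (m + 2 : ℕ)) (j : Fin R.r) (z : ℂ) (hz : 0 < z.im) :
    (R.translate (m + 2) f j ∘ ofComplex) (-1 / z) = z ^ (m + 2) * (R.factor χ ModularGroup.S j *
      (R.translate (m + 2) f (R.act ModularGroup.S j) ∘ ofComplex) z) := by
  rw [slash_S_ofComplex (m + 2) _ hz, R.translate_slash hf]
  rfl

theorem CosetReps.mem_vanishing (R : CosetReps N) (k : ℕ) (f : ℍ → ℂ) (j : Fin R.r) :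
    j ∈ R.vanishing k f ↔ IsZeroAtImInfty (R.translate k f j) := by
  simp [CosetReps.vanishing]

/-- The translates `f_j` and `g_j` of two modular forms. -/
noncomputable def CosetReps.slashSystem [NeZero N] (R : CosetReps N)
    (hf : f ∈ modularFormsWithCharacter N χ (m + 2 : ℕ))
    (hg : g ∈ modularFormsWithCharacter N χ (m + 2 : ℕ))
    (h : ∀ j, IsZeroAtImInfty (R.translate (m + 2) f j) ∨
      IsZeroAtImInfty (R.translate (m + 2) g j)) : SlashSystem (Fin R.r) m where
  f := R.translate (m + 2) f
  g := R.translate (m + 2) g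
  E := R.vanishing (m + 2) f
  T := R.actPerm ModularGroup.T
  S := R.actPerm ModularGroup.S
  t := R.factor χ ModularGroup.T
  s := R.factor χ ModularGroup.S
  t_mul_conj := R.factor_mul_conj χ _
  s_mul_conj := R.factor_mul_conj χ _
  S_S := R.act_S_act_S
  T_mem j := by
    rw [R.mem_vanishing, R.mem_vanishing]
    exact R.isZeroAtImInfty_act_T hf j
  differentiableOn_f := R.differentiableOn_translate f
  differentiableOn_g := R.differentiableOn_translate g
  subExp_f := R.subExp_translate f
  subExp_g := R.subExp_translate g
  expDecay_f j hj := R.expDecay_translate hf ((R.mem_vanishing _ _ _).1 hj)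
  expDecay_g j hj := R.expDecay_translate hg
    ((h j).resolve_left fun h0 => hj ((R.mem_vanishing _ _ _).2 h0))
  f_add_one := R.translate_add_one hf
  g_add_one := R.translate_add_one hg
  f_neg_one_div := R.translate_neg_one_div hf
  g_neg_one_div := R.translate_neg_one_div hg

end

theorem mainTheorem2 (N : ℕ) [NeZero N] (χ : DirichletCharacter ℂ N) (k : ℕ) (hk : 2 ≤ k)
    (f g : ModularForm ((Gamma1 N).map (mapGL ℝ)) (k : ℤ))
    (hf : f ∈ modularFormsWithCharacter N χ k) (hg : g ∈ modularFormsWithCharacter N χ k)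
    (F : Set ℍ) (hF : IsFundamentalDomainGamma0 N F) (R : CosetReps N)
    (fj gj : Fin R.r → ℍ → ℂ) (hfj : fj = R.translate k f) (hgj : gj = R.translate k g)
    (E SE : Finset (Fin R.r)) (hE : E = R.vanishing k f)
    (hSE : SE = E.image (R.act ModularGroup.S)) :
    (PeterssonConverges k F f g ↔ VanishAtEachCusp N k f g) ∧
    (PeterssonConverges k F f g →
      (R.r : ℂ) * (2 * Complex.I) ^ (k - 1) * peterssonProduct N k F f g =
          (∑ j with j ∈ E, doubleIntegral k (fj j) (gj j) ptRho1 ptInfty ptI ptI1)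
        + (∑ j with j ∉ E ∧ j ∈ SE, doubleIntegral k (fj j) (gj j) ptRho1 ptRho ptI ptInfty)
        + (∑ j with j ∉ E ∧ j ∉ SE, doubleIntegral k (fj j) (gj j) ptRho ptI ptInfty ptZero) ∧
      (∀ j, j ∈ E →
        ReducesToSingleIntegrals k (fj j) (gj j) ptRho1 ptInfty ptI ptI1) ∧
      (∀ j, j ∉ E → j ∈ SE →
        ReducesToSingleIntegrals k (fj j) (gj j) ptRho1 ptRho ptI ptInfty) ∧
      (∀ j, j ∉ E → j ∉ SE →
        ReducesToSingleIntegrals k (fj j) (gj j) ptRho ptI ptInfty ptZero)) := by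
  obtain ⟨m, rfl⟩ := Nat.exists_eq_add_of_le' hk
  subst hfj hgj
  have hiff := R.peterssonConverges_iff hf hg hF
  refine ⟨hiff.trans (R.vanishAtEachCusp_iff hf hg).symm, fun hc => ?_⟩
  set D := R.slashSystem hf hg (hiff.1 hc) with hD
  -- S acts on the indices as an involution, so image and preimage of E agree.
  have hmem : ∀ j, j ∈ SE ↔ D.S j ∈ D.E := by
    intro j
    subst hSE hE
    rw [Finset.mem_image]
    constructor
    · rintro ⟨i, hi, rfl⟩
      change R.act ModularGroup.S (R.act ModularGroup.S i) ∈ _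
      rw [R.act_S_act_S]
      exact hi
    · intro h
      exact ⟨_, h, R.act_S_act_S j⟩
  subst hE
  refine ⟨?_, fun j hj => D.reducesToSingleIntegrals_of_mem hj,
    fun j hj _ => D.reducesToSingleIntegrals_of_notMem hj,
    fun j hj hSj => D.reducesToSingleIntegrals_of_notMem_notMem hj fun h => hSj ((hmem j).2 h)⟩
  simp only [hmem]
  rw [show m + 2 - 1 = m + 1 from rfl, R.peterssonProduct_eq hf hg hF hc]
  exact D.sum_eq_sum_doubleIntegral
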